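/- Let $p$ be a prime, let $K\subset\overline{\mathbf Q}_p$ be a finite extension of $\mathbf Q_p$ with ramification index $e$, ring of integers $\mathcal O_K$ and uniformizer $\pi$, and let $K_0$ be its maximal unramified subextension. Let $K_\infty/K$ be a Galois extension inside $\overline{\mathbf Q}_p$ whose Galois group $\Gamma_K=\mathrm{Gal}(K_\infty/K)$ is a $p$-adic Lie group of dimension $d$, and put $G_K=\mathrm{Gal}(\overline{\mathbf Q}_p/K)$, $H_K=\mathrm{Gal}(\overline{\mathbf Q}_p/K_\infty)$. If $G_K$ acts on $R$, write $R_K=R^{H_K}$, on which $\Gamma_K$ acts. Choose an open uniform pro-$p$ subgroup $\Gamma_0$ of $\Gamma_K$ with a coordinate (a homeomorphism) $c:\Gamma_0\to\mathbf Z_p^d$ such that, for $\Gamma_i=\{g^{p^i}: g\in\Gamma_0\}$, one has $c(\Gamma_i)=(p^i\mathbf Z_p)^d$, and $gh^{-1}\in\Gamma_i$ if and only if $c(g)-c(h)\in(p^i\mathbf Z_p)^d$. On $\Gamma_m$ use the coordinate $p^{-m}c:\Gamma_m\to\mathbf Z_p^d$. Rings. Let $\tilde{\mathbf E}^+$ be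 the tilt of $\mathcal O_{\mathbf C_p}$, with fraction field $\tilde{\mathbf E}$ and valuation $v_{\mathbf E}$ induced by the valuation of $\mathbf C_p$ with $v_p(p)=1$. Let $\tilde{\mathbf A}^+=\mathcal O_K\otimes_{\mathcal O_{K_0}}W(\tilde{\mathbf E}^+)$, $\tilde{\mathbf A}=\mathcal O_K\otimes_{\mathcal O_{K_0}}W(\tilde{\mathbf E})$ and $\tilde{\mathbf B}=\tilde{\mathbf A}[1/\pi]$; each $x\in\tilde{\mathbf B}$ is uniquely $x=\sum_{k\gg-\infty}\pi^k[x_k]$ with $x_k\in\tilde{\mathbf E}$. For $r>0$ put $V(x,r)=\inf_k\bigl(\tfrac ke+\tfrac{p-1}{pr}v_{\mathbf E}(x_k)\bigr)$, and for $0<r\le s$ put $V(x,[r,s])=\inf_{t\in[r,s]}V(x,t)$. Fix $\varpi\in\tilde{\mathbf E}^+$ with $0<v_{\mathbf E}(\varpi)<\infty$. For $r>0$ let $\tilde{\mathbf A}^{\dagger,r}$ be the set of $x=\sum_{k\ge0}\pi^k[x_k]\in\tilde{\mathbf A}$ such that $v_{\mathbf E}(x_k)+\tfrac{prk}{(p-1)e}$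 is $\ge0$ for all $k$ and tends to $+\infty$. Let $r_0=\tfrac{p-1}{p}$ and, for $\rho>0$ and $r=r_0/\rho$, let $\tilde{\mathbf A}^{(0,\rho]}=\tilde{\mathbf A}^{\dagger,r}[1/[\varpi]]$, with the valuation $v_\rho=\tfrac{r}{r_0}V(\cdot,r)$. Let $\tilde{\mathbf A}^\dagger=\bigcup_{\rho>0}\tilde{\mathbf A}^{(0,\rho]}$. Let $\tilde{\mathbf B}^{[r,s]}$ be the completion of $\tilde{\mathbf A}^+[1/\pi,1/[\varpi]]$ for $V(\cdot,[r,s])$, $\tilde{\mathbf B}_{\mathrm{rig}}^{\dagger,r}=\varprojlim_{s\ge r}\tilde{\mathbf B}^{[r,s]}$ and $\tilde{\mathbf B}_{\mathrm{rig}}^\dagger=\bigcup_{r>0}\tilde{\mathbf B}_{\mathrm{rig}}^{\dagger,r}$. An element $x=\sum_{k\ge0}\pi^k[x_k]$ of $\tilde{\mathbf A}$ is regarded as an element of $\tilde{\mathbf B}_{\mathrm{rig}}^{\dagger,r}$ when this series converges there. Locally analytic vectors, integral sense. Let $x\in\tilde{\mathbf A}_K^{(0,\rho]}$. For $m\ge0$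 let $F:\mathbf Z_p^d\to\tilde{\mathbf A}_K^{(0,\rho]}$ be the map $g\mapsto g(x)$ on $\Gamma_m$ read in the coordinate $p^{-m}c$, and let $a_n(F)=\sum_{k\le n}\prod_i(-1)^{n_i-k_i}\binom{n_i}{k_i}F(k)$, $n\in\mathbf N^d$, be its Mahler coefficients. Then $x$ is locally analytic if there are $m\ge0$ and $\lambda,\mu\in\mathbf R$ such that $F$ is continuous for $v_\rho$ and $v_\rho(a_n(F))\ge p^\lambda p^{\lfloor\log_p|n|_\infty\rfloor}+\mu$ for all $n\in\mathbf N^d$, where $|n|_\infty=\max_i n_i$ and $p^{\lfloor\log_p 0\rfloor}=0$. Let $(\tilde{\mathbf A}_K^\dagger)^{\Gamma_K\text{-la}}=\bigcup_{\rho>0}(\tilde{\mathbf A}_K^{(0,\rho]})^{\Gamma_K\text{-la}}$. Pro-analytic vectors. A vector $y\in\tilde{\mathbf B}_K^{[r,s]}$ is locally analytic if there are $m\ge0$ and a family $(w_k)_{k\in\mathbf N^d}$ in $\tilde{\mathbf B}_K^{[r,s]}$ that tends to $0$ such that $g(y)=\sum_k (p^{-m}c(g))^k\,w_k$ for all $g\in\Gamma_m$.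 A vector of $\tilde{\mathbf B}_{\mathrm{rig},K}^{\dagger,r}$ is pro-analytic if its image in $\tilde{\mathbf B}_K^{[r,s]}$ is locally analytic for every $s\ge r$, and $(\tilde{\mathbf B}_{\mathrm{rig},K}^{\dagger})^{\Gamma_K\text{-pa}}=\bigcup_{r>0}(\tilde{\mathbf B}_{\mathrm{rig},K}^{\dagger,r})^{\Gamma_K\text{-pa}}$. Then: (1) for every $x\in\tilde{\mathbf A}_K^\dagger$, one has $x\in(\tilde{\mathbf A}_K^\dagger)^{\Gamma_K\text{-la}}$ if and only if $x\in(\tilde{\mathbf B}_{\mathrm{rig},K}^\dagger)^{\Gamma_K\text{-pa}}$; (2) $(\tilde{\mathbf A}_K^\dagger)^{\Gamma_K\text{-la}}=\tilde{\mathbf A}^\dagger\cap(\tilde{\mathbf B}_{\mathrm{rig},K}^\dagger)^{\Gamma_K\text{-pa}}$. -/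

import Mathlib

open scoped NNReal TensorProduct

namespace PeriodRings

noncomputable section

/-! ### Ramified Witt vectors -/

section Ramified

variable {p : ℕ} [Fact p.Prime] {O : Type} [CommRing O] [Fact (¬IsUnit (p : O))]
  [IsAdicComplete (Ideal.span {(p : O)}) O]
  {R : Type} [CommRing R] {S : Type} [CommRing S]

/-- For `ι : O♭ →+* R`, the ring `O ⊗_{W(O♭)} W(R)`. The left map is Fontaine's
`θ : W(O♭) → O`, the right one is `W(ι)`. If `O` is the ring of integers of a finite extension of
`ℚ_p`, then `O♭ = lim_{x ↦ x^p} O/p` is the residue field `k` of `O`, and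
`θ : W(k) → O` is the inclusion of the ring of integers of the maximal unramified subextension. -/
def RamWitt (ι : PreTilt O p →+* R) : Type :=
  letI : Algebra (WittVector p (PreTilt O p)) O := (WittVector.fontaineTheta O p).toAlgebra
  letI : Algebra (WittVector p (PreTilt O p)) (WittVector p R) :=
    (WittVector.map ι).toAlgebra
  O ⊗[WittVector p (PreTilt O p)] WittVector p R

variable (ι : PreTilt O p →+* R) (ι' : PreTilt O p →+* S)

/-- The ring structure of the tensor product. -/
def RamWitt.commRing : CommRing (RamWitt ι) :=
  @Algebra.TensorProduct.instCommRing (WittVector p (PreTilt O p)) O (WittVector p R) _ _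
    (WittVector.fontaineTheta O p).toAlgebra _ (WittVector.map ι).toAlgebra

instance : CommRing (RamWitt ι) := RamWitt.commRing ι

namespace RamWitt

/-- `c ↦ c ⊗ 1`. -/
def ofInt : O →+* RamWitt ι :=
  letI : Algebra (WittVector p (PreTilt O p)) O := (WittVector.fontaineTheta O p).toAlgebra
  letI : Algebra (WittVector p (PreTilt O p)) (WittVector p R) :=
    (WittVector.map ι).toAlgebra
  (Algebra.TensorProduct.includeLeftRingHom :
    O →+* O ⊗[WittVector p (PreTilt O p)] WittVector p R)

/-- `w ↦ 1 ⊗ w`. -/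
def ofWitt : WittVector p R →+* RamWitt ι :=
  letI : Algebra (WittVector p (PreTilt O p)) O := (WittVector.fontaineTheta O p).toAlgebra
  letI : Algebra (WittVector p (PreTilt O p)) (WittVector p R) :=
    (WittVector.map ι).toAlgebra
  (Algebra.TensorProduct.includeRight :
    WittVector p R →ₐ[WittVector p (PreTilt O p)]
      O ⊗[WittVector p (PreTilt O p)] WittVector p R).toRingHom

/-- The Teichmüller representative `[a]`. -/
def teich (a : R) : RamWitt ι := ofWitt ι (WittVector.teichmuller p a)

theorem ofInt_theta (w : WittVector p (PreTilt O p)) :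
    ofInt ι (WittVector.fontaineTheta O p w) = ofWitt ι (WittVector.map ι w) := by
  letI : Algebra (WittVector p (PreTilt O p)) O := (WittVector.fontaineTheta O p).toAlgebra
  letI : Algebra (WittVector p (PreTilt O p)) (WittVector p R) :=
    (WittVector.map ι).toAlgebra
  exact (Algebra.TensorProduct.tmul_one_eq_one_tmul
    (A := O) (B := WittVector p R) w)

theorem induction_on {P : RamWitt ι → Prop} (x : RamWitt ι)
    (tmul : ∀ c w, P (ofInt ι c * ofWitt ι w)) (add : ∀ x y, P x → P y → P (x + y)) : P x := by
  letI : Algebra (WittVector p (PreTilt O p)) O := (WittVector.fontaineTheta O p).toAlgebra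
  letI : Algebra (WittVector p (PreTilt O p)) (WittVector p R) :=
    (WittVector.map ι).toAlgebra
  have key : ∀ (c : O) (w : WittVector p R),
      (ofInt ι c * ofWitt ι w : RamWitt ι) =
        (c ⊗ₜ[WittVector p (PreTilt O p)] w : O ⊗[WittVector p (PreTilt O p)] WittVector p R) := by
    intro c w
    change ((c ⊗ₜ[WittVector p (PreTilt O p)] (1 : WittVector p R)) *
      ((1 : O) ⊗ₜ[WittVector p (PreTilt O p)] w) :
        O ⊗[WittVector p (PreTilt O p)] WittVector p R) = _
    rw [Algebra.TensorProduct.tmul_mul_tmul, mul_one, one_mul]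
  have h : ∀ z : O ⊗[WittVector p (PreTilt O p)] WittVector p R, P z := by
    intro z
    induction z using TensorProduct.induction_on with
    | zero =>
      have := tmul 0 0
      rw [map_zero, zero_mul] at this
      exact this
    | tmul c w => rw [← key]; exact tmul c w
    | add x y hx hy => exact add x y hx hy
  exact h x

/-- A ring homomorphism out of `O ⊗ W(R)`. -/
def lift {C : Type} [CommRing C] (f : O →+* C) (g : WittVector p R →+* C)
    (h : ∀ w, f (WittVector.fontaineTheta O p w) = g (WittVector.map ι w)) : RamWitt ι →+* C :=
  letI : Algebra (WittVector p (PreTilt O p)) O := (WittVector.fontaineTheta O p).toAlgebra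
  letI : Algebra (WittVector p (PreTilt O p)) (WittVector p R) :=
    (WittVector.map ι).toAlgebra
  letI : Algebra (WittVector p (PreTilt O p)) C :=
    (f.comp (WittVector.fontaineTheta O p)).toAlgebra
  (Algebra.TensorProduct.lift
    ({ f with commutes' := fun _ => rfl } : O →ₐ[WittVector p (PreTilt O p)] C)
    ({ g with commutes' := fun w => (h w).symm } :
      WittVector p R →ₐ[WittVector p (PreTilt O p)] C)
    (fun _ _ => Commute.all _ _) :
    O ⊗[WittVector p (PreTilt O p)] WittVector p R →ₐ[WittVector p (PreTilt O p)] C).toRingHom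

variable {C : Type} [CommRing C] (f : O →+* C) (g : WittVector p R →+* C)
    (h : ∀ w, f (WittVector.fontaineTheta O p w) = g (WittVector.map ι w))

@[simp] theorem lift_ofInt (c : O) : lift ι f g h (ofInt ι c) = f c := by
  letI : Algebra (WittVector p (PreTilt O p)) O := (WittVector.fontaineTheta O p).toAlgebra
  letI : Algebra (WittVector p (PreTilt O p)) (WittVector p R) :=
    (WittVector.map ι).toAlgebra
  letI : Algebra (WittVector p (PreTilt O p)) C :=
    (f.comp (WittVector.fontaineTheta O p)).toAlgebra
  change f c * g 1 = f c
  rw [map_one, mul_one]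

@[simp] theorem lift_ofWitt (w : WittVector p R) : lift ι f g h (ofWitt ι w) = g w := by
  change f 1 * g w = g w
  rw [map_one, one_mul]

/-- Functoriality in `R`: the map `id ⊗ W(f)`. -/
def map (f : R →+* S) (hf : f.comp ι = ι') : RamWitt ι →+* RamWitt ι' :=
  lift ι (ofInt ι') ((ofWitt ι').comp (WittVector.map f)) (by
    intro w
    rw [ofInt_theta, ← hf, RingHom.comp_apply]
    congr 1)

variable {ι ι'}

@[simp] theorem map_ofInt (f : R →+* S) (hf : f.comp ι = ι') (c : O) :
    map ι ι' f hf (ofInt ι c) = ofInt ι' c := lift_ofInt _ _ _ _ _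

@[simp] theorem map_ofWitt (f : R →+* S) (hf : f.comp ι = ι') (w : WittVector p R) :
    map ι ι' f hf (ofWitt ι w) = ofWitt ι' (WittVector.map f w) := lift_ofWitt _ _ _ _ _

@[simp] theorem map_teich (f : R →+* S) (hf : f.comp ι = ι') (a : R) :
    map ι ι' f hf (teich ι a) = teich ι' (f a) := by
  simp [teich]

theorem teich_mul (a b : R) : teich ι (a * b) = teich ι a * teich ι b := by simp [teich]

theorem teich_one : teich ι (1 : R) = 1 := by simp [teich]

theorem teich_zero : teich ι (0 : R) = 0 := by simp [teich]


variable (ι ι')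

/-- The hypotheses on `π` under which the elements of `O ⊗ W(R)` have unique expansions
`∑ π^k [a_k]`; they are verified below for a uniformizer of the ring of integers of a finite
extension of `ℚ_p`. -/
structure Good (p : ℕ) [Fact p.Prime] {O : Type} [CommRing O] [Fact (¬IsUnit (p : O))]
    (π : O) : Prop where
  regular : ∀ c, π * c = 0 → c = 0
  dvd : π ∣ (p : O)
  isField : IsField (PreTilt O p)
  bij : Function.Bijective
    (fun t : PreTilt O p => Ideal.Quotient.factor
      ((Ideal.span_singleton_le_span_singleton).2 dvd) (PreTilt.coeff 0 t) : _ → O ⧸ Ideal.span {π})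

/-- `x = ∑_{k ≥ 0} π^k [a_k]` in the `π`-adic sense. -/
def IsExp (π : O) (x : RamWitt ι) (a : ℕ → R) : Prop :=
  ∀ N : ℕ, ∃ y : RamWitt ι,
    x = ∑ k ∈ Finset.range N, ofInt ι π ^ k * teich ι (a k) + ofInt ι π ^ N * y

section Expansions

variable {π : O} (hπ : Good p π) [CharP R p] [PerfectRing R p] [CharP S p] [PerfectRing S p]

theorem exists_red (hπ : Good p π) : ∃ f : RamWitt ι →+* R,
    (∀ w, f (ofWitt ι w) = w.coeff 0) ∧ f (ofInt ι π) = 0 := by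
  let e : PreTilt O p →+* O ⧸ Ideal.span {π} :=
    (Ideal.Quotient.factor ((Ideal.span_singleton_le_span_singleton).2 hπ.dvd)).comp
      (PreTilt.coeff 0)
  let E : PreTilt O p ≃+* O ⧸ Ideal.span {π} := RingEquiv.ofBijective e hπ.bij
  let f : O →+* R := ι.comp (E.symm.toRingHom.comp (Ideal.Quotient.mk (Ideal.span {π})))
  have hE : ∀ w : WittVector p (PreTilt O p),
      E.symm (Ideal.Quotient.mk (Ideal.span {π}) (WittVector.fontaineTheta O p w)) =
        w.coeff 0 := by
    intro w
    rw [RingEquiv.symm_apply_eq]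
    change _ = e (w.coeff 0)
    change _ = Ideal.Quotient.factor ((Ideal.span_singleton_le_span_singleton).2 hπ.dvd)
      (PreTilt.coeff 0 (w.coeff 0))
    rw [← WittVector.mk_fontaineTheta]
    rfl
  refine ⟨lift ι f WittVector.constantCoeff ?_, ?_, ?_⟩
  · intro w
    change ι (E.symm (Ideal.Quotient.mk (Ideal.span {π}) (WittVector.fontaineTheta O p w))) =
      (WittVector.map ι w).coeff 0
    rw [hE, WittVector.map_coeff]
  · intro w
    rw [lift_ofWitt]; rfl
  · rw [lift_ofInt]
    change ι (E.symm (Ideal.Quotient.mk (Ideal.span {π}) π)) = 0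
    rw [Ideal.Quotient.eq_zero_iff_mem.2 (Ideal.mem_span_singleton_self π), map_zero, map_zero]

/-- Reduction modulo `π`. -/
def red : RamWitt ι →+* R := (exists_red ι hπ).choose

theorem red_teich (a : R) : red ι hπ (teich ι a) = a := by
  rw [teich, red, (exists_red ι hπ).choose_spec.1, WittVector.teichmuller_coeff_zero]

theorem red_pi : red ι hπ (ofInt ι π) = 0 := (exists_red ι hπ).choose_spec.2

theorem witt_eq (w : WittVector p R) (a : R) (h : w.coeff 0 = a) :
    ∃ w', w = WittVector.teichmuller p a + p * w' := by
  have h1 : w - WittVector.teichmuller p a ∈ Ideal.span {(p : WittVector p R)} := by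
    rw [WittVector.mem_span_p_iff_coeff_zero_eq_zero]
    have := map_sub (WittVector.constantCoeff (p := p) (R := R)) w (WittVector.teichmuller p a)
    simp only [WittVector.constantCoeff_apply, WittVector.teichmuller_coeff_zero] at this
    rw [this, h, sub_self]
  obtain ⟨w', hw'⟩ := Ideal.mem_span_singleton.1 h1
  exact ⟨w', by rw [← hw']; ring⟩

theorem exists_teich (hπ : Good p π) (x : RamWitt ι) : ∃ a y, x = teich ι a + ofInt ι π * y := by
  obtain ⟨u, hu⟩ := hπ.dvd
  have hp : (p : RamWitt ι) = ofInt ι π * ofInt ι u := by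
    rw [← map_mul, ← hu, map_natCast]
  have hw : ∀ w : WittVector p R, ∃ y, ofWitt ι w = teich ι (w.coeff 0) + ofInt ι π * y := by
    intro w
    obtain ⟨w', hw'⟩ := witt_eq w _ rfl
    refine ⟨ofInt ι u * ofWitt ι w', ?_⟩
    conv_lhs => rw [hw']
    rw [map_add, map_mul, map_natCast, hp, teich]; ring
  induction x using induction_on with
  | tmul c w =>
    obtain ⟨t, ht⟩ := hπ.bij.2 (Ideal.Quotient.mk _ c)
    have h1 : c - WittVector.fontaineTheta O p (WittVector.teichmuller p t) ∈
        Ideal.span {π} := by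
      rw [← Ideal.Quotient.eq, ← ht]
      have := WittVector.mk_fontaineTheta (R := O) (WittVector.teichmuller p t)
      rw [WittVector.teichmuller_coeff_zero] at this
      simp only [← this]
      rfl
    obtain ⟨c', hc'⟩ := Ideal.mem_span_singleton.1 h1
    have hc : c = WittVector.fontaineTheta O p (WittVector.teichmuller p t) + π * c' := by
      rw [← hc']; ring
    obtain ⟨y, hy⟩ := hw (WittVector.map ι (WittVector.teichmuller p t) * w)
    refine ⟨(WittVector.map ι (WittVector.teichmuller p t) * w).coeff 0,
      y + ofInt ι c' * ofWitt ι w, ?_⟩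
    · rw [hc, map_add, map_mul, ofInt_theta, add_mul, ← map_mul, hy]; ring
  | add x y hx hy =>
    obtain ⟨a, x', rfl⟩ := hx
    obtain ⟨b, y', rfl⟩ := hy
    obtain ⟨z, hz⟩ := hw (WittVector.teichmuller p a + WittVector.teichmuller p b)
    refine ⟨(WittVector.teichmuller p a + WittVector.teichmuller p b).coeff 0, z + x' + y', ?_⟩
    · have : teich ι a + teich ι b = teich ι
        ((WittVector.teichmuller p a + WittVector.teichmuller p b).coeff 0) + ofInt ι π * z := by
        rw [← hz, map_add]; rfl
      linear_combination this

theorem exists_eq (x : RamWitt ι) : ∃ y, x = teich ι (red ι hπ x) + ofInt ι π * y := by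
  obtain ⟨a, y, rfl⟩ := exists_teich ι hπ x
  refine ⟨y, ?_⟩
  rw [map_add, map_mul, red_teich, red_pi, zero_mul, add_zero]

theorem pi_regular (hπ : Good p π) (x : RamWitt ι) (h : ofInt ι π * x = 0) : x = 0 := by
  letI : Field (PreTilt O p) := hπ.isField.toField
  let : Algebra (WittVector p (PreTilt O p)) O := (WittVector.fontaineTheta O p).toAlgebra
  let : Algebra (WittVector p (PreTilt O p)) (WittVector p R) := (WittVector.map ι).toAlgebra
  have hreg : ∀ (n : ℕ) (w : WittVector p R), (p : WittVector p R) ^ n * w = 0 → w = 0 := by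
    intro n
    induction n with
    | zero => intro w hw; simpa using hw
    | succ n ih =>
      intro w hw
      apply ih
      apply WittVector.eq_zero_of_p_mul_eq_zero
      rw [← hw, pow_succ]; ring
  have flat : Module.Flat (WittVector p (PreTilt O p)) (WittVector p R) := by
    rw [Module.Flat.flat_iff_torsion_eq_bot_of_isBezout, eq_bot_iff]
    intro w hw
    obtain ⟨⟨a, ha⟩, haw⟩ := (Submodule.mem_torsion_iff _).1 hw
    have ha0 : a ≠ 0 := nonZeroDivisors.ne_zero ha
    obtain ⟨m, b, rfl⟩ := WittVector.exists_eq_pow_p_mul' a ha0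
    have h1 : WittVector.map ι ((p : WittVector p (PreTilt O p)) ^ m *
        (b : WittVector p (PreTilt O p))) * w = 0 := haw
    rw [map_mul, map_pow, map_natCast, mul_assoc] at h1
    have h2 := hreg _ _ h1
    have hu : IsUnit (WittVector.map ι (b : WittVector p (PreTilt O p))) := b.isUnit.map _
    exact (hu.mul_right_eq_zero).1 h2
  have hinj : Function.Injective
      (LinearMap.mulLeft (WittVector p (PreTilt O p)) π : O →ₗ[WittVector p (PreTilt O p)] O) := by
    rw [← LinearMap.ker_eq_bot, LinearMap.ker_eq_bot']
    intro c hc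
    exact hπ.regular c hc
  have h2 := Module.Flat.rTensor_preserves_injective_linearMap (M := WittVector p R) _ hinj
  have h3 : ∀ z : O ⊗[WittVector p (PreTilt O p)] WittVector p R,
      (LinearMap.mulLeft (WittVector p (PreTilt O p)) π).rTensor (WittVector p R) z =
        (π ⊗ₜ[WittVector p (PreTilt O p)] (1 : WittVector p R)) * z := by
    intro z
    induction z using TensorProduct.induction_on with
    | zero => simp
    | tmul c w => simp
    | add x y hx hy => rw [map_add, hx, hy, mul_add]
  have h4 : ∀ z : O ⊗[WittVector p (PreTilt O p)] WittVector p R,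
      (π ⊗ₜ[WittVector p (PreTilt O p)] (1 : WittVector p R)) * z = 0 → z = 0 := by
    intro z hz
    apply h2
    rw [h3, map_zero, hz]
  exact h4 x h

theorem pi_pow_regular (hπ : Good p π) (n : ℕ) (x : RamWitt ι) (h : ofInt ι π ^ n * x = 0) : x = 0 := by
  induction n with
  | zero => simpa using h
  | succ n ih =>
    apply ih
    apply pi_regular ι hπ
    rw [← h, pow_succ]; ring

theorem exists_isExp (hπ : Good p π) (x : RamWitt ι) : ∃ a, IsExp ι π x a := by
  choose s hs using exists_eq ι hπ
  refine ⟨fun k => red ι hπ (s^[k] x), fun N => ⟨s^[N] x, ?_⟩⟩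
  induction N with
  | zero => simp
  | succ N ih =>
    rw [Finset.sum_range_succ, Function.iterate_succ_apply']
    conv_lhs => rw [ih, hs (s^[N] x)]
    rw [pow_succ]; ring

variable {ι} in
/-- The first coefficients of an expansion only depend on `x` modulo `π^{N+1}`. -/
theorem IsExp.congr (hπ : Good p π) {x y z : RamWitt ι} {a b : ℕ → R} {N : ℕ} (hx : IsExp ι π x a)
    (hy : IsExp ι π y b) (hxy : x = y + ofInt ι π ^ N * z) : ∀ k < N, a k = b k := by
  intro k
  induction k using Nat.strong_induction_on with
  | _ k ih =>
  intro hk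
  obtain ⟨u, hu⟩ := hx (k + 1)
  obtain ⟨v, hv⟩ := hy (k + 1)
  have hs : ∑ i ∈ Finset.range k, ofInt ι π ^ i * teich ι (a i) =
      ∑ i ∈ Finset.range k, ofInt ι π ^ i * teich ι (b i) :=
    Finset.sum_congr rfl fun i hi => by
      rw [ih i (Finset.mem_range.1 hi) ((Finset.mem_range.1 hi).trans hk)]
  rw [Finset.sum_range_succ] at hu hv
  obtain ⟨m, rfl⟩ : ∃ m, N = k + 1 + m := ⟨N - (k + 1), by omega⟩
  have h0 : ofInt ι π ^ k * (teich ι (a k) - teich ι (b k) +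
      ofInt ι π * (u - v - ofInt ι π ^ m * z)) = 0 := by
    rw [pow_add] at hxy
    linear_combination hxy - hu + hv - hs
  have h1 := congrArg (red ι hπ) (pi_pow_regular ι hπ k _ h0)
  rw [map_add, map_sub, map_mul, red_teich, red_teich, red_pi, zero_mul, add_zero, map_zero,
    sub_eq_zero] at h1
  exact h1

variable {ι} in
theorem IsExp.unique (hπ : Good p π) {x : RamWitt ι} {a b : ℕ → R} (hx : IsExp ι π x a) (hy : IsExp ι π x b) :
    a = b := by
  funext k
  exact hx.congr hπ hy (N := k + 1) (z := 0) (by simp) k (Nat.lt_succ_self k)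

end Expansions

variable (π : O)

open Classical in
/-- The coefficients `x_k` in `x = ∑_{k ≥ 0} π^k [x_k]`. -/
def coeff (x : RamWitt ι) : ℕ → R :=
  if h : ∃ a, IsExp ι π x a then h.choose else 0

section Coeff

variable {ι} {π} (hπ : Good p π) [CharP R p] [PerfectRing R p] [CharP S p] [PerfectRing S p]

theorem isExp_coeff (hπ : Good p π) (x : RamWitt ι) : IsExp ι π x (coeff ι π x) := by
  have h := exists_isExp ι hπ x
  rw [coeff, dif_pos h]
  exact h.choose_spec

theorem IsExp.coeff_eq (hπ : Good p π) {x : RamWitt ι} {a : ℕ → R} (h : IsExp ι π x a) : coeff ι π x = a :=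
  (isExp_coeff hπ x).unique hπ h

theorem coeff_teich_mul (hπ : Good p π) (a : R) (x : RamWitt ι) (k : ℕ) :
    coeff ι π (teich ι a * x) k = a * coeff ι π x k := by
  refine congrFun (IsExp.coeff_eq hπ (a := fun k => a * coeff ι π x k) fun N => ?_) k
  obtain ⟨y, hy⟩ := isExp_coeff hπ x N
  refine ⟨teich ι a * y, ?_⟩
  conv_lhs => rw [hy]
  rw [mul_add, Finset.mul_sum]
  congr 1
  · exact Finset.sum_congr rfl fun k _ => by rw [teich_mul]; ring
  · ring

theorem coeff_map (hπ : Good p π) (f : R →+* S) (hf : f.comp ι = ι') (x : RamWitt ι) (k : ℕ) :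
    coeff ι' π (map ι ι' f hf x) k = f (coeff ι π x k) := by
  refine congrFun (IsExp.coeff_eq hπ (a := fun k => f (coeff ι π x k)) fun N => ?_) k
  obtain ⟨y, hy⟩ := isExp_coeff hπ x N
  refine ⟨map ι ι' f hf y, ?_⟩
  conv_lhs => rw [hy]
  simp [map_sum]

theorem coeff_pi_pow_mul (hπ : Good p π) (n : ℕ) (x : RamWitt ι) (k : ℕ) :
    coeff ι π (ofInt ι π ^ n * x) (k + n) = coeff ι π x k := by
  have h : IsExp ι π (ofInt ι π ^ n * x)
      (fun k => if k < n then 0 else coeff ι π x (k - n)) := by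
    intro N
    rcases le_total N n with hN | hN
    · obtain ⟨m, rfl⟩ := Nat.exists_eq_add_of_le hN
      refine ⟨ofInt ι π ^ m * x, ?_⟩
      rw [Finset.sum_eq_zero, zero_add, pow_add]
      · ring
      · intro i hi
        simp only [if_pos ((Finset.mem_range.1 hi).trans_le hN), teich_zero, mul_zero]
    · obtain ⟨m, rfl⟩ := Nat.exists_eq_add_of_le hN
      obtain ⟨y, hy⟩ := isExp_coeff hπ x m
      refine ⟨y, ?_⟩
      rw [Finset.sum_range_add]
      rw [Finset.sum_eq_zero (s := Finset.range n), zero_add]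
      · conv_lhs => rw [hy]
        rw [mul_add, Finset.mul_sum]
        congr 1
        · refine Finset.sum_congr rfl fun i _ => ?_
          simp only [if_neg (show ¬ n + i < n by omega), Nat.add_sub_cancel_left]
          rw [pow_add]; ring
        · rw [pow_add]; ring
      · intro i hi
        simp only [if_pos (Finset.mem_range.1 hi), teich_zero, mul_zero]
  rw [IsExp.coeff_eq hπ h]
  simp

theorem coeff_pi_pow_mul_of_lt (hπ : Good p π) (n : ℕ) (x : RamWitt ι) (k : ℕ) (hk : k < n) :
    coeff ι π (ofInt ι π ^ n * x) k = 0 := by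
  have h0 : IsExp ι π (0 : RamWitt ι) (fun _ => 0) := fun N => ⟨0, by simp [teich_zero]⟩
  exact (isExp_coeff hπ (ofInt ι π ^ n * x)).congr hπ h0 (N := n) (z := x) (by simp) k hk

theorem coeff_zero (hπ : Good p π) (k : ℕ) : coeff ι π (0 : RamWitt ι) k = 0 := by
  have h0 : IsExp ι π (0 : RamWitt ι) (fun _ => 0) := fun N => ⟨0, by simp [teich_zero]⟩
  rw [IsExp.coeff_eq hπ h0]

end Coeff

end RamWitt

end Ramified

/-! ### The tilt of `𝓞_ℂ_[p]` and its fraction field -/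

section Tilt

variable (p : ℕ) [Fact p.Prime]

instance fact_not_isUnit_Cp : Fact (¬IsUnit (p : 𝓞_ℂ_[p])) := ⟨fun h => by
  have h1 := (PadicComplexInt.integers p).one_of_isUnit h
  rw [map_natCast, PadicComplex.valuation_p] at h1
  have h2 : (1 : ℝ≥0) < p := by exact_mod_cast (Fact.out : p.Prime).one_lt
  rw [one_div, inv_eq_one] at h1
  exact h2.ne' h1⟩

/-- `Ẽ⁺`, the tilt of the ring of integers of `ℂ_p`. -/
abbrev EtPlus : Type := PreTilt 𝓞_ℂ_[p] p

instance isDomain_EtPlus : IsDomain (EtPlus p) :=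
  PreTilt.isDomain ℂ_[p] (PadicComplex.valued p).v 𝓞_ℂ_[p] (PadicComplexInt.integers p) p

/-- `Ẽ`, the fraction field of `Ẽ⁺`. -/
abbrev Et : Type := FractionRing (EtPlus p)

/-- The absolute value of `Ẽ⁺` that comes from the one of `ℂ_p` (with `|p| = 1/p`). -/
def valPlus : Valuation (EtPlus p) ℝ≥0 :=
  PreTilt.val ℂ_[p] (PadicComplex.valued p).v 𝓞_ℂ_[p] (PadicComplexInt.integers p) p

theorem valPlus_eq_zero {x : EtPlus p} : valPlus p x = 0 ↔ x = 0 :=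
  PreTilt.map_eq_zero (PadicComplexInt.integers p)

/-- Its extension to `Ẽ`. -/
def val : Valuation (Et p) ℝ≥0 :=
  (valPlus p).extendToLocalization (S := nonZeroDivisors (EtPlus p)) (by
    intro x hx h
    exact nonZeroDivisors.ne_zero hx ((valPlus_eq_zero p).1 h)) (Et p)

theorem val_algebraMap (x : EtPlus p) : val p (algebraMap (EtPlus p) (Et p) x) = valPlus p x :=
  Valuation.extendToLocalization_apply_map_apply _ _ _ _

theorem valPlus_le_one (x : EtPlus p) : valPlus p x ≤ 1 := by
  by_cases hx : x = 0
  · simp [hx]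
  obtain ⟨n, hn⟩ : ∃ n, PreTilt.coeff n x ≠ 0 := by
    by_contra! h
    exact hx (Perfection.ext h)
  change PreTilt.valAux _ _ _ _ x ≤ 1
  rw [PreTilt.valAux_eq (PadicComplexInt.integers p) hn]
  apply pow_le_one₀ zero_le
  unfold ModP.preVal
  split_ifs
  · exact zero_le
  · exact (PadicComplexInt.integers p).2 _

open Classical in
/-- `v_E : Ẽ → ℝ ∪ {∞}`, normalized through `v_p(p) = 1`. -/
def vE (a : Et p) : EReal := if a = 0 then ⊤ else ((-Real.logb p (val p a) : ℝ) : EReal)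

instance charP_Et : CharP (Et p) p := IsFractionRing.charP_of_isFractionRing (EtPlus p) p

instance perfectRing_Et : PerfectRing (Et p) p := by
  apply PerfectRing.ofSurjective
  intro x
  obtain ⟨a, b, hb, rfl⟩ := IsFractionRing.div_surjective (A := EtPlus p) x
  obtain ⟨a', rfl⟩ := (PerfectRing.bijective_frobenius (R := EtPlus p) (p := p)).2 a
  obtain ⟨b', rfl⟩ := (PerfectRing.bijective_frobenius (R := EtPlus p) (p := p)).2 b
  exact ⟨algebraMap _ _ a' / algebraMap _ _ b', by
    simp [frobenius_def, div_pow]⟩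

end Tilt

/-! ### A finite extension of `ℚ_p` and its ring of integers -/

section Base

variable {p : ℕ} [Fact p.Prime] (K : IntermediateField ℚ_[p] (PadicAlgCl p))

/-- The ring of integers `𝓞_K`. -/
def OK : ValuationSubring K := (NormedField.valuation (K := K)).valuationSubring

variable {K} in
theorem mem_OK {x : K} : x ∈ OK K ↔ ‖x‖ ≤ 1 := by
  rw [OK, Valuation.mem_valuationSubring_iff, NormedField.valuation_apply]
  exact_mod_cast Iff.rfl

variable {K} in
theorem OK_dvd_iff {x y : OK K} : x ∣ y ↔ ‖(y : K)‖ ≤ ‖(x : K)‖ := by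
  have h := (Valuation.integer.integers (NormedField.valuation (K := K))).le_iff_dvd (x := y) (y := x)
  exact h.symm

theorem norm_p : ‖((p : OK K) : K)‖ = (p : ℝ)⁻¹ := by
  have : ‖((p : ℚ_[p]) : PadicAlgCl p)‖ = ‖(p : ℚ_[p])‖ := PadicAlgCl.norm_extends p _
  rw [Padic.norm_p] at this
  rw [← this]
  simp

instance fact_not_isUnit_OK : Fact (¬IsUnit (p : OK K)) := ⟨fun h => by
  have h1 := (OK_dvd_iff (x := (p : OK K)) (y := 1)).1 h.dvd
  rw [norm_p] at h1
  have h2 : (1 : ℝ) < p := by exact_mod_cast (Fact.out : p.Prime).one_lt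
  have h3 := inv_lt_one_of_one_lt₀ h2
  simp at h1
  linarith⟩

theorem mem_span_p_pow {x : OK K} {n : ℕ} :
    x ∈ (Ideal.span {(p : OK K)} ^ n • ⊤ : Ideal (OK K)) ↔ ‖(x : K)‖ ≤ ((p : ℝ)⁻¹) ^ n := by
  rw [smul_eq_mul, Ideal.mul_top, Ideal.span_singleton_pow, Ideal.mem_span_singleton, OK_dvd_iff]
  simp only [SubmonoidClass.coe_pow, norm_pow, norm_p]

section Finite

variable [FiniteDimensional ℚ_[p] K]

instance isAdicComplete_OK : IsAdicComplete (Ideal.span {(p : OK K)}) (OK K) := by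
  have hp1 : (1 : ℝ) < p := by exact_mod_cast (Fact.out : p.Prime).one_lt
  have hp0 : (0 : ℝ) ≤ (p : ℝ)⁻¹ := by positivity
  have hp2 : (p : ℝ)⁻¹ < 1 := inv_lt_one_of_one_lt₀ hp1
  have hlim := tendsto_pow_atTop_nhds_zero_of_lt_one hp0 hp2
  have : CompleteSpace K := FiniteDimensional.complete ℚ_[p] K
  refine { haus' := ?_, prec' := ?_ }
  · intro x hx
    have h : ∀ n, ‖(x : K)‖ ≤ ((p : ℝ)⁻¹) ^ n := fun n => by
      have := hx n
      rw [SModEq.zero] at this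
      exact (mem_span_p_pow K).1 this
    have h0 : ‖(x : K)‖ ≤ 0 := ge_of_tendsto' hlim h
    exact Subtype.ext (norm_le_zero_iff.1 h0)
  · intro f hf
    have h : ∀ m n : ℕ, m ≤ n → ‖(f m : K) - (f n : K)‖ ≤ ((p : ℝ)⁻¹) ^ m := fun m n hmn => by
      have h1 := hf hmn
      rw [SModEq.sub_mem] at h1
      have h2 := (mem_span_p_pow K).1 h1
      rwa [AddSubgroupClass.coe_sub] at h2
    have hc : CauchySeq (fun n => (f n : K)) := by
      refine cauchySeq_of_le_tendsto_0' (fun n => ((p : ℝ)⁻¹) ^ n) ?_ hlim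
      intro n m hnm
      rw [dist_eq_norm]
      exact h n m hnm
    obtain ⟨L, hL⟩ := cauchySeq_tendsto_of_complete hc
    have hL1 : ‖L‖ ≤ 1 := le_of_tendsto' hL.norm fun n => mem_OK.1 (f n).2
    refine ⟨⟨L, mem_OK.2 hL1⟩, fun n => ?_⟩
    rw [SModEq.sub_mem]
    rw [mem_span_p_pow, AddSubgroupClass.coe_sub]
    have h2 : Filter.Tendsto (fun m => ‖(f n : K) - f m‖) Filter.atTop (nhds ‖(f n : K) - L‖) :=
      (tendsto_const_nhds.sub hL).norm
    refine le_of_tendsto h2 ?_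
    filter_upwards [Filter.eventually_ge_atTop n] with m hm using h n m hm

/-- A uniformizer of `𝓞_K`, that is a generator of its maximal ideal. -/
structure Uniformizer where
  /-- the element of `𝓞_K` -/
  elt : OK K
  span_eq : IsLocalRing.maximalIdeal (OK K) = Ideal.span {elt}

variable {K}

theorem norm_lt_one_iff {x : OK K} : x ∈ IsLocalRing.maximalIdeal (OK K) ↔ ‖(x : K)‖ < 1 := by
  rw [IsLocalRing.mem_maximalIdeal, mem_nonunits_iff, isUnit_iff_dvd_one, OK_dvd_iff, not_le]
  simp

namespace Uniformizer

variable (π : Uniformizer K)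

theorem dvd_p : π.elt ∣ (p : OK K) := by
  rw [← Ideal.mem_span_singleton, ← π.span_eq, IsLocalRing.mem_maximalIdeal, mem_nonunits_iff]
  exact (fact_not_isUnit_OK K).out

theorem ne_zero : π.elt ≠ 0 := by
  intro h
  have h1 := OK_dvd_iff.1 π.dvd_p
  rw [norm_p, h] at h1
  have h2 : (0 : ℝ) < (p : ℝ)⁻¹ := by
    have : (0 : ℝ) < p := by exact_mod_cast (Fact.out : p.Prime).pos
    positivity
  rw [ZeroMemClass.coe_zero, norm_zero] at h1
  exact absurd h1 (not_le.2 h2)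

theorem norm_lt_one : ‖(π.elt : K)‖ < 1 := by
  rw [← norm_lt_one_iff, π.span_eq]
  exact Ideal.mem_span_singleton_self _

theorem exists_p_dvd_pow : ∃ n : ℕ, (p : OK K) ∣ π.elt ^ n := by
  have hp0 : (0 : ℝ) < (p : ℝ)⁻¹ := by
    have : (0 : ℝ) < p := by exact_mod_cast (Fact.out : p.Prime).pos
    positivity
  obtain ⟨n, hn⟩ := exists_pow_lt_of_lt_one hp0 π.norm_lt_one
  refine ⟨n, OK_dvd_iff.2 ?_⟩
  rw [norm_p, SubmonoidClass.coe_pow, norm_pow]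
  exact hn.le

theorem finite_modP : Finite (ModP (OK K) p) := by
  have : ProperSpace K := FiniteDimensional.proper ℚ_[p] K
  have hset : ((OK K : Set K)) = Metric.closedBall 0 1 := by
    ext x
    rw [SetLike.mem_coe, mem_OK, mem_closedBall_zero_iff]
  have : CompactSpace (OK K) := by
    have hc : IsCompact ((OK K : Set K)) := by
      rw [hset]
      exact isCompact_closedBall 0 1
    exact isCompact_iff_compactSpace.1 hc
  have hopen : IsOpen ((Ideal.span {(p : OK K)} : Ideal (OK K)) : Set (OK K)) := by
    have : ((Ideal.span {(p : OK K)} : Ideal (OK K)) : Set (OK K)) =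
        (fun x : OK K => (x : K)) ⁻¹' Metric.closedBall 0 (p : ℝ)⁻¹ := by
      ext x
      rw [SetLike.mem_coe, Ideal.mem_span_singleton, OK_dvd_iff, norm_p, Set.mem_preimage,
        mem_closedBall_zero_iff]
    rw [this]
    refine (IsUltrametricDist.isOpen_closedBall 0 ?_).preimage continuous_subtype_val
    have : (0 : ℝ) < p := by exact_mod_cast (Fact.out : p.Prime).pos
    positivity
  exact AddSubgroup.quotient_finite_of_isOpen
    (Submodule.toAddSubgroup (Ideal.span {(p : OK K)} : Ideal (OK K))) hopen

/-- The reduction `𝓞_K♭ → 𝓞_K/p → 𝓞_K/π`. -/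
def redTilt : PreTilt (OK K) p →+* OK K ⧸ Ideal.span {π.elt} :=
  (Ideal.Quotient.factor ((Ideal.span_singleton_le_span_singleton).2 π.dvd_p)).comp
    (PreTilt.coeff 0)

theorem isMaximal : (Ideal.span {π.elt} : Ideal (OK K)).IsMaximal := by
  rw [← π.span_eq]; infer_instance

theorem redTilt_injective : Function.Injective π.redTilt := by
  rw [injective_iff_map_eq_zero]
  intro t ht
  have := π.isMaximal
  obtain ⟨N, hN⟩ := π.exists_p_dvd_pow
  let F := Ideal.Quotient.factor ((Ideal.span_singleton_le_span_singleton).2 π.dvd_p)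
  have hpow : ∀ n m, (PreTilt.coeff (n + m) t) ^ p ^ m = PreTilt.coeff n t := by
    intro n m
    induction m with
    | zero => simp
    | succ m ih => rw [pow_succ', pow_mul, ← add_assoc, PreTilt.coeff_pow_p, ih]
  have h1 : ∀ n, F (PreTilt.coeff n t) = 0 := by
    intro n
    have h2 := hpow 0 n
    have h3 : F (PreTilt.coeff n t) ^ p ^ n = 0 := by
      rw [← map_pow]
      rw [zero_add] at h2
      rw [h2]
      exact ht
    exact pow_eq_zero_iff (pow_ne_zero _ (Fact.out : p.Prime).ne_zero) |>.1 h3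
  refine Perfection.ext fun n => ?_
  change PreTilt.coeff n t = PreTilt.coeff n 0
  rw [map_zero, ← hpow n N]
  obtain ⟨c, hc⟩ := Ideal.Quotient.mk_surjective (PreTilt.coeff (n + N) t)
  have h4 := h1 (n + N)
  rw [← hc] at h4 ⊢
  have h5 : c ∈ Ideal.span {π.elt} := Ideal.Quotient.eq_zero_iff_mem.1 h4
  rw [← map_pow]
  refine Ideal.Quotient.eq_zero_iff_mem.2 (Ideal.mem_span_singleton.2 ?_)
  calc (p : OK K) ∣ π.elt ^ N := hN
    _ ∣ π.elt ^ p ^ N := pow_dvd_pow _ (Nat.lt_pow_self (Fact.out : p.Prime).one_lt).le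
    _ ∣ c ^ p ^ N := pow_dvd_pow_of_dvd (Ideal.mem_span_singleton.1 h5) _

theorem redTilt_surjective : Function.Surjective π.redTilt := by
  have hfin : Finite (ModP (OK K) p) := finite_modP
  have := π.isMaximal
  letI : Field (OK K ⧸ Ideal.span {π.elt}) := Ideal.Quotient.field _
  let F : ModP (OK K) p →+* OK K ⧸ Ideal.span {π.elt} :=
    Ideal.Quotient.factor ((Ideal.span_singleton_le_span_singleton).2 π.dvd_p)
  have hF : Function.Surjective F := Ideal.Quotient.factor_surjective _
  have : Finite (ModP (OK K) p → ModP (OK K) p) := Pi.finite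
  obtain ⟨a, b, hab, hfab⟩ := Finite.exists_ne_map_eq_of_infinite
    (fun n : ℕ => fun x : ModP (OK K) p => x ^ p ^ n)
  wlog hlt : a < b generalizing a b
  · exact this b a hab.symm hfab.symm (lt_of_le_of_ne (not_lt.1 hlt) hab.symm)
  obtain ⟨D, rfl⟩ := Nat.exists_eq_add_of_lt hlt
  set d := D + 1 with hd
  have h1 : ∀ x : ModP (OK K) p, x ^ p ^ a = x ^ p ^ (a + d) := fun x => congrFun hfab x
  have h2 : ∀ (j n : ℕ) (x : ModP (OK K) p), a ≤ n → x ^ p ^ (n + d * j) = x ^ p ^ n := by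
    intro j n x hn
    induction j with
    | zero => simp
    | succ j ih =>
      rw [← ih]
      obtain ⟨m, hm⟩ := Nat.exists_eq_add_of_le (hn.trans (Nat.le_add_right n (d * j)))
      have e1 : n + d * (j + 1) = (a + d) + m := by rw [mul_add]; omega
      rw [e1, hm, pow_add p (a + d), pow_mul, ← h1, ← pow_mul, ← pow_add]
  set N := d * (a + 1) with hN
  have haN : a ≤ N := by
    rw [hN, hd]; nlinarith
  have hNN : ∀ x : ModP (OK K) p, x ^ p ^ (N + N) = x ^ p ^ N := fun x => h2 (a + 1) N x haN
  have hN1 : 1 ≤ N := by rw [hN, hd]; nlinarith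
  intro y
  obtain ⟨c, hc⟩ := hF y
  let s := c ^ p ^ N
  have hs : ∀ j : ℕ, s ^ p ^ (j + N) = s ^ p ^ j := by
    intro j
    change (c ^ p ^ N) ^ p ^ (j + N) = (c ^ p ^ N) ^ p ^ j
    rw [← pow_mul, ← pow_add, ← pow_mul, ← pow_add]
    have e1 : N + (j + N) = (N + N) + j := by omega
    rw [e1, pow_add p (N + N), pow_mul, hNN, ← pow_mul, ← pow_add]
  let t : PreTilt (OK K) p := ⟨fun n => s ^ p ^ (n * (N - 1)), fun n => by
    change (s ^ p ^ ((n + 1) * (N - 1))) ^ p = s ^ p ^ (n * (N - 1))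
    rw [← pow_mul, ← pow_succ]
    have e1 : (n + 1) * (N - 1) + 1 = n * (N - 1) + N := by rw [add_mul]; omega
    rw [e1, hs]⟩
  refine ⟨t, ?_⟩
  have ht : PreTilt.coeff 0 t = s := by
    change s ^ p ^ (0 * (N - 1)) = s
    simp
  change F (PreTilt.coeff 0 t) = y
  rw [ht]
  change F (c ^ p ^ N) = y
  rw [map_pow, hc]
  have hch : CharP (OK K ⧸ Ideal.span {π.elt}) p := by
    have hcc : CharP (ModP (OK K) p) p := inferInstance
    have h0 : (p : OK K ⧸ Ideal.span {π.elt}) = 0 := by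
      have hz : ((p : ℕ) : ModP (OK K) p) = 0 := CharP.cast_eq_zero _ _
      have h3 := congrArg F hz
      rwa [map_natCast, map_zero] at h3
    exact (CharP.charP_iff_prime_eq_zero (Fact.out : p.Prime)).2 h0
  have hy : (y ^ p ^ N) ^ p ^ N = y ^ p ^ N := by
    rw [← hc, ← map_pow, ← map_pow, ← pow_mul, ← pow_add, hNN]
  exact iterateFrobenius_inj (OK K ⧸ Ideal.span {π.elt}) p N hy

theorem good : RamWitt.Good p π.elt where
  regular c hc := by
    rcases mul_eq_zero.1 hc with h | h
    · exact absurd h π.ne_zero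
    · exact h
  dvd := π.dvd_p
  isField := by
    have := π.isMaximal
    letI : Field (OK K ⧸ Ideal.span {π.elt}) := Ideal.Quotient.field _
    exact MulEquiv.isField (Field.toIsField (OK K ⧸ Ideal.span {π.elt}))
      (RingEquiv.ofBijective π.redTilt ⟨π.redTilt_injective, π.redTilt_surjective⟩).toMulEquiv
  bij := ⟨π.redTilt_injective, π.redTilt_surjective⟩

end Uniformizer

end Finite

end Base

/-! ### The Galois action on `ℂ_p` and on its tilt -/

section Galois

variable {p : ℕ} [Fact p.Prime] {K : IntermediateField ℚ_[p] (PadicAlgCl p)}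

theorem isometry_gal (σ : Gal(PadicAlgCl p/K)) : Isometry σ := by
  refine AddMonoidHomClass.isometry_of_norm σ fun x => ?_
  exact (spectralNorm_eq_of_equiv (σ.restrictScalars ℚ_[p]) x).symm

/-- The action of `σ ∈ G_K` on `ℂ_p`, by continuity. -/
def galCp (σ : Gal(PadicAlgCl p/K)) : ℂ_[p] →+* ℂ_[p] :=
  UniformSpace.Completion.mapRingHom (σ : PadicAlgCl p →+* PadicAlgCl p)
    (isometry_gal σ).continuous

theorem galCp_coe (σ : Gal(PadicAlgCl p/K)) (x : PadicAlgCl p) :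
    galCp σ (x : ℂ_[p]) = ((σ x : PadicAlgCl p) : ℂ_[p]) :=
  UniformSpace.Completion.mapRingHom_coe (f := (σ : PadicAlgCl p →+* PadicAlgCl p))
    (isometry_gal σ).continuous x

theorem continuous_galCp (σ : Gal(PadicAlgCl p/K)) : Continuous (galCp σ) :=
  UniformSpace.Completion.continuous_map

theorem norm_galCp (σ : Gal(PadicAlgCl p/K)) (x : ℂ_[p]) : ‖galCp σ x‖ = ‖x‖ := by
  induction x using UniformSpace.Completion.induction_on with
  | hp => exact isClosed_eq (continuous_galCp σ).norm continuous_norm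
  | ih a =>
    rw [galCp_coe, PadicComplex.norm_extends, PadicComplex.norm_extends]
    exact (isometry_gal σ).norm_map_of_map_zero (map_zero σ) a

theorem coe_v_eq_norm (x : ℂ_[p]) : (((PadicComplex.valued p).v x : ℝ≥0) : ℝ) = ‖x‖ := by
  rw [PadicComplex.norm_eq_norm, Valuation.norm_def, PadicComplex.RankOne.hom_eq_embedding,
    Valuation.embedding_restrict (PadicComplex.valued p).v x]

theorem v_galCp (σ : Gal(PadicAlgCl p/K)) (x : ℂ_[p]) :
    (PadicComplex.valued p).v (galCp σ x) = (PadicComplex.valued p).v x := by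
  apply NNReal.eq
  rw [coe_v_eq_norm, coe_v_eq_norm, norm_galCp]

/-- The action on `𝓞_{ℂ_p}`. -/
def galOCp (σ : Gal(PadicAlgCl p/K)) : 𝓞_ℂ_[p] →+* 𝓞_ℂ_[p] :=
  (galCp σ).restrict 𝓞_ℂ_[p] 𝓞_ℂ_[p] fun x hx => by
    change (PadicComplex.valued p).v (galCp σ x) ≤ 1
    rw [v_galCp]
    exact hx

/-- The action on `𝓞_{ℂ_p}/p`. -/
def galModP (σ : Gal(PadicAlgCl p/K)) : ModP 𝓞_ℂ_[p] p →+* ModP 𝓞_ℂ_[p] p :=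
  Ideal.quotientMap _ (galOCp σ) (by
    rw [Ideal.span_singleton_le_iff_mem, Ideal.mem_comap, map_natCast]
    exact Ideal.mem_span_singleton_self _)

/-- The action on `Ẽ⁺`. -/
def galPlus (σ : Gal(PadicAlgCl p/K)) : EtPlus p →+* EtPlus p :=
  Perfection.map p (galModP σ)

theorem coeff_galPlus (σ : Gal(PadicAlgCl p/K)) (x : EtPlus p) (n : ℕ) :
    PreTilt.coeff n (galPlus σ x) = galModP σ (PreTilt.coeff n x) := rfl

theorem preVal_galModP (σ : Gal(PadicAlgCl p/K)) (x : ModP 𝓞_ℂ_[p] p) (hx : x ≠ 0) :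
    galModP σ x ≠ 0 ∧
      ModP.preVal ℂ_[p] (PadicComplex.valued p).v 𝓞_ℂ_[p] p (galModP σ x) =
        ModP.preVal ℂ_[p] (PadicComplex.valued p).v 𝓞_ℂ_[p] p x := by
  obtain ⟨y, rfl⟩ := Ideal.Quotient.mk_surjective x
  have hv : (PadicComplex.valued p).v (algebraMap 𝓞_ℂ_[p] ℂ_[p] (galOCp σ y)) =
      (PadicComplex.valued p).v (algebraMap 𝓞_ℂ_[p] ℂ_[p] y) := v_galCp σ y
  have h1 : (Ideal.Quotient.mk _ (galOCp σ y) : ModP 𝓞_ℂ_[p] p) ≠ 0 := by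
    rw [← ModP.v_p_lt_val (PadicComplexInt.integers p)] at hx ⊢
    rwa [hv]
  refine ⟨h1, ?_⟩
  change ModP.preVal _ _ _ _ (Ideal.Quotient.mk _ (galOCp σ y)) = _
  rw [ModP.preVal_mk (PadicComplexInt.integers p) h1,
    ModP.preVal_mk (PadicComplexInt.integers p) hx, hv]

theorem valPlus_galPlus (σ : Gal(PadicAlgCl p/K)) (x : EtPlus p) :
    valPlus p (galPlus σ x) = valPlus p x := by
  by_cases hx : x = 0
  · simp [hx]
  obtain ⟨n, hn⟩ : ∃ n, PreTilt.coeff n x ≠ 0 := by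
    by_contra! h
    exact hx (Perfection.ext h)
  obtain ⟨h1, h2⟩ := preVal_galModP σ _ hn
  change PreTilt.valAux _ _ _ _ (galPlus σ x) = PreTilt.valAux _ _ _ _ x
  rw [PreTilt.valAux_eq (PadicComplexInt.integers p) hn,
    PreTilt.valAux_eq (PadicComplexInt.integers p) (n := n) (by rwa [coeff_galPlus]),
    coeff_galPlus, h2]

theorem galPlus_injective (σ : Gal(PadicAlgCl p/K)) : Function.Injective (galPlus σ) := by
  rw [injective_iff_map_eq_zero]
  intro x hx
  rw [← valPlus_eq_zero, ← valPlus_galPlus σ, hx, map_zero]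

/-- The action on `Ẽ`. -/
def galE (σ : Gal(PadicAlgCl p/K)) : Et p →+* Et p :=
  IsFractionRing.map (galPlus_injective σ)

theorem galE_algebraMap (σ : Gal(PadicAlgCl p/K)) (x : EtPlus p) :
    galE σ (algebraMap (EtPlus p) (Et p) x) = algebraMap (EtPlus p) (Et p) (galPlus σ x) := by
  rw [galE, IsFractionRing.map, IsLocalization.map_eq]

theorem val_galE (σ : Gal(PadicAlgCl p/K)) (x : Et p) : val p (galE σ x) = val p x := by
  obtain ⟨a, b, hb, rfl⟩ := IsFractionRing.div_surjective (A := EtPlus p) x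
  rw [map_div₀, map_div₀, map_div₀, galE_algebraMap, galE_algebraMap, val_algebraMap,
    val_algebraMap, val_algebraMap, val_algebraMap, valPlus_galPlus, valPlus_galPlus]

variable (K)

/-- The inclusion `𝓞_K → 𝓞_{ℂ_p}`. -/
def inclOK : OK K →+* 𝓞_ℂ_[p] :=
  ((algebraMap (PadicAlgCl p) ℂ_[p]).comp (K.val : K →+* PadicAlgCl p)).restrict
    (OK K) 𝓞_ℂ_[p] fun x hx => by
      change (PadicComplex.valued p).v (((x : PadicAlgCl p)) : ℂ_[p]) ≤ 1
      rw [PadicComplex.valuation_extends, PadicAlgCl.valuation_def]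
      exact mem_OK.1 hx

/-- The map `𝓞_K/p → 𝓞_{ℂ_p}/p`. -/
def inclModP : ModP (OK K) p →+* ModP 𝓞_ℂ_[p] p :=
  Ideal.quotientMap _ (inclOK K) (by
    rw [Ideal.span_singleton_le_iff_mem, Ideal.mem_comap, map_natCast]
    exact Ideal.mem_span_singleton_self _)

/-- The inclusion `𝓞_K♭ → Ẽ⁺` of the residue field of `K`. -/
def iotaPlus : PreTilt (OK K) p →+* EtPlus p := Perfection.map p (inclModP K)

/-- The inclusion `𝓞_K♭ → Ẽ`. -/
def iota : PreTilt (OK K) p →+* Et p := (algebraMap (EtPlus p) (Et p)).comp (iotaPlus K)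

theorem iota_eq : (algebraMap (EtPlus p) (Et p)).comp (iotaPlus K) = iota K := by
  rw [iota]

variable {K}

theorem galPlus_comp_iotaPlus (σ : Gal(PadicAlgCl p/K)) :
    (galPlus σ).comp (iotaPlus K) = iotaPlus K := by
  ext t
  refine Perfection.ext fun n => ?_
  change galModP σ (inclModP K (PreTilt.coeff n t)) = inclModP K (PreTilt.coeff n t)
  obtain ⟨c, hc⟩ := Ideal.Quotient.mk_surjective (PreTilt.coeff n t)
  rw [← hc]
  change Ideal.Quotient.mk _ (galOCp σ (inclOK K c)) = Ideal.Quotient.mk _ (inclOK K c)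
  congr 1
  apply Subtype.ext
  change galCp σ (((c : K) : PadicAlgCl p) : ℂ_[p]) = (((c : K) : PadicAlgCl p) : ℂ_[p])
  rw [galCp_coe]
  congr 1
  exact σ.commutes (c : K)

theorem galE_comp_iota (σ : Gal(PadicAlgCl p/K)) : (galE σ).comp (iota K) = iota K := by
  ext t
  change galE σ (algebraMap (EtPlus p) (Et p) (iotaPlus K t)) =
    algebraMap (EtPlus p) (Et p) (iotaPlus K t)
  rw [galE_algebraMap]
  congr 1
  exact RingHom.congr_fun (galPlus_comp_iotaPlus σ) t

end Galois

/-! ### The rings `Ã⁺`, `Ã`, `B̃` and the valuations `V(·, r)` -/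

section Rings

variable {p : ℕ} [Fact p.Prime] (K : IntermediateField ℚ_[p] (PadicAlgCl p))
  [FiniteDimensional ℚ_[p] K]

/-- `Ã⁺ = 𝓞_K ⊗_{𝓞_{K_0}} W(Ẽ⁺)`. -/
abbrev AtPlus : Type := RamWitt (iotaPlus K)

/-- `Ã = 𝓞_K ⊗_{𝓞_{K_0}} W(Ẽ)`. -/
abbrev At : Type := RamWitt (iota K)

/-- The map `Ã⁺ → Ã`. -/
def plusToAt : AtPlus K →+* At K :=
  RamWitt.map (iotaPlus K) (iota K) (algebraMap (EtPlus p) (Et p)) (iota_eq K)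

/-- The Teichmüller representative `[a] ∈ Ã` of `a ∈ Ẽ`. -/
def teichA (a : Et p) : At K := RamWitt.teich (iota K) a

variable {K}

/-- The action of `σ ∈ G_K` on `Ã`. -/
def galA (σ : Gal(PadicAlgCl p/K)) : At K →+* At K :=
  RamWitt.map (iota K) (iota K) (galE σ) (galE_comp_iota σ)

variable (π : Uniformizer K)

/-- `v_p(π) = 1/e`, where `e` is the ramification index of `K` and `v_p(p) = 1`. -/
def vPi : ℝ := -Real.logb p ‖(π.elt : K)‖

/-- `π` as an element of `Ã`. -/
def piA : At K := RamWitt.ofInt (iota K) π.elt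

/-- The coefficients `x_k` of `x = ∑_{k ≥ 0} π^k [x_k] ∈ Ã`. -/
def coeffA (x : At K) (k : ℕ) : Et p := RamWitt.coeff (iota K) π.elt x k

/-- `B̃ = Ã[1/π]`. -/
abbrev Bt : Type := Localization.Away (piA π)

/-- `Ã → B̃`. -/
abbrev toBt : At K →+* Bt π := algebraMap (At K) (Bt π)

theorem galA_piA (σ : Gal(PadicAlgCl p/K)) : galA σ (piA π) = piA π := RamWitt.map_ofInt _ _ _

/-- The action of `σ ∈ G_K` on `B̃`. -/
def galB (σ : Gal(PadicAlgCl p/K)) : Bt π →+* Bt π :=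
  IsLocalization.map (M := Submonoid.powers (piA π)) (T := Submonoid.powers (piA π)) (Bt π)
    (galA σ) (by
      rw [Submonoid.powers_le, Submonoid.mem_comap, galA_piA]
      exact Submonoid.mem_powers _)

theorem galB_toBt (σ : Gal(PadicAlgCl p/K)) (x : At K) :
    galB π σ (toBt π x) = toBt π (galA σ x) := IsLocalization.map_eq _ _

/-- `x = ∑_{k ≫ -∞} π^k [a_k]` in `B̃`. -/
def IsExpB (x : Bt π) (a : ℤ → Et p) : Prop :=
  ∃ (n : ℕ) (y : At K), toBt π (piA π ^ n) * x = toBt π y ∧ (∀ k < -(n : ℤ), a k = 0) ∧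
    RamWitt.IsExp (iota K) π.elt y (fun k => a (k - n))

open Classical in
/-- The coefficients `x_k` of `x = ∑_{k ≫ -∞} π^k [x_k] ∈ B̃`. -/
def coeffB (x : Bt π) : ℤ → Et p := if h : ∃ a, IsExpB π x a then h.choose else 0

/-- `V(x, r) = inf_k (k/e + (p-1)/(pr) v_E(x_k))`. -/
def V (x : Bt π) (r : ℝ) : EReal :=
  ⨅ k : ℤ, (((k : ℝ) * vPi π : ℝ) : EReal) +
    ((((p : ℝ) - 1) / (p * r) : ℝ) : EReal) * vE p (coeffB π x k)

end Rings

/-! ### `V(·, r)` is a (non-archimedean) norm -/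

section Norm

variable {p : ℕ} [Fact p.Prime] {K : IntermediateField ℚ_[p] (PadicAlgCl p)}
  [FiniteDimensional ℚ_[p] K] (π : Uniformizer K)

/-- The valuation ring of `Ẽ`. -/
abbrev EtInt (p : ℕ) [Fact p.Prime] : Subring (Et p) := (val p).integer

instance charP_EtInt : CharP (EtInt p) p :=
  (algebraMap (EtInt p) (Et p)).charP Subtype.val_injective p

instance perfectRing_EtInt : PerfectRing (EtInt p) p := by
  apply PerfectRing.ofSurjective
  intro x
  obtain ⟨y, hy⟩ := (PerfectRing.bijective_frobenius (R := Et p) (p := p)).2 (x : Et p)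
  have hy2 : val p y ≤ 1 := by
    by_contra! h
    have h1 : val p (x : Et p) ≤ 1 := x.2
    rw [← hy, map_pow] at h1
    exact absurd h1 (not_le.2 (one_lt_pow₀ h (Fact.out : p.Prime).ne_zero))
  exact ⟨⟨y, hy2⟩, Subtype.ext hy⟩

variable (K) in
/-- `𝓞_K♭` lands in the valuation ring of `Ẽ`. -/
def iotaInt : PreTilt (OK K) p →+* EtInt p :=
  (iota K).codRestrict (EtInt p) fun t => by
    change val p (algebraMap (EtPlus p) (Et p) (iotaPlus K t)) ≤ 1
    rw [val_algebraMap]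
    exact valPlus_le_one p _

theorem iotaInt_eq : (algebraMap (EtInt p) (Et p)).comp (iotaInt K) = iota K :=
  RingHom.ext fun _ => rfl

variable (K) in
/-- The map `𝓞_K ⊗ W(EtInt) → Ã`. -/
def intToAt : RamWitt (iotaInt K) →+* At K :=
  RamWitt.map (iotaInt K) (iota K) (algebraMap (EtInt p) (Et p)) iotaInt_eq

/-- Coefficientwise bounds, expressed through approximations modulo `π^{N+1}`. -/
theorem bound_iff {b : ℕ → ℝ≥0} (hb : Monotone b) (x : At K) :
    (∀ k, val p (coeffA π x k) ≤ b k) ↔ ∀ N : ℕ, ∃ a : Et p, val p a ≤ b N ∧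
      ∃ (z : RamWitt (iotaInt K)) (t : At K),
        x = teichA K a * intToAt K z + piA π ^ (N + 1) * t := by
  constructor
  · intro h N
    obtain ⟨i, hi, hmax⟩ := Finset.exists_max_image (Finset.range (N + 1))
      (fun k => val p (coeffA π x k)) ⟨0, by simp⟩
    obtain ⟨t, ht⟩ := RamWitt.isExp_coeff π.good x (N + 1)
    have hq : ∀ k ∈ Finset.range (N + 1),
        ∃ c : EtInt p, coeffA π x k = coeffA π x i * c := by
      intro k hk
      by_cases h0 : coeffA π x i = 0
      · have := hmax k hk
        rw [h0, map_zero, nonpos_iff_eq_zero, (val p).zero_iff] at this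
        exact ⟨0, by rw [this]; simp⟩
      · refine ⟨⟨coeffA π x k / coeffA π x i, ?_⟩, ?_⟩
        · change val p _ ≤ 1
          rw [map_div₀]
          exact div_le_one_of_le₀ (hmax k hk) zero_le
        · rw [mul_div_cancel₀ _ h0]
    choose! c hc using hq
    refine ⟨coeffA π x i, (h i).trans (hb (Nat.lt_succ_iff.1 (Finset.mem_range.1 hi))),
      ∑ k ∈ Finset.range (N + 1), RamWitt.ofInt (iotaInt K) π.elt ^ k *
        RamWitt.teich (iotaInt K) (c k), t, ?_⟩
    conv_lhs => rw [ht]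
    congr 1
    rw [map_sum, Finset.mul_sum]
    refine Finset.sum_congr rfl fun k hk => ?_
    have : RamWitt.coeff (iota K) π.elt x k = coeffA π x i * (c k : Et p) := hc k hk
    rw [this, RamWitt.teich_mul, map_mul, map_pow, intToAt, RamWitt.map_ofInt, RamWitt.map_teich,
      teichA]
    change _ = _ * (_ * RamWitt.teich (iota K) (c k : Et p))
    ring
  · intro h k
    obtain ⟨a, ha, z, t, hx⟩ := h k
    have h1 := RamWitt.IsExp.congr π.good (RamWitt.isExp_coeff π.good x)
      (RamWitt.isExp_coeff π.good (teichA K a * intToAt K z)) hx k (Nat.lt_succ_self k)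
    change val p (RamWitt.coeff (iota K) π.elt x k) ≤ b k
    rw [h1, teichA, RamWitt.coeff_teich_mul π.good, intToAt, RamWitt.coeff_map _ π.good, map_mul]
    have h2 : val p (algebraMap (EtInt p) (Et p)
      (RamWitt.coeff (iotaInt K) π.elt z k)) ≤ 1 := (RamWitt.coeff (iotaInt K) π.elt z k).2
    calc _ ≤ val p a * 1 := by gcongr
      _ ≤ b k := by rwa [mul_one]

theorem bound_add {b : ℕ → ℝ≥0} (hb : Monotone b) {x y : At K}
    (hx : ∀ k, val p (coeffA π x k) ≤ b k) (hy : ∀ k, val p (coeffA π y k) ≤ b k) :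
    ∀ k, val p (coeffA π (x + y) k) ≤ b k := by
  rw [bound_iff π hb] at hx hy ⊢
  have key : ∀ (a c : Et p), val p a ≤ val p c → ∃ d : EtInt p, a = c * d := by
    intro a c hac
    by_cases h0 : c = 0
    · rw [h0, map_zero, nonpos_iff_eq_zero, (val p).zero_iff] at hac
      exact ⟨0, by rw [hac]; simp⟩
    · refine ⟨⟨a / c, ?_⟩, ?_⟩
      · change val p _ ≤ 1
        rw [map_div₀]
        exact div_le_one_of_le₀ hac zero_le
      · rw [mul_div_cancel₀ _ h0]
  have hteich : ∀ (c : Et p) (d : EtInt p), teichA K (c * d) =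
      teichA K c * intToAt K (RamWitt.teich (iotaInt K) d) := by
    intro c d
    rw [teichA, RamWitt.teich_mul, intToAt, RamWitt.map_teich]
    rfl
  intro N
  obtain ⟨a, ha, z, t, hx⟩ := hx N
  obtain ⟨c, hc, w, s, hy⟩ := hy N
  rcases le_total (val p a) (val p c) with h | h
  · obtain ⟨d, rfl⟩ := key a c h
    refine ⟨c, hc, RamWitt.teich (iotaInt K) d * z + w, t + s, ?_⟩
    rw [hx, hy, hteich, map_add, map_mul]; ring
  · obtain ⟨d, rfl⟩ := key c a h
    refine ⟨a, ha, z + RamWitt.teich (iotaInt K) d * w, t + s, ?_⟩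
    rw [hx, hy, hteich, map_add, map_mul]; ring

theorem bound_mul {b : ℕ → ℝ≥0} (hb : Monotone b) {x : At K}
    (hx : ∀ k, val p (coeffA π x k) ≤ b k) (w : RamWitt (iotaInt K)) :
    ∀ k, val p (coeffA π (intToAt K w * x) k) ≤ b k := by
  rw [bound_iff π hb] at hx ⊢
  intro N
  obtain ⟨a, ha, z, t, hx⟩ := hx N
  exact ⟨a, ha, w * z, intToAt K w * t, by rw [hx, map_mul]; ring⟩

theorem exists_rep (x : Bt π) : ∃ (n : ℕ) (y : At K), toBt π (piA π ^ n) * x = toBt π y := by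
  obtain ⟨n, y, h⟩ := IsLocalization.Away.surj (piA π) x
  exact ⟨n, y, by rw [← h, map_pow, mul_comm]⟩

theorem rep_mul {x : Bt π} {n : ℕ} {y : At K} (h : toBt π (piA π ^ n) * x = toBt π y) (m : ℕ) :
    toBt π (piA π ^ (n + m)) * x = toBt π (piA π ^ m * y) := by
  rw [pow_add, map_mul, map_mul, ← h]; ring

theorem toBt_injective : Function.Injective (toBt π) := by
  apply IsLocalization.injective (M := Submonoid.powers (piA π))
  rw [Submonoid.powers_le, mem_nonZeroDivisors_iff_right]
  intro x hx
  exact RamWitt.pi_regular (iota K) π.good x (by rw [mul_comm]; exact hx)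

theorem isExpB_of_rep {x : Bt π} {n : ℕ} {y : At K}
    (h : toBt π (piA π ^ n) * x = toBt π y) :
    IsExpB π x (fun k => if k < -(n : ℤ) then 0 else coeffA π y (k + n).toNat) := by
  refine ⟨n, y, h, fun k hk => if_pos hk, ?_⟩
  convert RamWitt.isExp_coeff π.good y using 1
  funext k
  have h1 : ¬ ((k : ℤ) - n < -(n : ℤ)) := by omega
  simp only [if_neg h1, sub_add_cancel, Int.toNat_natCast, coeffA]

theorem IsExpB.unique {x : Bt π} {a b : ℤ → Et p} (ha : IsExpB π x a) (hb : IsExpB π x b) :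
    a = b := by
  obtain ⟨n, y, h, h0, hy⟩ := ha
  obtain ⟨m, z, h', h0', hz⟩ := hb
  have e1 := rep_mul π h m
  have e2 := rep_mul π h' n
  rw [add_comm m n, e1] at e2
  have e3 := toBt_injective π e2
  have hy' := RamWitt.IsExp.coeff_eq π.good hy
  have hz' := RamWitt.IsExp.coeff_eq π.good hz
  have key : ∀ j : ℕ, RamWitt.coeff (iota K) π.elt (piA π ^ m * y) j = a (j - (n + m)) := by
    intro j
    by_cases hj : j < m
    · rw [piA, RamWitt.coeff_pi_pow_mul_of_lt π.good m y j hj, h0 _ (by omega)]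
    · obtain ⟨i, rfl⟩ : ∃ i, j = i + m := ⟨j - m, by omega⟩
      rw [piA, RamWitt.coeff_pi_pow_mul π.good, hy']
      have e : ((i + m : ℕ) : ℤ) - (n + m) = i - n := by omega
      rw [e]
  have key' : ∀ j : ℕ, RamWitt.coeff (iota K) π.elt (piA π ^ n * z) j = b (j - (n + m)) := by
    intro j
    by_cases hj : j < n
    · rw [piA, RamWitt.coeff_pi_pow_mul_of_lt π.good n z j hj, h0' _ (by omega)]
    · obtain ⟨i, rfl⟩ : ∃ i, j = i + n := ⟨j - n, by omega⟩
      rw [piA, RamWitt.coeff_pi_pow_mul π.good, hz']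
      have e : ((i + n : ℕ) : ℤ) - (n + m) = i - m := by omega
      rw [e]
  funext k
  by_cases hk : k < -((n : ℤ) + m)
  · rw [h0 k (by omega), h0' k (by omega)]
  · have e4 := key (k + (n + m)).toNat
    have e5 := key' (k + (n + m)).toNat
    rw [e3, e5] at e4
    have e6 : (((k + (n + m)).toNat : ℕ) : ℤ) - (n + m) = k := by omega
    rw [e6] at e4
    exact e4.symm

theorem coeffB_eq {x : Bt π} {n : ℕ} {y : At K} (h : toBt π (piA π ^ n) * x = toBt π y) (k : ℤ) :
    coeffB π x k = if k < -(n : ℤ) then 0 else coeffA π y (k + n).toNat := by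
  have hex : ∃ a, IsExpB π x a := ⟨_, isExpB_of_rep π h⟩
  rw [coeffB, dif_pos hex]
  exact congrFun (hex.choose_spec.unique π (isExpB_of_rep π h)) k

theorem vPi_pos : 0 < vPi π := by
  have hp1 : (1 : ℝ) < p := by exact_mod_cast (Fact.out : p.Prime).one_lt
  have h0 : 0 < ‖(π.elt : K)‖ := norm_pos_iff.2 fun h => π.ne_zero (Subtype.ext h)
  have := Real.logb_neg hp1 h0 π.norm_lt_one
  rw [vPi]; linarith

/-- The bound on the absolute value of the coefficient of `π^j` that amounts to
`c ≤ j/e + (p-1)/(pr) v_E`. -/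
def bnd (c r : ℝ) (j : ℤ) : ℝ≥0 :=
  ⟨(p : ℝ) ^ (-((c - j * vPi π) * (p * r / (p - 1)))), by positivity⟩

theorem le_term_iff {c r : ℝ} (hr : 0 < r) (j : ℤ) (a : Et p) :
    ((c : EReal) ≤ (((j : ℝ) * vPi π : ℝ) : EReal) +
      ((((p : ℝ) - 1) / (p * r) : ℝ) : EReal) * vE p a) ↔ val p a ≤ bnd π c r j := by
  have hp1 : (1 : ℝ) < p := by exact_mod_cast (Fact.out : p.Prime).one_lt
  have hC : 0 < ((p : ℝ) - 1) / (p * r) := div_pos (by linarith) (by positivity)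
  by_cases ha : a = 0
  · rw [vE, if_pos ha, EReal.coe_mul_top_of_pos hC, EReal.coe_add_top, ha, map_zero]
    simp
  · rw [vE, if_neg ha, ← EReal.coe_mul, ← EReal.coe_add, EReal.coe_le_coe_iff,
      ← NNReal.coe_le_coe]
    change _ ↔ ((val p a : ℝ≥0) : ℝ) ≤ (p : ℝ) ^ (-((c - j * vPi π) * (p * r / (p - 1))))
    have hv : (0 : ℝ) < (val p a : ℝ≥0) := by
      have : val p a ≠ 0 := (val p).ne_zero_iff.2 ha
      exact_mod_cast pos_iff_ne_zero.2 this
    rw [← Real.logb_le_iff_le_rpow hp1 hv]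
    have hp2 : (0 : ℝ) < p - 1 := by linarith
    have e : (p : ℝ) * r / (p - 1) = (((p : ℝ) - 1) / (p * r))⁻¹ := (inv_div _ _).symm
    rw [e, ← neg_mul, ← div_eq_mul_inv, le_div_iff₀ hC]
    constructor <;> intro h <;> nlinarith

theorem bnd_mono {c r : ℝ} (hr : 0 < r) : Monotone (bnd π c r) := by
  have hp1 : (1 : ℝ) < p := by exact_mod_cast (Fact.out : p.Prime).one_lt
  intro i j hij
  rw [← NNReal.coe_le_coe]
  change (p : ℝ) ^ _ ≤ (p : ℝ) ^ _
  apply Real.rpow_le_rpow_of_exponent_le hp1.le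
  apply neg_le_neg
  apply mul_le_mul_of_nonneg_right
  · have h1 : (i : ℝ) ≤ j := by exact_mod_cast hij
    nlinarith [vPi_pos π]
  · exact (div_pos (by positivity) (by linarith)).le

theorem le_V_iff {c r : ℝ} (hr : 0 < r) {x : Bt π} {n : ℕ} {y : At K}
    (h : toBt π (piA π ^ n) * x = toBt π y) :
    ((c : EReal) ≤ V π x r) ↔ ∀ k : ℕ, val p (coeffA π y k) ≤ bnd π c r (k - n) := by
  rw [V, le_iInf_iff]
  constructor
  · intro h1 k
    have h2 := (le_term_iff π hr _ _).1 (h1 (k - n))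
    rw [coeffB_eq π h, if_neg (by omega)] at h2
    simpa using h2
  · intro h1 k
    rw [le_term_iff π hr, coeffB_eq π h]
    split_ifs with hk
    · simp
    · have h2 := h1 (k + n).toNat
      have e : (((k + n).toNat : ℕ) : ℤ) - n = k := by omega
      rwa [e] at h2

theorem V_add {c r : ℝ} (hr : 0 < r) {x y : Bt π} (hx : (c : EReal) ≤ V π x r)
    (hy : (c : EReal) ≤ V π y r) : (c : EReal) ≤ V π (x + y) r := by
  obtain ⟨n, x', h⟩ := exists_rep π x
  obtain ⟨m, y', h'⟩ := exists_rep π y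
  have e1 := rep_mul π h m
  have e2 := rep_mul π h' n
  rw [add_comm m n] at e2
  have e3 : toBt π (piA π ^ (n + m)) * (x + y) =
      toBt π (piA π ^ m * x' + piA π ^ n * y') := by
    rw [mul_add, e1, e2, map_add]
  rw [le_V_iff π hr e1] at hx
  rw [le_V_iff π hr e2] at hy
  rw [le_V_iff π hr e3]
  exact bound_add π (fun i j hij => bnd_mono π hr (by omega)) hx hy

theorem V_mul {c r : ℝ} (hr : 0 < r) {x : Bt π} (hx : (c : EReal) ≤ V π x r)
    (w : RamWitt (iotaInt K)) : (c : EReal) ≤ V π (toBt π (intToAt K w) * x) r := by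
  obtain ⟨n, x', h⟩ := exists_rep π x
  have e : toBt π (piA π ^ n) * (toBt π (intToAt K w) * x) = toBt π (intToAt K w * x') := by
    rw [map_mul, ← h]; ring
  rw [le_V_iff π hr h] at hx
  rw [le_V_iff π hr e]
  exact bound_mul π (fun i j hij => bnd_mono π hr (by omega)) hx w

theorem V_zero (r : ℝ) (hr : 0 < r) : V π 0 r = ⊤ := by
  rw [EReal.eq_top_iff_forall_lt]
  intro c
  refine lt_of_lt_of_le (EReal.coe_lt_coe_iff.2 (lt_add_one c)) ?_
  rw [le_V_iff π hr (n := 0) (y := 0) (by simp)]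
  intro k
  rw [coeffA, RamWitt.coeff_zero π.good, map_zero]
  exact zero_le

theorem V_neg {c r : ℝ} (hr : 0 < r) {x : Bt π} (hx : (c : EReal) ≤ V π x r) :
    (c : EReal) ≤ V π (-x) r := by
  have := V_mul π hr hx (-1)
  rwa [map_neg, map_one, map_neg, map_one, neg_one_mul] at this

theorem V_gal (σ : Gal(PadicAlgCl p/K)) (r : ℝ) (x : Bt π) :
    V π (galB π σ x) r = V π x r := by
  obtain ⟨n, y, h⟩ := exists_rep π x
  have h' : toBt π (piA π ^ n) * galB π σ x = toBt π (galA σ y) := by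
    have := congrArg (galB π σ) h
    rwa [map_mul, galB_toBt, galB_toBt, map_pow, galA_piA] at this
  have hv : ∀ a : Et p, vE p (galE σ a) = vE p a := by
    intro a
    by_cases ha : a = 0
    · rw [ha, map_zero]
    · rw [vE, vE, val_galE, if_neg ha, if_neg ((map_ne_zero (galE σ)).2 ha)]
  have hc : ∀ k, vE p (coeffB π (galB π σ x) k) = vE p (coeffB π x k) := by
    intro k
    rw [coeffB_eq π h, coeffB_eq π h']
    split_ifs
    · rfl
    · rw [coeffA, galA, RamWitt.coeff_map _ π.good, hv, coeffA]
  simp only [V, hc]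

end Norm

/-! ### The Banach spaces `B̃^{[r,s]}` and the Fréchet spaces `B̃_rig^{†,r}` -/

section Banach

variable {p : ℕ} [Fact p.Prime] {K : IntermediateField ℚ_[p] (PadicAlgCl p)}
  [FiniteDimensional ℚ_[p] K] (π : Uniformizer K)

/-- The action of `σ ∈ G_K` on `Ã⁺`. -/
def galAPlus (σ : Gal(PadicAlgCl p/K)) : AtPlus K →+* AtPlus K :=
  RamWitt.map (iotaPlus K) (iotaPlus K) (galPlus σ) (galPlus_comp_iotaPlus σ)

theorem galA_plusToAt (σ : Gal(PadicAlgCl p/K)) (y : AtPlus K) :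
    galA σ (plusToAt K y) = plusToAt K (galAPlus σ y) := by
  induction y using RamWitt.induction_on with
  | tmul c w =>
    rw [map_mul, map_mul, map_mul, map_mul, galA, galAPlus, plusToAt, RamWitt.map_ofInt,
      RamWitt.map_ofInt, RamWitt.map_ofInt, RamWitt.map_ofWitt, RamWitt.map_ofWitt,
      RamWitt.map_ofWitt, RamWitt.map_ofInt, RamWitt.map_ofWitt]
    congr 2
    ext n
    rw [WittVector.map_coeff, WittVector.map_coeff, WittVector.map_coeff, WittVector.map_coeff,
      galE_algebraMap]
  | add x y hx hy => rw [map_add, map_add, map_add, map_add, hx, hy]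

theorem galA_teichA (σ : Gal(PadicAlgCl p/K)) (a : Et p) :
    galA σ (teichA K a) = teichA K (galE σ a) := RamWitt.map_teich _ _ _

theorem teichA_mul (a b : Et p) : teichA K (a * b) = teichA K a * teichA K b :=
  RamWitt.teich_mul a b

theorem plusToAt_ofInt (c : OK K) :
    plusToAt K (RamWitt.ofInt (iotaPlus K) c) = RamWitt.ofInt (iota K) c :=
  RamWitt.map_ofInt _ _ _

theorem plusToAt_teich (a : EtPlus p) :
    plusToAt K (RamWitt.teich (iotaPlus K) a) = teichA K (algebraMap (EtPlus p) (Et p) a) :=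
  RamWitt.map_teich _ _ _

/-- `B̃⁺[1/[ū]] = Ã⁺[1/π, 1/[ū]]`, the ring of the `x ∈ B̃` such that `π^n [a] x ∈ Ã⁺` for some
`n ≥ 0` and some nonzero `a ∈ Ẽ⁺`. (If `v_E(ū) > 0`, then `a` divides a power of `ū`.) -/
def Bb : Subring (Bt π) where
  carrier := {x | ∃ (n : ℕ) (a : EtPlus p) (y : AtPlus K), a ≠ 0 ∧
    toBt π (piA π ^ n * teichA K (algebraMap (EtPlus p) (Et p) a)) * x = toBt π (plusToAt K y)}
  zero_mem' := ⟨0, 1, 0, one_ne_zero, by simp⟩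
  one_mem' := ⟨0, 1, 1, one_ne_zero, by
    simp [teichA, RamWitt.teich_one]⟩
  mul_mem' := by
    rintro x x' ⟨n, a, y, ha, h⟩ ⟨m, b, z, hb, h'⟩
    refine ⟨n + m, a * b, y * z, mul_ne_zero ha hb, ?_⟩
    rw [map_mul (plusToAt K), map_mul (toBt π) (plusToAt K y), ← h, ← h',
      map_mul (algebraMap (EtPlus p) (Et p)), teichA_mul, pow_add]
    simp only [map_mul]
    ring
  add_mem' := by
    rintro x x' ⟨n, a, y, ha, h⟩ ⟨m, b, z, hb, h'⟩
    refine ⟨n + m, a * b, RamWitt.ofInt (iotaPlus K) π.elt ^ m * RamWitt.teich (iotaPlus K) b * y +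
      RamWitt.ofInt (iotaPlus K) π.elt ^ n * RamWitt.teich (iotaPlus K) a * z,
      mul_ne_zero ha hb, ?_⟩
    rw [map_add (plusToAt K), map_mul (plusToAt K), map_mul (plusToAt K), map_mul (plusToAt K),
      map_mul (plusToAt K), map_pow (plusToAt K), map_pow (plusToAt K), plusToAt_ofInt,
      plusToAt_teich, plusToAt_teich, map_add (toBt π), map_mul (toBt π) _ (plusToAt K y),
      map_mul (toBt π) _ (plusToAt K z), ← h, ← h',
      map_mul (algebraMap (EtPlus p) (Et p)), teichA_mul, pow_add]
    simp only [map_mul, piA]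
    ring
  neg_mem' := by
    rintro x ⟨n, a, y, ha, h⟩
    exact ⟨n, a, -y, ha, by rw [mul_neg, h, map_neg, map_neg]⟩

theorem ofInt_mem_Bb (c : OK K) : toBt π (RamWitt.ofInt (iota K) c) ∈ Bb π :=
  ⟨0, 1, RamWitt.ofInt (iotaPlus K) c, one_ne_zero, by
    rw [plusToAt_ofInt]
    simp [teichA, RamWitt.teich_one]⟩

theorem teichA_mem_Bb (a : Et p) : toBt π (teichA K a) ∈ Bb π := by
  obtain ⟨b, c, hc, rfl⟩ := IsFractionRing.div_surjective (A := EtPlus p) a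
  have hc0 : c ≠ 0 := nonZeroDivisors.ne_zero hc
  refine ⟨0, c, RamWitt.teich (iotaPlus K) b, hc0, ?_⟩
  have hc1 : algebraMap (EtPlus p) (Et p) c ≠ 0 :=
    (map_ne_zero_iff _ (IsFractionRing.injective (EtPlus p) (Et p))).2 hc0
  rw [pow_zero, one_mul, ← map_mul, ← teichA_mul, mul_div_cancel₀ _ hc1, plusToAt_teich]

theorem galB_mem_Bb (σ : Gal(PadicAlgCl p/K)) {x : Bt π} (hx : x ∈ Bb π) :
    galB π σ x ∈ Bb π := by
  obtain ⟨n, a, y, ha, h⟩ := hx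
  refine ⟨n, galPlus σ a, galAPlus σ y, ?_, ?_⟩
  · exact (map_ne_zero_iff _ (galPlus_injective σ)).2 ha
  · have := congrArg (galB π σ) h
    rwa [map_mul, galB_toBt, galB_toBt, map_mul, map_pow, galA_piA, galA_teichA, galE_algebraMap,
      galA_plusToAt] at this

/-- The intervals `[r, s]` with `0 < r ≤ s`. -/
structure PosInterval where
  /-- the left end -/
  r : ℝ
  /-- the right end -/
  s : ℝ
  pos : 0 < r
  le : r ≤ s

/-- `V(x, [r,s]) = inf_{t ∈ [r,s]} V(x, t)`. -/
def VI (I : PosInterval) (x : Bt π) : EReal := ⨅ t ∈ Set.Icc I.r I.s, V π x t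

theorem le_VI_iff {I : PosInterval} {x : Bt π} {c : EReal} :
    c ≤ VI π I x ↔ ∀ t ∈ Set.Icc I.r I.s, c ≤ V π x t := by
  simp only [VI, le_iInf_iff]

theorem coeffA_plusToAt (y : AtPlus K) (k : ℕ) : val p (coeffA π (plusToAt K y) k) ≤ 1 := by
  rw [coeffA, plusToAt, RamWitt.coeff_map _ π.good, val_algebraMap]
  exact valPlus_le_one p _

theorem VI_ne_bot (I : PosInterval) {x : Bt π} (hx : x ∈ Bb π) : VI π I x ≠ ⊥ := by
  obtain ⟨n, a, y, ha, h⟩ := hx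
  obtain ⟨m, x', hx'⟩ := exists_rep π x
  have hp1 : (1 : ℝ) < p := by exact_mod_cast (Fact.out : p.Prime).one_lt
  have ha1 : algebraMap (EtPlus p) (Et p) a ≠ 0 :=
    (map_ne_zero_iff _ (IsFractionRing.injective (EtPlus p) (Et p))).2 ha
  set a' := algebraMap (EtPlus p) (Et p) a with ha'
  have hv : 0 < val p a' := pos_iff_ne_zero.2 ((val p).ne_zero_iff.2 ha1)
  have hv1 : val p a' ≤ 1 := by rw [ha', val_algebraMap]; exact valPlus_le_one p a
  have e1 : piA π ^ n * (teichA K a' * x') = piA π ^ m * plusToAt K y := by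
    apply toBt_injective π
    rw [map_mul, map_mul (toBt π) (piA π ^ m), ← h, map_mul, ← hx', map_mul]
    ring
  have e2 : ∀ k, val p (coeffA π x' k) ≤ (val p a')⁻¹ := by
    intro k
    have h1 := RamWitt.coeff_pi_pow_mul π.good n (teichA K a' * x') k
    have h2 : val p (RamWitt.coeff (iota K) π.elt
        (RamWitt.ofInt (iota K) π.elt ^ n * (teichA K a' * x')) (k + n)) ≤ 1 := by
      have e3 : RamWitt.ofInt (iota K) π.elt ^ n * (teichA K a' * x') =
        plusToAt K (RamWitt.ofInt (iotaPlus K) π.elt ^ m * y) := by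
        rw [map_mul, map_pow, plusToAt_ofInt]
        exact e1
      rw [e3]
      exact coeffA_plusToAt π _ _
    rw [h1, teichA, RamWitt.coeff_teich_mul π.good, map_mul] at h2
    rw [← one_div, le_div_iff₀ hv, mul_comm]
    exact h2
  have hq : (0 : ℝ) < p / (p - 1) := div_pos (by linarith) (by linarith)
  set L : ℝ := -Real.logb p (val p a') with hL
  have hL0 : 0 ≤ L := by
    rw [hL, Left.nonneg_neg_iff]
    exact Real.logb_nonpos hp1 (by positivity) (by exact_mod_cast hv1)
  set C : ℝ := -(m * vPi π) - L / (p / (p - 1) * I.r) with hC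
  have hD : 0 < (p : ℝ) / (p - 1) * I.r := mul_pos hq I.pos
  have key : (C : EReal) ≤ VI π I x := by
    rw [le_VI_iff]
    intro t ht
    have ht0 : 0 < t := I.pos.trans_le ht.1
    rw [le_V_iff π ht0 hx']
    intro k
    refine (e2 k).trans ((?_ : (val p a')⁻¹ ≤ bnd π C t (-m)).trans (bnd_mono π ht0 (by omega)))
    rw [← NNReal.coe_le_coe]
    change _ ≤ (p : ℝ) ^ (-((C - ((-m : ℤ) : ℝ) * vPi π) * (p * t / (p - 1))))
    have hva : (0 : ℝ) < ((val p a')⁻¹ : ℝ≥0) := by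
      rw [NNReal.coe_pos]; exact inv_pos.2 hv
    rw [← Real.logb_le_iff_le_rpow hp1 hva, NNReal.coe_inv, Real.logb_inv]
    change L ≤ _
    have e4 : -((C - ((-m : ℤ) : ℝ) * vPi π) * (p * t / (p - 1))) =
        L * ((p / (p - 1) * t) / (p / (p - 1) * I.r)) := by
      rw [hC]; push_cast; ring
    rw [e4]
    have h5 : 1 ≤ ((p : ℝ) / (p - 1) * t) / (p / (p - 1) * I.r) := by
      rw [one_le_div hD]
      exact mul_le_mul_of_nonneg_left ht.1 hq.le
    nlinarith
  intro hbot
  rw [hbot, le_bot_iff] at key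
  exact EReal.coe_ne_bot C key

open Classical in
/-- The norm `p^{-V(x, I)}`. -/
def normI (I : PosInterval) (x : Bt π) : ℝ :=
  if VI π I x = ⊤ then 0 else (p : ℝ) ^ (-(VI π I x).toReal)

theorem normI_nonneg (I : PosInterval) (x : Bt π) : 0 ≤ normI π I x := by
  rw [normI]
  split_ifs <;> positivity

theorem normI_le_iff (I : PosInterval) {x : Bt π} (hx : x ∈ Bb π) (c : ℝ) :
    normI π I x ≤ (p : ℝ) ^ (-c) ↔ (c : EReal) ≤ VI π I x := by
  have hp1 : (1 : ℝ) < p := by exact_mod_cast (Fact.out : p.Prime).one_lt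
  have hb := VI_ne_bot π I hx
  rw [normI]
  split_ifs with h
  · rw [h]
    simp only [le_top, iff_true]
    positivity
  · rw [Real.rpow_le_rpow_left_iff hp1, neg_le_neg_iff]
    conv_rhs => rw [← EReal.coe_toReal h hb]
    rw [EReal.coe_le_coe_iff]

theorem normI_le_of_forall (I : PosInterval) {x : Bt π} (hx : x ∈ Bb π) {M : ℝ} (hM : 0 ≤ M)
    (h : ∀ c : ℝ, M ≤ (p : ℝ) ^ (-c) → (c : EReal) ≤ VI π I x) : normI π I x ≤ M := by
  have hp1 : (1 : ℝ) < p := by exact_mod_cast (Fact.out : p.Prime).one_lt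
  have hp0 : (0 : ℝ) < p := by linarith
  rcases hM.eq_or_lt with rfl | hM
  · have : VI π I x = ⊤ := by
      rw [EReal.eq_top_iff_forall_lt]
      intro c
      exact lt_of_lt_of_le (EReal.coe_lt_coe_iff.2 (lt_add_one c)) (h _ (by positivity))
    rw [normI, if_pos this]
  · have e : (p : ℝ) ^ (-(-Real.logb p M)) = M := by
      rw [neg_neg, Real.rpow_logb hp0 hp1.ne' hM]
    rw [← e, normI_le_iff π I hx]
    exact h _ e.ge

/-- `B̃⁺[1/[ū]]`, regarded with the norm `p^{-V(·, I)}`. -/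
def BPre (_I : PosInterval) : Type := Bb π

instance (I : PosInterval) : AddCommGroup (BPre π I) := inferInstanceAs (AddCommGroup (Bb π))

/-- `p^{-V(·, I)}` as a seminorm. -/
def seminormI (I : PosInterval) : AddGroupSeminorm (BPre π I) where
  toFun x := normI π I x.1
  map_zero' := by
    have : VI π I (0 : Bt π) = ⊤ := by
      rw [eq_top_iff, le_VI_iff]
      intro t ht
      rw [V_zero π t (I.pos.trans_le ht.1)]
    change normI π I (0 : Bt π) = 0
    rw [normI, if_pos this]
  add_le' x y := by
    change normI π I (x.1 + y.1) ≤ _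
    refine (normI_le_of_forall π I ((Bb π).add_mem x.2 y.2)
      ((normI_nonneg π I x.1).trans (le_max_left _ (normI π I y.1))) ?_).trans
      (max_le_add_of_nonneg (normI_nonneg π I _) (normI_nonneg π I _))
    intro c hc
    rw [max_le_iff, normI_le_iff π I x.2, normI_le_iff π I y.2, le_VI_iff, le_VI_iff] at hc
    rw [le_VI_iff]
    exact fun t ht => V_add π (I.pos.trans_le ht.1) (hc.1 t ht) (hc.2 t ht)
  neg' x := by
    have key : ∀ y : Bb π, normI π I (-y.1) ≤ normI π I y.1 := by
      intro y
      refine normI_le_of_forall π I ((Bb π).neg_mem y.2) (normI_nonneg π I _) ?_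
      intro c hc
      rw [normI_le_iff π I y.2, le_VI_iff] at hc
      rw [le_VI_iff]
      exact fun t ht => V_neg π (I.pos.trans_le ht.1) (hc t ht)
    change normI π I (-x.1) = normI π I x.1
    refine le_antisymm (key x) ?_
    have := key ⟨-x.1, (Bb π).neg_mem x.2⟩
    rwa [neg_neg] at this

instance (I : PosInterval) : SeminormedAddCommGroup (BPre π I) :=
  (seminormI π I).toSeminormedAddCommGroup

theorem norm_BPre {I : PosInterval} (x : BPre π I) : ‖x‖ = normI π I x.1 := rfl

variable (K) in
/-- The map `ℤ_p → 𝓞_K`. -/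
def zpToOK : ℤ_[p] →+* OK K :=
  ((algebraMap ℚ_[p] K).comp PadicInt.Coe.ringHom).codRestrict (OK K) fun t => by
    rw [mem_OK]
    change ‖((t : ℚ_[p]) : PadicAlgCl p)‖ ≤ 1
    rw [PadicAlgCl.norm_extends]
    exact t.2

/-- The map `ℤ_p → B̃⁺[1/[ū]]`. -/
def zpToBb : ℤ_[p] →+* Bb π :=
  (((toBt π).comp (RamWitt.ofInt (iota K))).comp (zpToOK K)).codRestrict (Bb π)
    fun t => ofInt_mem_Bb π (zpToOK K t)

instance (I : PosInterval) : Module ℤ_[p] (BPre π I) :=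
  (Module.compHom (Bb π) (zpToBb π) : Module ℤ_[p] (Bb π))

theorem coe_smul {I : PosInterval} (t : ℤ_[p]) (x : BPre π I) :
    (t • x).1 = toBt π (RamWitt.ofInt (iota K) (zpToOK K t)) * x.1 := rfl

theorem norm_smul_le {I : PosInterval} (t : ℤ_[p]) (x : BPre π I) : ‖t • x‖ ≤ ‖x‖ := by
  refine normI_le_of_forall π I (t • x).2 (normI_nonneg π I _) ?_
  intro c hc
  rw [norm_BPre, normI_le_iff π I x.2, le_VI_iff] at hc
  rw [coe_smul, le_VI_iff]
  intro s hs
  have := V_mul π (I.pos.trans_le hs.1) (hc s hs) (RamWitt.ofInt (iotaInt K) (zpToOK K t))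
  rwa [intToAt, RamWitt.map_ofInt] at this

instance (I : PosInterval) : UniformContinuousConstSMul ℤ_[p] (BPre π I) :=
  ⟨fun t => uniformContinuous_addMonoidHom_of_continuous
    (f := DistribSMul.toAddMonoidHom (BPre π I) t)
    (AddMonoidHomClass.continuous_of_bound _ 1 fun x => by
      rw [one_mul]; exact norm_smul_le π t x)⟩

/-- `B̃^{[r,s]}`, the completion of `B̃⁺[1/[ū]]` for `V(·, [r,s])`. -/
abbrev BtI (I : PosInterval) : Type := UniformSpace.Completion (BPre π I)

/-- The action of `σ ∈ G_K` on `B̃⁺[1/[ū]]`. -/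
def galPre (I : PosInterval) (σ : Gal(PadicAlgCl p/K)) : BPre π I →+ BPre π I where
  toFun x := ⟨galB π σ x.1, galB_mem_Bb π σ x.2⟩
  map_zero' := Subtype.ext (map_zero (galB π σ))
  map_add' x y := Subtype.ext (map_add (galB π σ) x.1 y.1)

theorem norm_galPre (I : PosInterval) (σ : Gal(PadicAlgCl p/K)) (x : BPre π I) :
    ‖galPre π I σ x‖ = ‖x‖ := by
  change normI π I (galB π σ x.1) = normI π I x.1
  have h : VI π I (galB π σ x.1) = VI π I x.1 := by simp only [VI, V_gal]
  rw [normI, normI, h]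

/-- The action of `σ ∈ G_K` on `B̃^{[r,s]}`. -/
def galBtI (I : PosInterval) (σ : Gal(PadicAlgCl p/K)) : BtI π I →+ BtI π I :=
  (galPre π I σ).completion (AddMonoidHomClass.continuous_of_bound _ 1 fun x => by
    rw [one_mul]; exact (norm_galPre π I σ x).le)

/-- The identity of `B̃⁺[1/[ū]]`, as a map between different norms. -/
def resPre (I J : PosInterval) : BPre π I →+ BPre π J := AddMonoidHom.id (Bb π)

theorem norm_resPre_le {I J : PosInterval} (h : Set.Icc J.r J.s ⊆ Set.Icc I.r I.s)
    (x : BPre π I) : ‖resPre π I J x‖ ≤ ‖x‖ := by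
  refine normI_le_of_forall π J (resPre π I J x).2 (normI_nonneg π I _) ?_
  intro c hc
  rw [norm_BPre, normI_le_iff π I x.2, le_VI_iff] at hc
  rw [le_VI_iff]
  exact fun t ht => hc t (h ht)

/-- The restriction map `B̃^I → B̃^J` for `J ⊆ I`. -/
def res {I J : PosInterval} (h : Set.Icc J.r J.s ⊆ Set.Icc I.r I.s) : BtI π I →+ BtI π J :=
  (resPre π I J).completion (AddMonoidHomClass.continuous_of_bound _ 1 fun x => by
    rw [one_mul]; exact norm_resPre_le π h x)

/-- The interval `[r, s]` with `s ∈ [r, ∞[`. -/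
def interval (r : Set.Ioi (0 : ℝ)) (s : Set.Ici (r : ℝ)) : PosInterval :=
  ⟨r, s, r.2, s.2⟩

theorem interval_subset (r : Set.Ioi (0 : ℝ)) {s s' : Set.Ici (r : ℝ)} (h : s ≤ s') :
    Set.Icc (interval r s).r (interval r s).s ⊆ Set.Icc (interval r s').r (interval r s').s :=
  Set.Icc_subset_Icc le_rfl h

/-- `B̃_rig^{†,r} = B̃^{[r,∞[} = lim_s B̃^{[r,s]}`. -/
def BtRig (r : Set.Ioi (0 : ℝ)) : Type :=
  {y : ∀ s : Set.Ici (r : ℝ), BtI π (interval r s) //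
    ∀ (s s' : Set.Ici (r : ℝ)) (h : s ≤ s'), res π (interval_subset r h) (y s') = y s}

theorem term_mem_Bb (k : ℕ) (a : Et p) : toBt π (piA π ^ k * teichA K a) ∈ Bb π := by
  rw [map_mul, map_pow]
  exact (Bb π).mul_mem ((Bb π).pow_mem (ofInt_mem_Bb π π.elt) k) (teichA_mem_Bb π a)

/-- The element `π^k [a]` of `B̃⁺[1/[ū]]`. -/
def termPre (I : PosInterval) (k : ℕ) (a : Et p) : BPre π I :=
  ⟨toBt π (piA π ^ k * teichA K a), term_mem_Bb π k a⟩

/-- The element `π^k [a]` of `B̃^{[r,s]}`. -/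
def termI (I : PosInterval) (k : ℕ) (a : Et p) : BtI π I := (termPre π I k a : BtI π I)

/-- `y ∈ B̃_rig^{†,r}` is the image of `x = ∑_{k ≥ 0} π^k [x_k] ∈ Ã`, that is, the series
`∑_{k ≥ 0} π^k [x_k]` converges to `y` in `B̃_rig^{†,r}`. -/
def IsImage {r : Set.Ioi (0 : ℝ)} (x : At K) (y : BtRig π r) : Prop :=
  ∀ s, HasSum (fun k : ℕ => termI π (interval r s) k (coeffA π x k)) (y.1 s)

end Banach

/-! ### Uniform pro-`p` groups and coordinates -/

section Groups

/-- The lower `p`-series `P_1 = G`, `P_{i+1} = closure of P_i^p [P_i, G]`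
(indexed here from `0`). -/
def lowerP (p : ℕ) (G : Type) [Group G] [TopologicalSpace G] [IsTopologicalGroup G] :
    ℕ → Subgroup G
  | 0 => ⊤
  | i + 1 => (Subgroup.closure ((fun g => g ^ p) '' (lowerP p G i : Set G)) ⊔
      ⁅lowerP p G i, (⊤ : Subgroup G)⁆).topologicalClosure

/-- Uniform pro-`p` groups: topologically finitely generated powerful pro-`p` groups whose lower
`p`-series has constant indices. -/
structure IsUniformProP (p : ℕ) (G : Type) [Group G] [TopologicalSpace G]
    [IsTopologicalGroup G] : Prop where
  compact : CompactSpace G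
  hausdorff : T2Space G
  totallyDisconnected : TotallyDisconnectedSpace G
  pro_p : ∀ U : Subgroup G, U.Normal → IsOpen (U : Set G) → ∃ n : ℕ, U.index = p ^ n
  fg : ∃ S : Finset G, (Subgroup.closure (S : Set G)).topologicalClosure = ⊤
  powerful : commutator G ≤ (Subgroup.closure
    (Set.range fun g : G => g ^ (if p = 2 then 4 else p))).topologicalClosure
  uniform : ∀ i, (lowerP p G (i + 1)).relIndex (lowerP p G i) =
    (lowerP p G 1).relIndex (lowerP p G 0)

/-- An open uniform pro-`p` subgroup `G_0` of a topological group `G`, with a coordinate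
`c : G_0 → ℤ_p^d` such that, for `G_i = {g^{p^i}, g ∈ G_0}`, one has `c(G_i) = (p^i ℤ_p)^d`, and
`g h⁻¹ ∈ G_i` if and only if `c(g) - c(h) ∈ (p^i ℤ_p)^d`. Such a pair exists for some `d` if and
only if `G` is a `p`-adic Lie group, of dimension `d`. -/
structure Coordinates (p : ℕ) [Fact p.Prime] (G : Type) [Group G] [TopologicalSpace G]
    [IsTopologicalGroup G] (d : ℕ) where
  /-- the subgroup `G_0` -/
  G0 : Subgroup G
  isOpen : IsOpen (G0 : Set G)
  isUniform : IsUniformProP p G0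
  /-- the coordinate -/
  c : G0 ≃ₜ (Fin d → ℤ_[p])
  image_pow : ∀ i : ℕ, c '' (Set.range fun g : G0 => g ^ p ^ i) =
    {t | ∀ j, (p : ℤ_[p]) ^ i ∣ t j}
  mul_inv_mem : ∀ (i : ℕ) (g h : G0),
    (g * h⁻¹ ∈ Set.range fun g : G0 => g ^ p ^ i) ↔ ∀ j, (p : ℤ_[p]) ^ i ∣ c g j - c h j

/-- The inverse of the coordinate `p^{-m} c : G_m → ℤ_p^d` of `G_m = {g^{p^m}, g ∈ G_0}`. -/
def Coordinates.param {p : ℕ} [Fact p.Prime] {G : Type} [Group G] [TopologicalSpace G]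
    [IsTopologicalGroup G] {d : ℕ} (C : Coordinates p G d) (m : ℕ) (t : Fin d → ℤ_[p]) : G :=
  C.c.symm fun j => (p : ℤ_[p]) ^ m * t j

end Groups

/-! ### Locally analytic and pro-analytic vectors -/

section Vectors

/-- The Mahler coefficients `a_n(F) = ∑_{k ≤ n} (∏_i (-1)^{n_i - k_i} (n_i choose k_i)) F(k)` of a
function `F` on `ℤ_p^d`, so that `F(t) = ∑_n (∏_i (t_i choose n_i)) a_n(F)` for continuous `F`
with values in a complete group. -/
def mahler {p : ℕ} [Fact p.Prime] {d : ℕ} {M : Type} [AddCommGroup M]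
    (F : (Fin d → ℤ_[p]) → M) (n : Fin d → ℕ) : M :=
  ∑ k ∈ Finset.Icc 0 n, (∏ i, (-1 : ℤ) ^ (n i - k i) * ((n i).choose (k i) : ℤ)) •
    F fun i => (k i : ℤ_[p])

/-- `p^λ p^{⌊log_p |n|_∞⌋}`, which is `0` for `n = 0`. -/
def growth (p : ℕ) {d : ℕ} (lam : ℝ) (n : Fin d → ℕ) : ℝ :=
  if n = 0 then 0 else (p : ℝ) ^ lam * (p : ℝ) ^ Nat.log p (Finset.univ.sup n)

variable {p : ℕ} [Fact p.Prime] {K : IntermediateField ℚ_[p] (PadicAlgCl p)}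
  [FiniteDimensional ℚ_[p] K] (π : Uniformizer K)

/-- `Ã^{†,r}`, the set of the `x = ∑_{k ≥ 0} π^k [x_k]` such that the sequence
`v_E(x_k) + (pr/(p-1)) (k/e)` has nonnegative terms and tends to `+∞`. -/
def AtDaggerR (r : ℝ) : Set (At K) :=
  {x | (∀ k : ℕ, 0 ≤ vE p (coeffA π x k) + ((p * r / (p - 1) * (k * vPi π) : ℝ) : EReal)) ∧
    Filter.Tendsto
      (fun k : ℕ => vE p (coeffA π x k) + ((p * r / (p - 1) * (k * vPi π) : ℝ) : EReal))
      Filter.atTop (nhds ⊤)}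

variable (p) in
/-- `r_0 = (p-1)/p`. -/
def rZero : ℝ := ((p : ℝ) - 1) / p

/-- `Ã^{(0,ρ]} = Ã^{†,r}[1/[ū]]` with `r = r_0/ρ`. -/
def AtRho (ρ : ℝ) : Set (At K) :=
  {x | ∃ a : EtPlus p, a ≠ 0 ∧
    teichA K (algebraMap (EtPlus p) (Et p) a) * x ∈ AtDaggerR π (rZero p / ρ)}

/-- `Ã^† = ⋃_{ρ > 0} Ã^{(0,ρ]}`. -/
def AtDagger : Set (At K) := {x | ∃ ρ > 0, x ∈ AtRho π ρ}

/-- `v_ρ = (r/r_0) V(·, r)` with `r = r_0/ρ`. -/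
def vRho (ρ : ℝ) (x : At K) : EReal :=
  ((1 / ρ : ℝ) : EReal) * V π (toBt π x) (rZero p / ρ)

variable (Kinf : IntermediateField K (PadicAlgCl p))

/-- The invariants of `Ã` under `H_K = Gal(ℚ̄_p/K_∞)`. -/
def AtFixed : Set (At K) := {x | ∀ σ ∈ Kinf.fixingSubgroup, galA σ x = x}

/-- `Ã_K^†`, the `H_K`-invariants of `Ã^†`. -/
def AtDaggerK : Set (At K) := AtDagger π ∩ AtFixed Kinf

variable {Kinf} [IsGalois K Kinf]

/-- A lift of `γ ∈ Γ_K = Gal(K_∞/K)` to `G_K`. Its action on `H_K`-invariants does not depend on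
the choice of the lift, and is the action of `γ`. -/
def liftGal (γ : Gal(Kinf/K)) : Gal(PadicAlgCl p/K) := γ.liftNormal (PadicAlgCl p)

variable {d : ℕ} (C : Coordinates p Gal(Kinf/K) d)

/-- The orbit map `g ↦ g(x)` on `Γ_m`, in the coordinate `p^{-m} c`, for `x ∈ Ã_K`. -/
def orbitA (m : ℕ) (x : At K) (t : Fin d → ℤ_[p]) : At K := galA (liftGal (C.param m t)) x

/-- `x` is `(λ, μ)`-analytic for `Γ_m` and `v_ρ`: the orbit map of `x` on `Γ_m` is continuous,
and its Mahler coefficients satisfy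
`v_ρ(a_n) ≥ p^λ p^{⌊log_p |n|_∞⌋} + μ`. -/
def IsMahlerAnalytic (ρ : ℝ) (m : ℕ) (lam μ : ℝ) (x : At K) : Prop :=
  (∀ (t : Fin d → ℤ_[p]) (B : ℝ), ∀ᶠ t' in nhds t,
    (B : EReal) ≤ vRho π ρ (orbitA C m x t' - orbitA C m x t)) ∧
  ∀ n : Fin d → ℕ, ((growth p lam n + μ : ℝ) : EReal) ≤ vRho π ρ (mahler (orbitA C m x) n)

/-- `(Ã_K^†)^{Γ_K-la} = ⋃_{ρ > 0} (Ã_K^{(0,ρ]})^{Γ_K-la}`. -/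
def laVectors : Set (At K) :=
  {x | ∃ ρ > 0, x ∈ AtRho π ρ ∩ AtFixed Kinf ∧ ∃ (m : ℕ) (lam μ : ℝ),
    IsMahlerAnalytic π C ρ m lam μ x}

variable (Kinf) in
/-- `B̃_K^{[r,s]}`, the `H_K`-invariants of `B̃^{[r,s]}`. -/
def BtIFixed (I : PosInterval) : Set (BtI π I) :=
  {y | ∀ σ ∈ Kinf.fixingSubgroup, galBtI π I σ y = y}

/-- `y ∈ B̃_K^{[r,s]}` is a `Γ_m`-analytic vector: there is a family `w_k → 0` in `B̃_K^{[r,s]}`,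
indexed by `k ∈ ℕ^d`, such that `g(y) = ∑_k t^k w_k` for all `g ∈ Γ_m` with
coordinate `t = p^{-m} c(g)`. -/
def IsAnalytic (I : PosInterval) (m : ℕ) (y : BtI π I) : Prop :=
  ∃ w : (Fin d → ℕ) → BtI π I, (∀ k, w k ∈ BtIFixed π Kinf I) ∧
    Filter.Tendsto w Filter.cofinite (nhds 0) ∧
    ∀ t : Fin d → ℤ_[p], HasSum (fun k : Fin d → ℕ => (∏ i, t i ^ k i) • w k)
      (galBtI π I (liftGal (C.param m t)) y)

/-- `(B̃_K^{[r,s]})^{Γ_K-la}`. -/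
def laVectorsI (I : PosInterval) : Set (BtI π I) :=
  {y | y ∈ BtIFixed π Kinf I ∧ ∃ m, IsAnalytic π C I m y}

variable (Kinf) in
/-- `B̃_{rig,K}^{†,r}`, the `H_K`-invariants of `B̃_rig^{†,r}`. -/
def BtRigFixed (r : Set.Ioi (0 : ℝ)) : Set (BtRig π r) :=
  {y | ∀ s, y.1 s ∈ BtIFixed π Kinf (interval r s)}

/-- `(B̃_{rig,K}^{†,r})^{Γ_K-pa}`: all the images in the `B̃_K^{[r,s]}` are locally analytic. -/
def paVectorsR (r : Set.Ioi (0 : ℝ)) : Set (BtRig π r) :=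
  {y | y ∈ BtRigFixed π Kinf r ∧ ∀ s, y.1 s ∈ laVectorsI π C (interval r s)}

/-- The elements of `Ã` that belong to
`(B̃_{rig,K}^†)^{Γ_K-pa} = ⋃_{r > 0} (B̃_{rig,K}^{†,r})^{Γ_K-pa}`. -/
def paVectors : Set (At K) :=
  {x | ∃ (r : Set.Ioi (0 : ℝ)) (y : BtRig π r), IsImage π x y ∧ y ∈ paVectorsR π C r}

end Vectors

end

end PeriodRings

open PeriodRings

namespace PeriodRings

noncomputable section

/-! ### Binomial polynomials on `p^h ℤ_p` -/

section Binomial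

variable {p : ℕ} [Fact p.Prime]

/-! Both notions of analyticity are read off the Mahler coefficients `a_n` of the orbit map `g ↦
g(x)`: each amounts to the valuation of `a_n` growing at least linearly in `|n|`. The function
`p^⌊log_p |n|⌋` lies between `|n|/p` and `|n|`, so the growth condition defining `laVectors` is
linear up to constants.

The first ingredient is Amice's criterion, for functions on `ℤ_p^d` with values in a complete
ultrametric `ℤ_p`-module. The `n`-th difference at `0` of a monomial is divisible by `∏ n_i!`, so a
convergent power series has linearly decaying coefficients (`continuous_and_norm_mahler_le`).
Conversely `p^⌊n/p^h⌋ (p^h u choose n)` is an integral polynomial in `u`, so rewriting a Mahler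
series on `p^h ℤ_p^d` as a power series costs about `d|n|/p^h` divisions by `p`, and any linear
decay absorbs this once `h` is large (`exists_power_series_of_mahler`).

The second ingredient is the change of radius. Only powers `π^k` with `k ≥ 0` occur in an element of
`Ã`, so `t V(x,t)` is nondecreasing in `t`. A lower bound for `V(·,r)` therefore propagates to all
of `[r,s]`, with slope multiplied by `r/s` (`le_VI_of_le_V`). The required `h` depends on `s`, so
the conclusion is pro-analyticity. In the other direction a bound on `[r,s]` contains the bound at
`s`, so a single sufficiently large `s` suffices.

The bridge between `Ã` and the completions is `imageGraph`. The map from `B̃` to `B̃^{[r,s]}` is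
only partially defined, and it is replaced by the relation of having common approximations. This
relation is additive, Galois stable, single-valued and compatible with valuations, so it carries
Mahler coefficients to Mahler coefficients. It is also injective on `Ã`, because `Ã` is `π`-adically
separated (`eq_zero_of_coeffA_eq_zero`). Hence invariance under `H_K` can be checked in the
completion, and the second assertion needs no invariance of `x` beforehand. -/

theorem factorial_dvd_p_pow (M : ℕ) : (M.factorial : ℤ_[p]) ∣ (p : ℤ_[p]) ^ M := by
  have hp := (Fact.out : p.Prime)
  obtain ⟨q, hq⟩ : ∃ q, M.factorial = p ^ padicValNat p M.factorial * q := pow_padicValNat_dvd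
  have h0 : M.factorial ≠ 0 := M.factorial_ne_zero
  have hq0 : ¬ p ∣ q := by
    rintro ⟨q', rfl⟩
    refine pow_succ_padicValNat_not_dvd (p := p) h0 ⟨q', ?_⟩
    rw [pow_succ, mul_assoc]
    exact hq
  have hu : IsUnit (q : ℤ_[p]) := by
    rw [PadicInt.isUnit_iff]
    exact (PadicInt.norm_natCast_eq_one_iff).2 ((Nat.Prime.coprime_iff_not_dvd hp).2 hq0)
  have hle : padicValNat p M.factorial ≤ M := by
    have := sub_one_mul_padicValNat_factorial (p := p) M
    have h2 : 1 ≤ p - 1 := by have := hp.two_le; omega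
    calc _ ≤ (p - 1) * padicValNat p M.factorial := Nat.le_mul_of_pos_left _ h2
      _ ≤ M := by omega
  rw [hq, Nat.cast_mul, Nat.cast_pow]
  exact (hu.mul_right_dvd).2 (pow_dvd_pow _ hle)

theorem natCast_dvd_gcd (h n : ℕ) (hn : ¬ p ^ h ∣ n) :
    (n : ℤ_[p]) ∣ ((Nat.gcd (p ^ h) n : ℕ) : ℤ_[p]) := by
  have hp := (Fact.out : p.Prime)
  have h0 : n ≠ 0 := by rintro rfl; exact hn (dvd_zero _)
  obtain ⟨v, q, hq0, rfl⟩ := Nat.exists_eq_pow_mul_and_not_dvd h0 p hp.ne_one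
  have hu : IsUnit (q : ℤ_[p]) := by
    rw [PadicInt.isUnit_iff]
    exact (PadicInt.norm_natCast_eq_one_iff).2 ((Nat.Prime.coprime_iff_not_dvd hp).2 hq0)
  have hv : v ≤ h := by
    by_contra! hlt
    exact hn (Dvd.dvd.mul_right (pow_dvd_pow _ hlt.le) _)
  rw [Nat.cast_mul]
  refine (hu.mul_right_dvd).2 ?_
  exact Nat.cast_dvd_cast (Nat.dvd_gcd (pow_dvd_pow _ hv) (Dvd.intro _ rfl))

/-- Factors of `n!` not divisible by `p^h` agree with their gcd with `p^h` up to a unit of `ℤ_p`.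
The others are `p^h q` with `q = 1, …, ⌊n/p^h⌋`, and these `q` multiply to the extra factorial. -/
theorem factorial_dvd_prod_gcd (h n : ℕ) :
    (n.factorial : ℤ_[p]) ∣ ((n / p ^ h).factorial : ℤ_[p]) *
      ∏ i ∈ Finset.range n, ((Nat.gcd (p ^ h) (i + 1) : ℕ) : ℤ_[p]) := by
  have hp := (Fact.out : p.Prime)
  induction n with
  | zero => simp
  | succ n ih =>
    rw [Finset.prod_range_succ, Nat.factorial_succ, Nat.succ_div]
    split_ifs with hd
    · obtain ⟨q, hq⟩ := hd
      have e : n / p ^ h + 1 = q := by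
        have h1 : (n + 1) / p ^ h = q := by rw [hq, Nat.mul_div_cancel_left _ (pow_pos hp.pos h)]
        rw [← h1, Nat.succ_div, if_pos ⟨q, hq⟩]
      rw [Nat.factorial_succ, e, hq, Nat.gcd_eq_left (Dvd.intro _ rfl)]
      push_cast
      calc (p : ℤ_[p]) ^ h * q * n.factorial ∣ (p : ℤ_[p]) ^ h * q *
            (((n / p ^ h).factorial : ℤ_[p]) *
              ∏ i ∈ Finset.range n, ((Nat.gcd (p ^ h) (i + 1) : ℕ) : ℤ_[p])) :=
            mul_dvd_mul_left _ ih
        _ = _ := by ring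
    · rw [add_zero, Nat.cast_mul, mul_comm, ← mul_assoc]
      exact mul_dvd_mul ih (natCast_dvd_gcd h (n + 1) hd)

/-- The index is shifted because the numerator of `(p^h u choose n)` has the factors `p^h u - i`
with `0 ≤ i < n`. The shift trades `gcd(p^h, n)` for `gcd(p^h, 0) = p^h`, which can only enlarge the
product. -/
theorem factorial_dvd_p_pow_mul_prod_gcd (h n : ℕ) :
    (n.factorial : ℤ_[p]) ∣ (p : ℤ_[p]) ^ (n / p ^ h) *
      ∏ i ∈ Finset.range n, ((Nat.gcd (p ^ h) i : ℕ) : ℤ_[p]) := by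
  refine (factorial_dvd_prod_gcd h n).trans (mul_dvd_mul (factorial_dvd_p_pow _) ?_)
  cases n with
  | zero => simp
  | succ n =>
    rw [Finset.prod_range_succ, Finset.prod_range_succ' (fun i => ((Nat.gcd (p ^ h) i : ℕ) : ℤ_[p]))]
    refine mul_dvd_mul_left _ ?_
    rw [Nat.gcd_zero_right]
    exact Nat.cast_dvd_cast (Nat.gcd_dvd_left _ _)

/-- The function `u ↦ p^{⌊n/p^h⌋} (p^h u choose n)` is a polynomial with coefficients in `ℤ_p`. -/
theorem exists_polynomial_choose (p : ℕ) [Fact p.Prime] (h n : ℕ) :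
    ∃ Q : Polynomial ℤ_[p], Q.natDegree ≤ n ∧
      ∀ u : ℤ_[p], Q.eval u = (p : ℤ_[p]) ^ (n / p ^ h) * Ring.choose ((p : ℤ_[p]) ^ h * u) n := by
  open Polynomial in
  have hn : (n.factorial : ℤ_[p]) ≠ 0 := by exact_mod_cast n.factorial_ne_zero
  -- Each linear factor of the falling factorial has content `gcd(p^h, i)`; these contents together
  -- with `p^⌊n/p^h⌋` compensate the denominator `n!`.
  have hf : ∀ i : ℕ, ∃ q : Polynomial ℤ_[p], C ((p : ℤ_[p]) ^ h) * X - C (i : ℤ_[p]) =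
      C ((Nat.gcd (p ^ h) i : ℕ) : ℤ_[p]) * q ∧ q.natDegree ≤ 1 := by
    intro i
    obtain ⟨a, ha⟩ := Nat.gcd_dvd_left (p ^ h) i
    obtain ⟨b, hb⟩ := Nat.gcd_dvd_right (p ^ h) i
    refine ⟨C (a : ℤ_[p]) * X - C (b : ℤ_[p]), ?_, ?_⟩
    · have ha' : (p : ℤ_[p]) ^ h = ((Nat.gcd (p ^ h) i : ℕ) : ℤ_[p]) * a := by exact_mod_cast ha
      have hb' : (i : ℤ_[p]) = ((Nat.gcd (p ^ h) i : ℕ) : ℤ_[p]) * b := by exact_mod_cast hb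
      rw [ha', hb', C_mul, C_mul]; ring
    · compute_degree
  choose q hq hdeg using hf
  obtain ⟨a, ha⟩ := factorial_dvd_p_pow_mul_prod_gcd (p := p) h n
  refine ⟨C a * ∏ i ∈ Finset.range n, q i, ?_, ?_⟩
  · refine (natDegree_C_mul_le _ _).trans ((natDegree_prod_le _ _).trans ?_)
    calc _ ≤ ∑ i ∈ Finset.range n, 1 := Finset.sum_le_sum fun i _ => hdeg i
      _ = n := by simp
  · intro u
    apply mul_left_cancel₀ hn
    have h1 : (n.factorial : ℤ_[p]) * Ring.choose ((p : ℤ_[p]) ^ h * u) n =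
        ∏ i ∈ Finset.range n, ((p : ℤ_[p]) ^ h * u - i) := by
      rw [← nsmul_eq_mul, ← Ring.descPochhammer_eq_factorial_smul_choose]
      clear hn ha hq hdeg
      induction n with
      | zero => simp [smeval_one]
      | succ n ih =>
        rw [Finset.prod_range_succ, ← ih, descPochhammer_succ_right, smeval_mul, smeval_sub,
          smeval_X, smeval_natCast]
        simp
    have h2 : ∏ i ∈ Finset.range n, ((p : ℤ_[p]) ^ h * u - i) =
        (∏ i ∈ Finset.range n, ((Nat.gcd (p ^ h) i : ℕ) : ℤ_[p])) *
          ∏ i ∈ Finset.range n, (q i).eval u := by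
      rw [← Finset.prod_mul_distrib]
      refine Finset.prod_congr rfl fun i _ => ?_
      have := congrArg (Polynomial.eval u) (hq i)
      simpa only [eval_sub, eval_mul, eval_C, eval_X] using this
    rw [eval_mul, eval_C, eval_prod, ← mul_assoc, ← ha, mul_left_comm, h1, h2]
    ring

/-- The `n`-th difference at `0` of a monomial is divisible by `n!`. -/
theorem factorial_dvd_alternating_sum (n k : ℕ) :
    (n.factorial : ℤ) ∣ ∑ j ∈ Finset.Icc 0 n, (-1 : ℤ) ^ (n - j) * (n.choose j : ℤ) * (j : ℤ) ^ k := by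
  have hI : ∀ n : ℕ, Finset.Icc 0 n = Finset.range (n + 1) := fun n => by
    ext; simp
  have hD : ∀ (n : ℕ) (f : ℕ → ℤ), ∑ j ∈ Finset.Icc 0 n, (-1 : ℤ) ^ (n - j) * (n.choose j : ℤ) * f j
      = (fwdDiff 1)^[n] f 0 := by
    intro n f
    rw [fwdDiff_iter_eq_sum_shift, hI]
    simp [smul_eq_mul]
  rw [hD n (fun j => (j : ℤ) ^ k)]
  induction k generalizing n with
  | zero =>
    cases n with
    | zero => simp
    | succ n =>
      have : fwdDiff 1 (fun j : ℕ => (j : ℤ) ^ 0) = fun _ => 0 := by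
        funext j; simp [fwdDiff]
      rw [Function.iterate_succ_apply, this]
      have : ∀ n, (fwdDiff 1)^[n] (fun _ : ℕ => (0 : ℤ)) = fun _ => 0 := by
        intro n
        induction n with
        | zero => rfl
        | succ n ih => rw [Function.iterate_succ_apply', ih]; funext j; simp [fwdDiff]
      rw [this]; exact dvd_zero _
  | succ k ih =>
    cases n with
    | zero => simp
    | succ n =>
      -- From `(j+1) (n+1 choose j+1) = (n+1) (n choose j)`, the `(n+1)`-st difference of `j^(k+1)`
      -- at `0` is `n+1` times the `n`-th difference of `j^k` at `1`, and `Δ^n f(1) = Δ^n f(0) +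
      -- Δ^(n+1) f(0)`.
      have key : (fwdDiff 1)^[n + 1] (fun j : ℕ => (j : ℤ) ^ (k + 1)) 0 =
          (n + 1) * ((fwdDiff 1)^[n] (fun j : ℕ => (j : ℤ) ^ k) 0 +
            (fwdDiff 1)^[n + 1] (fun j : ℕ => (j : ℤ) ^ k) 0) := by
        have e1 : (fwdDiff 1)^[n] (fun j : ℕ => (j : ℤ) ^ k) 0 +
            (fwdDiff 1)^[n + 1] (fun j : ℕ => (j : ℤ) ^ k) 0 =
            (fwdDiff 1)^[n] (fun j : ℕ => (j : ℤ) ^ k) 1 := by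
          rw [Function.iterate_succ_apply']; simp [fwdDiff]
        rw [e1, fwdDiff_iter_eq_sum_shift, fwdDiff_iter_eq_sum_shift, Finset.sum_range_succ',
          Finset.mul_sum]
        simp only [smul_eq_mul, mul_one, zero_add, Nat.cast_zero, ne_eq, Nat.succ_ne_zero,
          not_false_eq_true, zero_pow, mul_zero, add_zero, Nat.reduceSubDiff]
        refine Finset.sum_congr rfl fun j _ => ?_
        have h3 : ((n + 1).choose (j + 1) : ℤ) * (j + 1) = (n + 1) * n.choose j := by
          exact_mod_cast (Nat.add_one_mul_choose_eq n j).symm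
        push_cast
        rw [add_comm 1 (j : ℤ), pow_succ ((j : ℤ) + 1)]
        linear_combination (-1 : ℤ) ^ (n - j) * ((j : ℤ) + 1) ^ k * h3
      rw [key, Nat.factorial_succ, Nat.cast_mul]
      push_cast
      refine mul_dvd_mul_left _ (dvd_add (ih n) ((Dvd.intro_left ((n : ℤ) + 1) ?_).trans (ih (n + 1))))
      rw [Nat.factorial_succ]; push_cast; ring

/-- Binomial inversion. -/
theorem sum_choose_mul_alternating (m k : ℕ) :
    ∑ n ∈ Finset.Icc 0 m, (m.choose n : ℤ) * ((-1 : ℤ) ^ (n - k) * (n.choose k : ℤ)) =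
      if k = m then 1 else 0 := by
  have hI : ∀ n : ℕ, Finset.Icc 0 n = Finset.range (n + 1) := fun n => by
    ext; simp
  -- Newton's formula `f(m) = ∑ (m choose n) Δ^n f(0)`, applied to the indicator function of `k`.
  have h1 := shift_eq_sum_fwdDiff_iter 1 (fun j : ℕ => if k = j then (1 : ℤ) else 0) m 0
  simp only [zero_add, smul_eq_mul, mul_one] at h1
  rw [h1, hI]
  refine Finset.sum_congr rfl fun n _ => ?_
  rw [fwdDiff_iter_eq_sum_shift, nsmul_eq_mul]
  congr 1
  simp only [zero_add, smul_eq_mul, mul_one, mul_ite, mul_zero]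
  rw [Finset.sum_ite_eq]
  split_ifs with h
  · rfl
  · rw [Nat.choose_eq_zero_of_lt (by simpa using h)]; simp

end Binomial

/-! ### Mahler expansions and power series on `ℤ_p^d` -/

section Expansions

variable {p : ℕ} [Fact p.Prime] {d : ℕ}

theorem Icc_zero_eq_piFinset (n : Fin d → ℕ) :
    Finset.Icc 0 n = Fintype.piFinset fun i => Finset.Icc 0 (n i) := rfl

/-- The added terms contain a vanishing binomial coefficient. A common summation box for all `n ≤ m`
allows the double sum in the inversion formula to be exchanged. -/
theorem mahler_eq_sum_of_le {M : Type} [AddCommGroup M] (F : (Fin d → ℤ_[p]) → M)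
    {n m : Fin d → ℕ} (hnm : n ≤ m) :
    mahler F n = ∑ k ∈ Finset.Icc 0 m, (∏ i, (-1 : ℤ) ^ (n i - k i) * ((n i).choose (k i) : ℤ)) •
      F fun i => (k i : ℤ_[p]) := by
  refine Finset.sum_subset (Finset.Icc_subset_Icc le_rfl hnm) fun k hk hk' => ?_
  obtain ⟨i, hi⟩ : ∃ i, n i < k i := by
    by_contra! h
    exact hk' (Finset.mem_Icc.2 ⟨(Finset.mem_Icc.1 hk).1, h⟩)
  rw [Finset.prod_eq_zero (Finset.mem_univ i), zero_smul]
  rw [Nat.choose_eq_zero_of_lt hi]; simp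

/-- A function on `ℕ^d` is recovered from its Mahler coefficients. -/
theorem sum_choose_smul_mahler {M : Type} [AddCommGroup M] (F : (Fin d → ℤ_[p]) → M)
    (m : Fin d → ℕ) :
    ∑ n ∈ Finset.Icc 0 m, (∏ i, ((m i).choose (n i) : ℤ)) • mahler F n =
      F fun i => (m i : ℤ_[p]) := by
  have h1 : ∑ n ∈ Finset.Icc 0 m, (∏ i, ((m i).choose (n i) : ℤ)) • mahler F n =
      ∑ n ∈ Finset.Icc 0 m, ∑ k ∈ Finset.Icc 0 m, (∏ i, ((m i).choose (n i) : ℤ) *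
        ((-1 : ℤ) ^ (n i - k i) * ((n i).choose (k i) : ℤ))) • F fun i => (k i : ℤ_[p]) := by
    refine Finset.sum_congr rfl fun n hn => ?_
    rw [mahler_eq_sum_of_le F (Finset.mem_Icc.1 hn).2, Finset.smul_sum]
    refine Finset.sum_congr rfl fun k _ => ?_
    rw [smul_smul, ← Finset.prod_mul_distrib]
  rw [h1, Finset.sum_comm]
  have h2 : ∀ k : Fin d → ℕ, ∑ n ∈ Finset.Icc 0 m, (∏ i, ((m i).choose (n i) : ℤ) *
        ((-1 : ℤ) ^ (n i - k i) * ((n i).choose (k i) : ℤ))) • F (fun i => (k i : ℤ_[p])) =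
      (if k = m then (1 : ℤ) else 0) • F fun i => (k i : ℤ_[p]) := by
    intro k
    rw [← Finset.sum_smul, Icc_zero_eq_piFinset]
    congr 1
    have := Finset.prod_univ_sum (fun i => Finset.Icc 0 (m i)) (fun i j =>
      ((m i).choose j : ℤ) * ((-1 : ℤ) ^ (j - k i) * (j.choose (k i) : ℤ)))
    rw [← this]
    simp only [sum_choose_mul_alternating]
    split_ifs with h
    · subst h; simp
    · obtain ⟨i, hi⟩ := Function.ne_iff.1 h
      exact Finset.prod_eq_zero (Finset.mem_univ i) (if_neg hi)
  simp only [h2]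
  rw [Finset.sum_eq_single m]
  · simp
  · intro k _ hk; simp [hk]
  · intro h; simp at h

/-- A multivariate difference of a product of functions of separate variables is the product of the
one-variable differences, and the `i`-th one is divisible by `n_i!`. -/
theorem mahler_monomial {M : Type} [AddCommGroup M] [Module ℤ_[p] M] (k : Fin d → ℕ) (w : M)
    (n : Fin d → ℕ) : ∃ c : ℤ_[p],
      mahler (fun t : Fin d → ℤ_[p] => (∏ i, t i ^ k i) • w) n =
        ((∏ i, ((n i).factorial : ℤ_[p])) * c) • w := by
  choose c hc using fun i => factorial_dvd_alternating_sum (n i) (k i)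
  refine ⟨∏ i, (c i : ℤ_[p]), ?_⟩
  have h1 : mahler (fun t : Fin d → ℤ_[p] => (∏ i, t i ^ k i) • w) n =
      (∑ j ∈ Fintype.piFinset fun i => Finset.Icc 0 (n i), ∏ i,
        (-1 : ℤ) ^ (n i - j i) * ((n i).choose (j i) : ℤ) * (j i : ℤ) ^ k i) • w := by
    rw [mahler, Icc_zero_eq_piFinset, Finset.sum_smul]
    refine Finset.sum_congr rfl fun j _ => ?_
    rw [Finset.prod_mul_distrib
      (f := fun i => (-1 : ℤ) ^ (n i - j i) * ((n i).choose (j i) : ℤ)), mul_smul]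
    congr 1
    rw [← Int.cast_smul_eq_zsmul ℤ_[p] (∏ i, (j i : ℤ) ^ k i) w]
    push_cast
    rfl
  have h2 := Finset.prod_univ_sum (fun i => Finset.Icc 0 (n i)) (fun i j =>
      (-1 : ℤ) ^ (n i - j) * ((n i).choose j : ℤ) * (j : ℤ) ^ k i)
  rw [h1, ← h2, ← Finset.prod_mul_distrib, ← Int.cast_smul_eq_zsmul ℤ_[p]]
  congr 1
  push_cast
  refine Finset.prod_congr rfl fun i _ => ?_
  have := congrArg (Int.cast : ℤ → ℤ_[p]) (hc i)
  push_cast at this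
  exact this

/-! ### Convergent series in complete ultrametric `ℤ_p`-modules. -/

theorem tendsto_cofinite_of_norm_le {ι M : Type} [SeminormedAddCommGroup M] {f : ι → M}
    {b : ι → ℝ} (hb : Filter.Tendsto b Filter.cofinite (nhds 0)) (h : ∀ i, ‖f i‖ ≤ b i) :
    Filter.Tendsto f Filter.cofinite (nhds 0) :=
  squeeze_zero_norm h hb

theorem norm_smul_le_norm {M : Type} [NormedAddCommGroup M] [Module ℤ_[p] M]
    [IsBoundedSMul ℤ_[p] M] (t : ℤ_[p]) (x : M) : ‖t • x‖ ≤ ‖x‖ :=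
  (_root_.norm_smul_le t x).trans (mul_le_of_le_one_left (norm_nonneg _) t.norm_le_one)

variable {M : Type} [NormedAddCommGroup M] [IsUltrametricDist M]

theorem norm_hasSum_le {ι : Type} {f : ι → M} {a : M} (h : HasSum f a) {B : ℝ} (hB : 0 ≤ B)
    (hf : ∀ i, ‖f i‖ ≤ B) : ‖a‖ ≤ B := by
  refine le_of_tendsto h.norm (Filter.Eventually.of_forall fun s => ?_)
  exact IsUltrametricDist.norm_sum_le_of_forall_le_of_nonneg hB fun i _ => hf i

/-- Over a compact space, uniform smallness of the terms is smallness in the complete ultrametric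
group `C(X, M)`, where null families are summable. This gives continuity of Mahler series and of
power series alike. -/
theorem exists_continuous_hasSum [CompleteSpace M] {ι X : Type} [TopologicalSpace X]
    [CompactSpace X]
    (f : ι → C(X, M)) {b : ι → ℝ} (hb : Filter.Tendsto b Filter.cofinite (nhds 0))
    (h : ∀ i x, ‖f i x‖ ≤ b i) : ∃ G : C(X, M), ∀ x, HasSum (fun i => f i x) (G x) := by
  have hs : Summable f := by
    refine NonarchimedeanAddGroup.summable_of_tendsto_cofinite_zero ?_
    refine tendsto_cofinite_of_norm_le (b := fun i => |b i|) (by simpa using hb.abs) fun i => ?_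
    exact (ContinuousMap.norm_le _ (abs_nonneg _)).2 fun x => (h i x).trans (le_abs_self _)
  exact ⟨∑' i, f i, fun x => ContinuousMap.hasSum_apply hs.hasSum x⟩

variable [Module ℤ_[p] M] [IsBoundedSMul ℤ_[p] M]

/-- The Mahler expansion of a continuous function whose Mahler coefficients tend to `0`. -/
theorem hasSum_mahler_of_tendsto [CompleteSpace M] {F : (Fin d → ℤ_[p]) → M} (hF : Continuous F)
    (ha : Filter.Tendsto (mahler F) Filter.cofinite (nhds 0)) (t : Fin d → ℤ_[p]) :
    HasSum (fun n : Fin d → ℕ => (∏ i, Ring.choose (t i) (n i)) • mahler F n) (F t) := by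
  let f : (Fin d → ℕ) → C(Fin d → ℤ_[p], M) := fun n =>
    ⟨fun t => (∏ i, Ring.choose (t i) (n i)) • mahler F n, by
      refine Continuous.smul (continuous_finsetProd _ fun i _ => ?_) continuous_const
      exact (PadicInt.continuous_choose (n i)).comp (continuous_apply i)⟩
  obtain ⟨G, hG⟩ := exists_continuous_hasSum f (b := fun n => ‖mahler F n‖)
    (by simpa using ha.norm) fun n x => norm_smul_le_norm _ _
  -- The sum of the Mahler series is continuous, so it need only be compared with `F` on the dense
  -- subset `ℕ^d`. There the series is finite and binomial inversion applies.
  have hd : DenseRange (fun (m : Fin d → ℕ) (i : Fin d) => (m i : ℤ_[p])) := by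
    exact DenseRange.piMap fun _ => PadicInt.denseRange_natCast
  have : F = G := by
    refine hd.equalizer hF G.continuous (funext fun m => ?_)
    refine HasSum.unique ?_ (hG _)
    change HasSum _ (F fun i => (m i : ℤ_[p]))
    rw [← sum_choose_smul_mahler F m]
    have h1 : ∀ n, f n (fun i => (m i : ℤ_[p])) = (∏ i, ((m i).choose (n i) : ℤ)) • mahler F n := by
      intro n
      change (∏ i, Ring.choose ((m i : ℕ) : ℤ_[p]) (n i)) • mahler F n = _
      rw [← Int.cast_smul_eq_zsmul ℤ_[p]]
      push_cast
      simp only [Ring.choose_natCast]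
    simp only [h1]
    refine hasSum_sum_of_ne_finset_zero fun n hn => ?_
    obtain ⟨i, hi⟩ : ∃ i, m i < n i := by
      by_contra! h
      exact hn (Finset.mem_Icc.2 ⟨zero_le, h⟩)
    rw [Finset.prod_eq_zero (Finset.mem_univ i), zero_smul]
    rw [Nat.choose_eq_zero_of_lt hi]; simp
  rw [congrFun this t]
  exact hG t

/-- A convergent power series is continuous, and its Mahler coefficients are bounded by `∏ n_i!`. -/
theorem continuous_and_norm_mahler_le [CompleteSpace M] {F : (Fin d → ℤ_[p]) → M}
    {w : (Fin d → ℕ) → M} (hw : Filter.Tendsto w Filter.cofinite (nhds 0))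
    (hF : ∀ t : Fin d → ℤ_[p], HasSum (fun k : Fin d → ℕ => (∏ i, t i ^ k i) • w k) (F t)) :
    Continuous F ∧ ∃ B : ℝ, 0 ≤ B ∧
      ∀ n, ‖mahler F n‖ ≤ ‖∏ i, ((n i).factorial : ℤ_[p])‖ * B := by
  constructor
  · let f : (Fin d → ℕ) → C(Fin d → ℤ_[p], M) := fun k =>
      ⟨fun t => (∏ i, t i ^ k i) • w k, by fun_prop⟩
    obtain ⟨G, hG⟩ := exists_continuous_hasSum f (b := fun n => ‖w n‖)
      (by simpa using hw.norm) fun n x => norm_smul_le_norm _ _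
    have : F = G := funext fun t => (hF t).unique (hG t)
    rw [this]
    exact G.continuous
  · obtain ⟨B, hB0, hB⟩ : ∃ B : ℝ, 0 ≤ B ∧ ∀ k, ‖w k‖ ≤ B := by
      have h1 : ∀ᶠ k in Filter.cofinite, ‖w k‖ < 1 := by
        have := hw.norm
        rw [norm_zero] at this
        exact this.eventually_lt_const one_pos
      have hfin : {k | ¬ ‖w k‖ < 1}.Finite := h1
      obtain ⟨B, hB⟩ := (hfin.image fun k => ‖w k‖).bddAbove
      refine ⟨max B 1, by positivity, fun k => ?_⟩
      by_cases hk : ‖w k‖ < 1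
      · exact hk.le.trans (le_max_right _ _)
      · exact (hB ⟨k, hk, rfl⟩).trans (le_max_left _ _)
    refine ⟨B, hB0, fun n => ?_⟩
    -- A Mahler coefficient is a finite integral combination of values, so it can be computed term
    -- by term in the power series.
    have h1 : HasSum (fun k => mahler (fun t : Fin d → ℤ_[p] => (∏ i, t i ^ k i) • w k) n)
        (mahler F n) := by
      refine hasSum_sum fun j _ => ?_
      exact (hF _).const_smul _
    refine norm_hasSum_le h1 (by positivity) fun k => ?_
    obtain ⟨c, hc⟩ := mahler_monomial (p := p) k (w k) n
    rw [hc]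
    refine (_root_.norm_smul_le _ _).trans ?_
    rw [norm_mul]
    gcongr
    · exact mul_le_of_le_one_right (norm_nonneg _) c.norm_le_one
    · exact hB k

/-- A function with linearly growing Mahler coefficients is given by a power series on
`p^h ℤ_p^d` for `h` large. -/
theorem exists_power_series_of_mahler [CompleteSpace M] (S : AddSubgroup M)
    (hSc : IsClosed (S : Set M)) (hSs : ∀ (t : ℤ_[p]), ∀ x ∈ S, t • x ∈ S)
    (hdiv : ∀ x ∈ S, ∃ y ∈ S, (p : ℤ_[p]) • y = x ∧ ‖y‖ ≤ p * ‖x‖)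
    {F : (Fin d → ℤ_[p]) → M} (hF : Continuous F) (hFS : ∀ t, F t ∈ S)
    {c B : ℝ} (hc : 0 < c)
    (ha : ∀ n : Fin d → ℕ, ‖mahler F n‖ ≤ (p : ℝ) ^ (B - c * (Finset.univ.sup n : ℕ))) :
    ∃ (h : ℕ) (w : (Fin d → ℕ) → M), (∀ k, w k ∈ S) ∧
      Filter.Tendsto w Filter.cofinite (nhds 0) ∧
      ∀ t : Fin d → ℤ_[p], HasSum (fun k : Fin d → ℕ => (∏ i, t i ^ k i) • w k)
        (F fun i => (p : ℤ_[p]) ^ h * t i) := by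
  have hp1 : (1 : ℝ) < p := by exact_mod_cast (Fact.out : p.Prime).one_lt
  have hp0 : (0 : ℝ) < p := by linarith
  -- The `n`-th term needs `∑ ⌊n_i/p^h⌋ ≤ d|n|/p^h` divisions by `p`. This choice of `h` makes their
  -- cost at most half of the available decay `c|n|`.
  obtain ⟨h, hh⟩ : ∃ h : ℕ, (d : ℝ) / (p : ℝ) ^ h ≤ c / 2 := by
    obtain ⟨h, hh⟩ := pow_unbounded_of_one_lt (2 * d / c) hp1
    refine ⟨h, ?_⟩
    rw [div_le_iff₀ (by positivity)]
    rw [div_lt_iff₀ hc] at hh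
    nlinarith
  have hmS : ∀ n, mahler F n ∈ S := fun n => S.sum_mem fun k _ => S.zsmul_mem (hFS _) _
  have hdivN : ∀ (N : ℕ), ∀ x ∈ S, ∃ y ∈ S, (p : ℤ_[p]) ^ N • y = x ∧ ‖y‖ ≤ (p : ℝ) ^ N * ‖x‖ := by
    intro N
    induction N with
    | zero => intro x hx; exact ⟨x, hx, by simp⟩
    | succ N ih =>
      intro x hx
      obtain ⟨y, hy, e1, e2⟩ := ih x hx
      obtain ⟨z, hz, e3, e4⟩ := hdiv y hy
      refine ⟨z, hz, by rw [pow_succ, mul_smul, e3, e1], e4.trans ?_⟩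
      rw [pow_succ']
      rw [mul_assoc]
      gcongr
  let N : (Fin d → ℕ) → ℕ := fun n => ∑ i, n i / p ^ h
  -- `b n` is `p^{-N(n)} a_n`, taken inside `S`; its norm still decays with slope `c/2`.
  choose b hbS hb hbn using fun n => hdivN (N n) (mahler F n) (hmS n)
  choose Q hQd hQ using exists_polynomial_choose p h
  have hlim : Filter.Tendsto (fun n : Fin d → ℕ => (p : ℝ) ^ (B - c / 2 * (Finset.univ.sup n : ℕ)))
      Filter.cofinite (nhds 0) := by
    have h1 : Filter.Tendsto (fun n : Fin d → ℕ => Finset.univ.sup n) Filter.cofinite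
        Filter.atTop := by
      rw [Filter.tendsto_atTop]
      intro K
      have : (Set.Iic (fun _ : Fin d => K)).Finite := Set.finite_Iic _
      filter_upwards [this.compl_mem_cofinite] with n hn
      by_contra! hlt
      exact hn fun i => (Finset.le_sup (f := n) (Finset.mem_univ i)).trans hlt.le
    have h2 : Filter.Tendsto (fun k : ℕ => (p : ℝ) ^ (B - c / 2 * (k : ℕ))) Filter.atTop (nhds 0) := by
      have h3 : Filter.Tendsto (fun k : ℕ => (p : ℝ) ^ B * ((p : ℝ) ^ (-(c / 2))) ^ k)
          Filter.atTop (nhds ((p : ℝ) ^ B * 0)) := by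
        refine (tendsto_pow_atTop_nhds_zero_of_lt_one (by positivity) ?_).const_mul _
        exact Real.rpow_lt_one_of_one_lt_of_neg hp1 (by linarith)
      rw [mul_zero] at h3
      refine h3.congr fun k => ?_
      rw [← Real.rpow_natCast, ← Real.rpow_mul hp0.le, ← Real.rpow_add hp0]
      congr 1; ring
    exact h2.comp h1
  have hbb : ∀ n, ‖b n‖ ≤ (p : ℝ) ^ (B - c / 2 * (Finset.univ.sup n : ℕ)) := by
    intro n
    refine (hbn n).trans ?_
    refine (mul_le_mul_of_nonneg_left (ha n) (by positivity)).trans ?_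
    rw [← Real.rpow_natCast, ← Real.rpow_add hp0]
    apply Real.rpow_le_rpow_of_exponent_le hp1.le
    have h1 : (N n : ℝ) ≤ d / (p : ℝ) ^ h * (Finset.univ.sup n : ℕ) := by
      have : ∀ i ∈ Finset.univ, ((n i / p ^ h : ℕ) : ℝ) ≤ (Finset.univ.sup n : ℕ) / (p : ℝ) ^ h := by
        intro i _
        refine Nat.cast_div_le.trans ?_
        push_cast
        gcongr
        exact Finset.le_sup (f := n) (Finset.mem_univ i)
      change ((∑ i, n i / p ^ h : ℕ) : ℝ) ≤ _
      rw [Nat.cast_sum]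
      refine (Finset.sum_le_sum this).trans ?_
      rw [Finset.sum_const, Finset.card_univ, Fintype.card_fin, nsmul_eq_mul]
      exact le_of_eq (by ring)
    have h2 : d / (p : ℝ) ^ h * (Finset.univ.sup n : ℕ) ≤ c / 2 * (Finset.univ.sup n : ℕ) := by
      gcongr
    linarith
  have hb0 : Filter.Tendsto b Filter.cofinite (nhds 0) := tendsto_cofinite_of_norm_le hlim hbb
  have ha0 : Filter.Tendsto (mahler F) Filter.cofinite (nhds 0) := by
    refine tendsto_cofinite_of_norm_le hlim fun n => (ha n).trans ?_
    apply Real.rpow_le_rpow_of_exponent_le hp1.le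
    have : (0 : ℝ) ≤ (Finset.univ.sup n : ℕ) := by positivity
    nlinarith
  -- `g k n` is the coefficient of `t^k` in the `n`-th Mahler term on `p^h ℤ_p^d`, so the power
  -- series must have coefficients `∑ₙ g k n`.
  let g : (Fin d → ℕ) → (Fin d → ℕ) → M := fun k n => (∏ i, (Q (n i)).coeff (k i)) • b n
  have hgz : ∀ k n, ¬ k ≤ n → g k n = 0 := by
    intro k n hkn
    obtain ⟨i, hi⟩ : ∃ i, n i < k i := by
      by_contra! h
      exact hkn h
    change (∏ i, (Q (n i)).coeff (k i)) • b n = 0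
    rw [Finset.prod_eq_zero (Finset.mem_univ i), zero_smul]
    exact Polynomial.coeff_eq_zero_of_natDegree_lt ((hQd _).trans_lt hi)
  have hgn : ∀ k n, ‖g k n‖ ≤ ‖b n‖ := fun k n => norm_smul_le_norm _ _
  -- Decay in the pair `(k, n)` is what permits summation in either order. Only finitely many `n`
  -- have `b n` large, and each of them involves only the finitely many `k ≤ n`.
  have hg0 : Filter.Tendsto (fun q : (Fin d → ℕ) × (Fin d → ℕ) => g q.1 q.2) Filter.cofinite
      (nhds 0) := by
    rw [Metric.tendsto_nhds]
    intro ε hε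
    have h1 : {n | ¬ ‖b n‖ < ε}.Finite := by
      have := hb0.norm
      rw [norm_zero] at this
      exact this.eventually_lt_const hε
    have h2 : (⋃ n ∈ {n | ¬ ‖b n‖ < ε}, (Set.Iic n) ×ˢ {n}).Finite :=
      h1.biUnion fun n _ => (Set.finite_Iic n).prod (Set.finite_singleton n)
    filter_upwards [h2.compl_mem_cofinite] with q hq
    rw [dist_zero_right]
    by_contra hlt
    apply hq
    have h3 : ¬ ‖b q.2‖ < ε := fun h4 => hlt ((hgn _ _).trans_lt h4)
    refine Set.mem_biUnion h3 ⟨?_, rfl⟩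
    by_contra h5
    rw [hgz _ _ h5, norm_zero] at hlt
    exact hlt hε
  have hgs : ∀ k, Summable (g k) := fun k =>
    NonarchimedeanAddGroup.summable_of_tendsto_cofinite_zero
      (tendsto_cofinite_of_norm_le (b := fun n => ‖b n‖) (by simpa using hb0.norm) (hgn k))
  refine ⟨h, fun k => ∑' n, g k n, ?_, ?_, ?_⟩
  · intro k
    refine hSc.mem_of_tendsto (hgs k).hasSum (Filter.Eventually.of_forall fun s => ?_)
    exact S.sum_mem fun n _ => hSs _ _ (hbS n)
  · rw [Metric.tendsto_nhds]
    intro ε hε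
    -- If `k` is not the first component of one of the finitely many pairs with large `g`, every
    -- term of `∑ₙ g k n` is small. The bound `ε/2` restores a strict inequality after the sum.
    have h1 : ((Prod.fst : (Fin d → ℕ) × (Fin d → ℕ) → _) ''
        {q : (Fin d → ℕ) × (Fin d → ℕ) | ¬ ‖g q.1 q.2‖ < ε / 2}).Finite := by
      refine Set.Finite.image _ ?_
      have := hg0.norm
      rw [norm_zero] at this
      exact this.eventually_lt_const (half_pos hε)
    filter_upwards [h1.compl_mem_cofinite] with k hk
    rw [dist_zero_right]
    refine (norm_hasSum_le (hgs k).hasSum (half_pos hε).le fun n => ?_).trans_lt (half_lt_self hε)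
    by_contra! hlt
    exact hk ⟨(k, n), not_lt.2 hlt.le, rfl⟩
  · intro t
    have h1 := hasSum_mahler_of_tendsto hF ha0 fun i => (p : ℤ_[p]) ^ h * t i
    have h2 : Summable (fun q : (Fin d → ℕ) × (Fin d → ℕ) => (∏ i, t i ^ q.1 i) • g q.1 q.2) := by
      refine NonarchimedeanAddGroup.summable_of_tendsto_cofinite_zero ?_
      exact tendsto_cofinite_of_norm_le (b := fun q => ‖g q.1 q.2‖) (by simpa using hg0.norm)
        fun q => norm_smul_le_norm _ _
    have h3 : HasSum (fun k => (∏ i, t i ^ k i) • ∑' n, g k n)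
        (∑' q : (Fin d → ℕ) × (Fin d → ℕ), (∏ i, t i ^ q.1 i) • g q.1 q.2) :=
      h2.hasSum.prod_fiberwise fun k => (hgs k).hasSum.const_smul _
    -- Summing over `k` with `n` fixed recovers the Mahler term: `N(n)` is precisely the sum of the
    -- exponents that make the one-variable binomials integral polynomials.
    have h4 : ∀ n, HasSum (fun k => (∏ i, t i ^ k i) • g k n)
        ((∏ i, Ring.choose ((p : ℤ_[p]) ^ h * t i) (n i)) • mahler F n) := by
      intro n
      have e : (∏ i, Ring.choose ((p : ℤ_[p]) ^ h * t i) (n i)) • mahler F n =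
          ∑ k ∈ Finset.Icc 0 n, (∏ i, t i ^ k i) • g k n := by
        have e1 : (∏ i, Ring.choose ((p : ℤ_[p]) ^ h * t i) (n i)) • mahler F n =
            (∏ i, (Q (n i)).eval (t i)) • b n := by
          rw [← hb n, smul_smul, ← Finset.prod_pow_eq_pow_sum, ← Finset.prod_mul_distrib]
          congr 1
          refine Finset.prod_congr rfl fun i _ => ?_
          rw [hQ, mul_comm]
        have e2 : ∀ i, (Q (n i)).eval (t i) =
            ∑ j ∈ Finset.Icc 0 (n i), t i ^ j * (Q (n i)).coeff j := by
          intro i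
          rw [Polynomial.eval_eq_sum_range' (Nat.lt_succ_of_le (hQd (n i)))]
          refine Finset.sum_congr (by ext; simp) fun j _ => mul_comm _ _
        have e3 := Finset.prod_univ_sum (fun i => Finset.Icc 0 (n i)) (fun i j =>
          t i ^ j * (Q (n i)).coeff j)
        rw [e1]
        simp only [e2]
        rw [e3, Finset.sum_smul]
        refine Finset.sum_congr rfl fun k _ => ?_
        rw [Finset.prod_mul_distrib, mul_smul]
      rw [e]
      refine hasSum_sum_of_ne_finset_zero fun k hk => ?_
      rw [hgz k n fun hkn => hk (Finset.mem_Icc.2 ⟨zero_le, hkn⟩), smul_zero]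
    have h5 := ((Equiv.prodComm _ _).hasSum_iff.2 h2.hasSum).prod_fiberwise h4
    rw [h1.unique h5]
    exact h3

end Expansions

/-! ### The Banach `ℤ_p`-modules `B̃^{[r,s]}` -/

section BanachModules

variable {p : ℕ} [Fact p.Prime] {K : IntermediateField ℚ_[p] (PadicAlgCl p)}
  [FiniteDimensional ℚ_[p] K] (π : Uniformizer K)

/-- The exponent `e` is the largest one with `π^e ∣ p`. It exists because `p` divides some `π^n`,
which excludes `π^(n+1) ∣ p`. By maximality the cofactor lies outside the maximal ideal, and
comparing norms gives `e v_p(π) = 1`. -/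
theorem Uniformizer.exists_p_eq : ∃ (e : ℕ) (u : OK K), IsUnit u ∧ (p : OK K) = π.elt ^ e * u ∧
    (e : ℝ) * vPi π = 1 := by
  have hp1 : (1 : ℝ) < p := by exact_mod_cast (Fact.out : p.Prime).one_lt
  have hp0 : (p : OK K) ≠ 0 := by
    intro h
    have := norm_p (p := p) K
    rw [h, ZeroMemClass.coe_zero, norm_zero] at this
    have h2 : (0 : ℝ) < (p : ℝ)⁻¹ := by positivity
    exact h2.ne this
  have hfin : ∃ n, ¬ π.elt ^ n ∣ (p : OK K) := by
    obtain ⟨n, hn⟩ := π.exists_p_dvd_pow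
    refine ⟨n + 1, fun h => ?_⟩
    have h1 : π.elt ^ n * π.elt ∣ π.elt ^ n * 1 := by
      rw [mul_one, ← pow_succ]; exact h.trans hn
    have h2 := (mul_dvd_mul_iff_left (pow_ne_zero n π.ne_zero)).1 h1
    rw [OK_dvd_iff] at h2
    rw [OneMemClass.coe_one, norm_one] at h2
    exact absurd h2 (not_le.2 π.norm_lt_one)
  classical
  obtain ⟨e, he⟩ : ∃ e, Nat.find hfin = e + 1 := by
    refine Nat.exists_eq_succ_of_ne_zero fun h0 => ?_
    have := Nat.find_spec hfin
    rw [h0, pow_zero] at this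
    exact this (one_dvd _)
  obtain ⟨u, hu⟩ : π.elt ^ e ∣ (p : OK K) := not_not.1 (Nat.find_min hfin (m := e) (by omega))
  have hunit : IsUnit u := by
    by_contra hnu
    have h1 : u ∈ IsLocalRing.maximalIdeal (OK K) := (IsLocalRing.mem_maximalIdeal u).2 hnu
    rw [π.span_eq] at h1
    obtain ⟨v, rfl⟩ := Ideal.mem_span_singleton.1 h1
    apply Nat.find_spec hfin
    rw [he]
    exact ⟨v, by rw [hu, pow_succ, mul_assoc]⟩
  refine ⟨e, u, hunit, hu, ?_⟩
  have hun : ‖(u : K)‖ = 1 := by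
    have h1 : ¬ ‖(u : K)‖ < 1 := by
      rw [← norm_lt_one_iff, IsLocalRing.mem_maximalIdeal, mem_nonunits_iff]
      exact not_not.2 hunit
    exact le_antisymm (mem_OK.1 u.2) (not_lt.1 h1)
  have hn := norm_p (p := p) K
  rw [hu] at hn
  simp only [MulMemClass.coe_mul, SubmonoidClass.coe_pow, norm_mul, norm_pow, hun, mul_one] at hn
  rw [vPi, mul_neg, ← Real.logb_pow, hn, Real.logb_inv, neg_neg, Real.logb_self_eq_one hp1]

theorem piA_pow_mul_ofInt (n : ℕ) (u : OK K) : piA π ^ n * RamWitt.ofInt (iota K) u =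
    RamWitt.ofInt (iota K) (π.elt ^ n * u) := by
  rw [piA, map_mul, map_pow]

theorem bnd_add_one (c r : ℝ) (j : ℤ) : bnd π c r (j + 1) = bnd π (c - vPi π) r j := by
  apply NNReal.eq
  change (p : ℝ) ^ (-((c - ((j + 1 : ℤ) : ℝ) * vPi π) * (p * r / (p - 1)))) =
    (p : ℝ) ^ (-((c - vPi π - j * vPi π) * (p * r / (p - 1))))
  push_cast
  congr 1; ring

/-- Multiplication by `π` shifts the expansion by one place, so it raises `V` by exactly `v_p(π)`.
The equivalence, rather than an inequality, is what controls division by `p`. -/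
theorem le_V_pi_mul_iff {c r : ℝ} (hr : 0 < r) (x : Bt π) :
    (c : EReal) ≤ V π (toBt π (piA π) * x) r ↔ ((c - vPi π : ℝ) : EReal) ≤ V π x r := by
  obtain ⟨n, y, h⟩ := exists_rep π x
  have h' : toBt π (piA π ^ n) * (toBt π (piA π) * x) = toBt π (piA π * y) := by
    rw [map_mul, ← h]; ring
  rw [le_V_iff π hr h, le_V_iff π hr h']
  have h1 : ∀ k, coeffA π (piA π * y) (k + 1) = coeffA π y k := fun k => by
    have := RamWitt.coeff_pi_pow_mul π.good 1 y k
    rwa [pow_one] at this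
  have h0 : coeffA π (piA π * y) 0 = 0 := by
    have := RamWitt.coeff_pi_pow_mul_of_lt π.good 1 y 0 one_pos
    rwa [pow_one] at this
  have hb : ∀ k : ℕ, bnd π c r (((k + 1 : ℕ) : ℤ) - n) = bnd π (c - vPi π) r (k - n) := fun k => by
    rw [← bnd_add_one]; congr 1; push_cast; ring
  constructor
  · intro H k
    have := H (k + 1)
    rwa [h1, hb] at this
  · intro H k
    cases k with
    | zero => rw [h0, map_zero]; exact zero_le
    | succ k => rw [h1, hb]; exact H k

theorem le_V_pi_pow_mul_iff {c r : ℝ} (hr : 0 < r) (n : ℕ) (x : Bt π) :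
    (c : EReal) ≤ V π (toBt π (piA π ^ n) * x) r ↔ ((c - n * vPi π : ℝ) : EReal) ≤ V π x r := by
  induction n generalizing c with
  | zero => simp
  | succ n ih =>
    rw [pow_succ', map_mul, mul_assoc, le_V_pi_mul_iff π hr, ih]
    congr! 2
    push_cast; ring

theorem le_V_ofInt_mul {c r : ℝ} (hr : 0 < r) {x : Bt π} (hx : (c : EReal) ≤ V π x r) (a : OK K) :
    (c : EReal) ≤ V π (toBt π (RamWitt.ofInt (iota K) a) * x) r := by
  have := V_mul π hr hx (RamWitt.ofInt (iotaInt K) a)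
  rwa [intToAt, RamWitt.map_ofInt] at this

/-- Up to a unit, `p` is `π^e` with `e v_p(π) = 1`. Neither the unit nor its inverse lowers `V`, so
the unit preserves it. -/
theorem le_V_p_mul_iff {c r : ℝ} (hr : 0 < r) (x : Bt π) :
    (c : EReal) ≤ V π ((p : Bt π) * x) r ↔ ((c - 1 : ℝ) : EReal) ≤ V π x r := by
  obtain ⟨e, u, hu, hp, he⟩ := π.exists_p_eq
  have h1 : (p : Bt π) * x =
      toBt π (piA π ^ e) * (toBt π (RamWitt.ofInt (iota K) u) * x) := by
    rw [← mul_assoc, ← map_mul, piA_pow_mul_ofInt, ← hp, map_natCast, map_natCast]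
  rw [h1, le_V_pi_pow_mul_iff π hr, he]
  refine ⟨fun h => ?_, fun h => le_V_ofInt_mul π hr h u⟩
  obtain ⟨v, hv⟩ := hu.exists_left_inv
  have := le_V_ofInt_mul π hr h v
  rwa [← mul_assoc, ← map_mul, ← map_mul, hv, map_one, map_one, one_mul] at this

theorem le_VI_add {I : PosInterval} {c : ℝ} {x y : Bt π} (hx : (c : EReal) ≤ VI π I x)
    (hy : (c : EReal) ≤ VI π I y) : (c : EReal) ≤ VI π I (x + y) := by
  rw [le_VI_iff] at *
  exact fun t ht => V_add π (I.pos.trans_le ht.1) (hx t ht) (hy t ht)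

theorem le_VI_neg {I : PosInterval} {c : ℝ} {x : Bt π} (hx : (c : EReal) ≤ VI π I x) :
    (c : EReal) ≤ VI π I (-x) := by
  rw [le_VI_iff] at *
  exact fun t ht => V_neg π (I.pos.trans_le ht.1) (hx t ht)

theorem le_VI_sub {I : PosInterval} {c : ℝ} {x y : Bt π} (hx : (c : EReal) ≤ VI π I x)
    (hy : (c : EReal) ≤ VI π I y) : (c : EReal) ≤ VI π I (x - y) := by
  rw [sub_eq_add_neg]
  exact le_VI_add π hx (le_VI_neg π hy)

theorem VI_gal (I : PosInterval) (σ : Gal(PadicAlgCl p/K)) (x : Bt π) :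
    VI π I (galB π σ x) = VI π I x := by simp only [VI, V_gal]

theorem norm_BPre_le_iff {I : PosInterval} (x : BPre π I) (c : ℝ) :
    ‖x‖ ≤ (p : ℝ) ^ (-c) ↔ (c : EReal) ≤ VI π I x.1 := normI_le_iff π I x.2 c

/-- The norms are accessible only through the thresholds `p^{-c}`. These run over all positive
reals, so they determine inequalities between norms, including the case `a = 0`. -/
theorem le_of_forall_rpow {a b : ℝ} (ha : 0 ≤ a)
    (h : ∀ c : ℝ, a ≤ (p : ℝ) ^ (-c) → b ≤ (p : ℝ) ^ (-c)) : b ≤ a := by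
  have hp1 : (1 : ℝ) < p := by exact_mod_cast (Fact.out : p.Prime).one_lt
  refine le_of_forall_gt_imp_ge_of_dense fun M hM => ?_
  have e : (p : ℝ) ^ (-(-Real.logb p M)) = M := by
    rw [neg_neg, Real.rpow_logb (by linarith) hp1.ne' (ha.trans_lt hM)]
  rw [← e]
  apply h
  rw [e]
  exact hM.le

instance (I : PosInterval) : IsUltrametricDist (BPre π I) := by
  refine IsUltrametricDist.isUltrametricDist_of_forall_norm_add_le_max_norm fun x y => ?_
  refine le_of_forall_rpow (p := p) (by positivity) fun c hc => ?_
  rw [max_le_iff, norm_BPre_le_iff, norm_BPre_le_iff] at hc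
  rw [norm_BPre_le_iff]
  exact le_VI_add π hc.1 hc.2

instance (I : PosInterval) : IsUltrametricDist (BtI π I) := by
  refine IsUltrametricDist.isUltrametricDist_of_forall_norm_add_le_max_norm fun x y => ?_
  induction x, y using UniformSpace.Completion.induction_on₂ with
  | hp => exact isClosed_le (by fun_prop) (by fun_prop)
  | ih x y =>
    rw [← UniformSpace.Completion.coe_add, UniformSpace.Completion.norm_coe,
      UniformSpace.Completion.norm_coe, UniformSpace.Completion.norm_coe]
    exact IsUltrametricDist.norm_add_le_max x y

theorem coe_natCast_smul {I : PosInterval} (n : ℕ) (x : BPre π I) :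
    ((n : ℤ_[p]) • x).1 = (n : Bt π) * x.1 := by
  rw [coe_smul, map_natCast, map_natCast, map_natCast]

theorem norm_p_smul_BPre {I : PosInterval} (x : BPre π I) :
    ‖(p : ℤ_[p]) • x‖ = (p : ℝ)⁻¹ * ‖x‖ := by
  have hp1 : (1 : ℝ) < p := by exact_mod_cast (Fact.out : p.Prime).one_lt
  have hp0 : (0 : ℝ) < p := by linarith
  have h : ∀ c : ℝ, ‖(p : ℤ_[p]) • x‖ ≤ (p : ℝ) ^ (-c) ↔ (p : ℝ)⁻¹ * ‖x‖ ≤ (p : ℝ) ^ (-c) := by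
    intro c
    have e : (p : ℝ)⁻¹ * ‖x‖ ≤ (p : ℝ) ^ (-c) ↔ ‖x‖ ≤ (p : ℝ) ^ (-(c - 1)) := by
      rw [inv_mul_le_iff₀ hp0, neg_sub, sub_eq_add_neg, Real.rpow_add hp0, Real.rpow_one]
    rw [e, norm_BPre_le_iff, norm_BPre_le_iff, coe_natCast_smul, le_VI_iff, le_VI_iff]
    exact forall₂_congr fun t ht => le_V_p_mul_iff π (I.pos.trans_le ht.1) x.1
  exact le_antisymm (le_of_forall_rpow (p := p) (by positivity) fun c hc => (h c).2 hc)
    (le_of_forall_rpow (p := p) (norm_nonneg _) fun c hc => (h c).1 hc)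

theorem continuous_smul_BtI {I : PosInterval} (t : ℤ_[p]) :
    Continuous fun x : BtI π I => t • x := continuous_const_smul t

theorem norm_p_smul {I : PosInterval} (x : BtI π I) : ‖(p : ℤ_[p]) • x‖ = (p : ℝ)⁻¹ * ‖x‖ := by
  induction x using UniformSpace.Completion.induction_on with
  | hp => exact isClosed_eq (continuous_smul_BtI π _).norm (by fun_prop)
  | ih x =>
    rw [← UniformSpace.Completion.coe_smul, UniformSpace.Completion.norm_coe,
      UniformSpace.Completion.norm_coe, norm_p_smul_BPre]

theorem norm_smul_BtI_le {I : PosInterval} (t : ℤ_[p]) (x : BtI π I) : ‖t • x‖ ≤ ‖x‖ := by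
  induction x using UniformSpace.Completion.induction_on with
  | hp => exact isClosed_le (continuous_smul_BtI π _).norm (by fun_prop)
  | ih x =>
    rw [← UniformSpace.Completion.coe_smul, UniformSpace.Completion.norm_coe,
      UniformSpace.Completion.norm_coe]
    exact norm_smul_le π t x

/-- A nonzero scalar is a unit times `p^n`. The power of `p` scales the norm exactly by `p^{-n}`,
and the unit does not increase it. -/
instance (I : PosInterval) : IsBoundedSMul ℤ_[p] (BtI π I) := by
  refine IsBoundedSMul.of_norm_smul_le fun t x => ?_
  by_cases ht : t = 0
  · simp [ht]
  have h : ∀ (n : ℕ) (x : BtI π I), ‖(p : ℤ_[p]) ^ n • x‖ = ((p : ℝ)⁻¹) ^ n * ‖x‖ := by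
    intro n
    induction n with
    | zero => intro x; simp
    | succ n ih => intro x; rw [pow_succ, mul_smul, ih, norm_p_smul, pow_succ, mul_assoc]
  rw [PadicInt.unitCoeff_spec ht, mul_smul, norm_mul, PadicInt.norm_units, one_mul,
    PadicInt.norm_p_pow, zpow_neg, zpow_natCast, ← inv_pow, ← h]
  exact norm_smul_BtI_le π _ _

theorem exists_p_smul_BPre (I : PosInterval) :
    ∃ f : BPre π I →+ BPre π I, ∀ x, (p : ℤ_[p]) • f x = x := by
  obtain ⟨e, u, hu, hp, -⟩ := π.exists_p_eq
  obtain ⟨v, hv⟩ := hu.exists_left_inv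
  let w : Bt π := IsLocalization.Away.invSelf (piA π) ^ e * toBt π (RamWitt.ofInt (iota K) v)
  have hπ : toBt π (piA π ^ e) * IsLocalization.Away.invSelf (piA π) ^ e = 1 := by
    rw [map_pow, ← mul_pow, IsLocalization.Away.mul_invSelf, one_pow]
  have hw : w ∈ Bb π := by
    -- The inverse of `p` is `π^{-e} u^{-1}`; multiplication by `π^e` clears its denominator, so no
    -- Teichmüller denominator is needed.
    refine ⟨e, 1, RamWitt.ofInt (iotaPlus K) v, one_ne_zero, ?_⟩
    rw [plusToAt_ofInt, map_one, teichA, RamWitt.teich_one, mul_one, ← mul_assoc, hπ, one_mul]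
  have hpw : (p : Bt π) * w = 1 := by
    have h1 : (p : Bt π) = toBt π (piA π ^ e) * toBt π (RamWitt.ofInt (iota K) u) := by
      rw [← map_mul, piA_pow_mul_ofInt, ← hp, map_natCast, map_natCast]
    calc (p : Bt π) * w = (toBt π (piA π ^ e) * IsLocalization.Away.invSelf (piA π) ^ e) *
          toBt π (RamWitt.ofInt (iota K) (v * u)) := by
          rw [h1, map_mul (RamWitt.ofInt (iota K)), map_mul (toBt π)]; ring
      _ = 1 := by rw [hπ, hv, map_one, map_one, one_mul]
  refine ⟨{ toFun := fun x => ⟨w * x.1, (Bb π).mul_mem hw x.2⟩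
            map_zero' := Subtype.ext (mul_zero w)
            map_add' := fun x y => Subtype.ext (mul_add w x.1 y.1) }, fun x => Subtype.ext ?_⟩
  rw [coe_natCast_smul]
  change (p : Bt π) * (w * x.1) = x.1
  rw [← mul_assoc, hpw, one_mul]

/-- Division by `p` is Lipschitz with constant `p` before completion, hence extends, and the
identity `p · (x/p) = x` persists by density. -/
theorem exists_p_smul_eq {I : PosInterval} (x : BtI π I) :
    ∃ y : BtI π I, (p : ℤ_[p]) • y = x := by
  have hp1 : (1 : ℝ) < p := by exact_mod_cast (Fact.out : p.Prime).one_lt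
  obtain ⟨f, hf⟩ := exists_p_smul_BPre π I
  have hc : Continuous f := AddMonoidHomClass.continuous_of_bound f p fun x => by
    have := norm_p_smul_BPre π (f x)
    rw [hf, eq_inv_mul_iff_mul_eq₀ (by positivity)] at this
    exact this.ge
  refine ⟨f.completion hc x, ?_⟩
  induction x using UniformSpace.Completion.induction_on with
  | hp =>
    exact isClosed_eq ((continuous_smul_BtI π _).comp (AddMonoidHom.continuous_completion f hc))
      continuous_id
  | ih x => rw [AddMonoidHom.completion_coe, ← UniformSpace.Completion.coe_smul, hf]

/-! ### The Galois action on the completions. -/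

theorem galBtI_coe (I : PosInterval) (σ : Gal(PadicAlgCl p/K)) (x : BPre π I) :
    galBtI π I σ (x : BtI π I) = (galPre π I σ x : BtI π I) :=
  AddMonoidHom.completion_coe _ _ _

theorem continuous_galBtI (I : PosInterval) (σ : Gal(PadicAlgCl p/K)) :
    Continuous (galBtI π I σ) := AddMonoidHom.continuous_completion _ _

theorem norm_galBtI (I : PosInterval) (σ : Gal(PadicAlgCl p/K)) (x : BtI π I) :
    ‖galBtI π I σ x‖ = ‖x‖ := by
  induction x using UniformSpace.Completion.induction_on with
  | hp => exact isClosed_eq (continuous_galBtI π I σ).norm continuous_norm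
  | ih x => rw [galBtI_coe, UniformSpace.Completion.norm_coe, UniformSpace.Completion.norm_coe,
      norm_galPre]

theorem galBtI_smul (I : PosInterval) (σ : Gal(PadicAlgCl p/K)) (t : ℤ_[p]) (x : BtI π I) :
    galBtI π I σ (t • x) = t • galBtI π I σ x := by
  induction x using UniformSpace.Completion.induction_on with
  | hp =>
    exact isClosed_eq ((continuous_galBtI π I σ).comp (continuous_smul_BtI π t))
      ((continuous_smul_BtI π t).comp (continuous_galBtI π I σ))
  | ih x =>
    rw [galBtI_coe, ← UniformSpace.Completion.coe_smul, galBtI_coe,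
      ← UniformSpace.Completion.coe_smul]
    congr 1
    apply Subtype.ext
    change galB π σ (t • x).1 = (t • galPre π I σ x).1
    rw [coe_smul, coe_smul, map_mul, galB_toBt, galA, RamWitt.map_ofInt]
    rfl

/-! ### The closed `ℤ_p`-submodule of `H_K`-invariants. -/

variable (Kinf : IntermediateField K (PadicAlgCl p))

/-- `B̃_K^{[r,s]}` as a subgroup of `B̃^{[r,s]}`. -/
def fixedSubgroup (I : PosInterval) : AddSubgroup (BtI π I) where
  carrier := BtIFixed π Kinf I
  zero_mem' := fun σ _ => map_zero _
  add_mem' := fun hx hy σ hσ => by rw [map_add, hx σ hσ, hy σ hσ]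
  neg_mem' := fun hx σ hσ => by rw [map_neg, hx σ hσ]

theorem isClosed_fixedSubgroup (I : PosInterval) :
    IsClosed (fixedSubgroup π Kinf I : Set (BtI π I)) := by
  have : (fixedSubgroup π Kinf I : Set (BtI π I)) =
      ⋂ σ ∈ Kinf.fixingSubgroup, {y | galBtI π I σ y = y} := by
    ext y
    simp only [Set.mem_iInter, Set.mem_ofPred_eq]
    exact Iff.rfl
  rw [this]
  exact isClosed_biInter fun σ _ => isClosed_eq (continuous_galBtI π I σ) continuous_id

theorem smul_mem_fixedSubgroup (I : PosInterval) (t : ℤ_[p]) (x : BtI π I)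
    (hx : x ∈ fixedSubgroup π Kinf I) : t • x ∈ fixedSubgroup π Kinf I := fun σ hσ => by
  rw [galBtI_smul, hx σ hσ]

/-- Multiplication by `p` scales norms, hence is injective, and it commutes with Galois. A vector is
therefore invariant as soon as its multiple by `p` is. This is the divisibility that
`exists_power_series_of_mahler` asks of the submodule. -/
theorem exists_p_smul_eq_fixedSubgroup (I : PosInterval) (x : BtI π I)
    (hx : x ∈ fixedSubgroup π Kinf I) :
    ∃ y ∈ fixedSubgroup π Kinf I, (p : ℤ_[p]) • y = x ∧ ‖y‖ ≤ p * ‖x‖ := by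
  have hp1 : (1 : ℝ) < p := by exact_mod_cast (Fact.out : p.Prime).one_lt
  obtain ⟨y, rfl⟩ := exists_p_smul_eq π x
  have hinj : ∀ z : BtI π I, (p : ℤ_[p]) • z = 0 → z = 0 := by
    intro z hz
    have := norm_p_smul π z
    rw [hz, norm_zero] at this
    have h2 : (p : ℝ)⁻¹ ≠ 0 := by positivity
    exact norm_eq_zero.1 ((mul_eq_zero.1 this.symm).resolve_left h2)
  refine ⟨y, fun σ hσ => ?_, rfl, ?_⟩
  · rw [← sub_eq_zero]
    apply hinj
    rw [smul_sub, ← galBtI_smul, hx σ hσ, sub_self]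
  · rw [norm_p_smul, ← mul_assoc, mul_inv_cancel₀ (by positivity), one_mul]

end BanachModules

/-! ### `O ⊗ W(R)` is `π`-adically separated -/

section Separated

variable {p : ℕ} [Fact p.Prime] {O : Type} [CommRing O] [Fact (¬IsUnit (p : O))]
  [IsAdicComplete (Ideal.span {(p : O)}) O]
  {R : Type} [CommRing R]

theorem isPrecomplete_pi_span_singleton {A : Type} [CommRing A] (a : A)
    [IsPrecomplete (Ideal.span {a}) A] (n : ℕ) :
    IsPrecomplete (Ideal.span {a}) (Fin n → A) := by
  have hmem : ∀ (k : ℕ) (x : Fin n → A),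
      x ∈ (Ideal.span {a} ^ k • ⊤ : Submodule A (Fin n → A)) ↔ ∀ i, a ^ k ∣ x i := by
    intro k x
    rw [Ideal.span_singleton_pow, Submodule.ideal_span_singleton_smul,
      Submodule.mem_smul_pointwise_iff_exists]
    constructor
    · rintro ⟨y, -, rfl⟩ i
      exact ⟨y i, rfl⟩
    · intro h
      choose y hy using h
      exact ⟨y, trivial, funext fun i => (hy i).symm⟩
  have hmem' : ∀ (k : ℕ) (x : A),
      x ∈ (Ideal.span {a} ^ k • ⊤ : Submodule A A) ↔ a ^ k ∣ x := by
    intro k x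
    rw [smul_eq_mul, Ideal.mul_top, Ideal.span_singleton_pow, Ideal.mem_span_singleton]
  refine ⟨fun f hf => ?_⟩
  have h : ∀ i, ∃ L : A, ∀ k, f k i ≡ L [SMOD (Ideal.span {a} ^ k • ⊤ : Submodule A A)] := by
    intro i
    refine IsPrecomplete.prec inferInstance (f := fun k => f k i) fun {k l} hkl => ?_
    have := hf hkl
    rw [SModEq.sub_mem, hmem] at this
    rw [SModEq.sub_mem, hmem']
    exact this i
  choose L hL using h
  refine ⟨L, fun k => ?_⟩
  rw [SModEq.sub_mem, hmem]
  intro i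
  have := hL i k
  rwa [SModEq.sub_mem, hmem'] at this

/-- The ring `O` is finite and torsion-free over the principal ideal domain `W(O♭)`, hence free. In
coordinates an element of `O ⊗ W(R)` becomes a finite family in `W(R)`, which is `p`-adically
separated. -/
theorem RamWitt.eq_zero_of_forall_p_pow_dvd (ι : PreTilt O p →+* R) [CharP R p] [PerfectRing R p]
    {π : O} (hπ : RamWitt.Good p π) (hn : ∃ n : ℕ, (p : O) ∣ π ^ n) (x : RamWitt ι)
    (hx : ∀ N : ℕ, (p : RamWitt ι) ^ N ∣ x) : x = 0 := by
  obtain ⟨n, hn⟩ := hn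
  let : Field (PreTilt O p) := hπ.isField.toField
  let : Algebra (WittVector p (PreTilt O p)) O := (WittVector.fontaineTheta O p).toAlgebra
  let : Algebra (WittVector p (PreTilt O p)) (WittVector p R) := (WittVector.map ι).toAlgebra
  have hπn : ∀ (k : ℕ) (c : O), π ^ k * c = 0 → c = 0 := by
    intro k
    induction k with
    | zero => intro c hc; simpa using hc
    | succ k ih => intro c hc; exact hπ.regular _ (ih _ (by rw [← hc, pow_succ, mul_assoc]))
  -- Some power of `π` is a multiple of `p`, so regularity of `π` gives regularity of `p`.
  have hp : ∀ c : O, (p : O) * c = 0 → c = 0 := by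
    intro c hc
    obtain ⟨u, hu⟩ := hn
    exact hπn n c (by rw [hu, mul_right_comm, hc, zero_mul])
  have hpm : ∀ (m : ℕ) (c : O), (p : O) ^ m * c = 0 → c = 0 := by
    intro m
    induction m with
    | zero => intro c hc; simpa using hc
    | succ m ih => intro c hc; exact hp _ (ih _ (by rw [← hc, pow_succ, mul_assoc]))
  have hdig : ∀ c : O, ∃ (t : PreTilt O p) (c' : O),
      c = WittVector.fontaineTheta O p (WittVector.teichmuller p t) + π * c' := by
    intro c
    obtain ⟨t, ht⟩ := hπ.bij.2 (Ideal.Quotient.mk _ c)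
    have h1 : c - WittVector.fontaineTheta O p (WittVector.teichmuller p t) ∈
        Ideal.span {π} := by
      rw [← Ideal.Quotient.eq, ← ht]
      have := WittVector.mk_fontaineTheta (R := O) (WittVector.teichmuller p t)
      rw [WittVector.teichmuller_coeff_zero] at this
      simp only [← this]
      rfl
    obtain ⟨c', hc'⟩ := Ideal.mem_span_singleton.1 h1
    exact ⟨t, c', by rw [← hc']; ring⟩
  have hexp : ∀ (m : ℕ) (c : O), ∃ (w : Fin m → WittVector p (PreTilt O p)) (c' : O),
      c = ∑ i, WittVector.fontaineTheta O p (w i) * π ^ (i : ℕ) + π ^ m * c' := by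
    intro m
    induction m with
    | zero => intro c; exact ⟨0, c, by simp⟩
    | succ m ih =>
      intro c
      obtain ⟨t, c₁, hc₁⟩ := hdig c
      obtain ⟨w, c', hc'⟩ := ih c₁
      refine ⟨Fin.cons (WittVector.teichmuller p t) w, c', ?_⟩
      rw [Fin.sum_univ_succ]
      simp only [Fin.cons_zero, Fin.cons_succ, Fin.val_zero, Fin.val_succ, pow_zero, mul_one]
      rw [hc₁, hc', mul_add, Finset.mul_sum, add_assoc]
      congr 2
      · exact Finset.sum_congr rfl fun i _ => by rw [pow_succ]; ring
      · rw [pow_succ]; ring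
  -- Since `p ∣ π^n`, the elements `1, …, π^(n-1)` generate `O` modulo `p`. Completeness of
  -- `W(O♭)^n` and separatedness of `O` lift this to generation of `O`.
  have hfin : Module.Finite (WittVector p (PreTilt O p)) O := by
    have : IsPrecomplete (Ideal.span {(p : WittVector p (PreTilt O p))})
        (Fin n → WittVector p (PreTilt O p)) := isPrecomplete_pi_span_singleton _ n
    have hmap : (Ideal.span {(p : WittVector p (PreTilt O p))}).map
        (algebraMap (WittVector p (PreTilt O p)) O) = Ideal.span {(p : O)} := by
      rw [Ideal.map_span, Set.image_singleton, map_natCast]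
    have hh : IsHausdorff ((Ideal.span {(p : WittVector p (PreTilt O p))}).map
        (algebraMap (WittVector p (PreTilt O p)) O)) O := by
      rw [hmap]; infer_instance
    have : IsHausdorff (Ideal.span {(p : WittVector p (PreTilt O p))}) O :=
      IsHausdorff.map_algebraMap_iff.mp hh
    let f : (Fin n → WittVector p (PreTilt O p)) →ₗ[WittVector p (PreTilt O p)] O :=
      Fintype.linearCombination _ fun i => π ^ (i : ℕ)
    refine Module.Finite.of_surjective f (surjective_of_mkQ_comp_surjective
      (I := Ideal.span {(p : WittVector p (PreTilt O p))}) fun y => ?_)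
    obtain ⟨c, rfl⟩ := Submodule.mkQ_surjective _ y
    obtain ⟨w, c', hc⟩ := hexp n c
    obtain ⟨u, hu⟩ := hn
    refine ⟨w, ?_⟩
    rw [LinearMap.comp_apply, ← sub_eq_zero, ← map_sub]
    rw [← LinearMap.mem_ker, Submodule.ker_mkQ]
    have hfw : f w = ∑ i, WittVector.fontaineTheta O p (w i) * π ^ (i : ℕ) := by
      rw [Fintype.linearCombination_apply]; rfl
    have : f w - c = (p : WittVector p (PreTilt O p)) • (-(u * c')) := by
      rw [Algebra.smul_def, map_natCast, hfw, hc, hu]; ring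
    rw [this]
    exact Submodule.smul_mem_smul (Ideal.mem_span_singleton_self _) trivial
  -- A nonzero Witt vector over the perfect field `O♭` is `p^m` times a unit, so only regularity of
  -- `p` on `O` matters.
  have htf : Module.IsTorsionFree (WittVector p (PreTilt O p)) O := by
    refine ⟨fun a ha => ?_⟩
    have ha0 : a ≠ 0 := ha.ne_zero
    obtain ⟨m, b, rfl⟩ := WittVector.exists_eq_pow_p_mul' a ha0
    intro c c' hcc
    rw [← sub_eq_zero]
    apply hpm m
    have hu : IsUnit (WittVector.fontaineTheta O p (b : WittVector p (PreTilt O p))) :=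
      b.isUnit.map _
    rw [← hu.mul_right_eq_zero, mul_left_comm, ← mul_assoc]
    have h2 : WittVector.fontaineTheta O p ((p : WittVector p (PreTilt O p)) ^ m * b) * c =
        WittVector.fontaineTheta O p ((p : WittVector p (PreTilt O p)) ^ m * b) * c' := hcc
    rw [map_mul, map_pow, map_natCast] at h2
    rw [mul_sub, h2, sub_self]
  have hfree : Module.Free (WittVector p (PreTilt O p)) O := Module.free_of_finite_type_torsion_free'
  let B := Module.Free.chooseBasis (WittVector p (PreTilt O p)) O
  let E := TensorProduct.equivFinsuppOfBasisLeft (N := WittVector p R) B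
  have key : ∀ z : O ⊗[WittVector p (PreTilt O p)] WittVector p R,
      (∀ N : ℕ, ∃ y, z = (p : WittVector p (PreTilt O p)) ^ N • y) → z = 0 := by
    intro z hz
    apply E.injective
    rw [map_zero]
    ext i : 1
    rw [Finsupp.zero_apply]
    refine IsHausdorff.haus (I := Ideal.span {(p : WittVector p R)}) inferInstance _ fun N => ?_
    rw [SModEq.zero, smul_eq_mul, Ideal.mul_top, Ideal.span_singleton_pow, Ideal.mem_span_singleton]
    obtain ⟨y, rfl⟩ := hz N
    refine ⟨E y i, ?_⟩
    rw [map_smul, Finsupp.smul_apply, Algebra.smul_def, map_pow, map_natCast]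
  refine key x fun N => ?_
  obtain ⟨y, hy⟩ := hx N
  refine ⟨y, ?_⟩
  have h1 : ∀ y : O ⊗[WittVector p (PreTilt O p)] WittVector p R,
      (p : O ⊗[WittVector p (PreTilt O p)] WittVector p R) ^ N * y =
        (p : WittVector p (PreTilt O p)) ^ N • y := by
    intro y
    rw [Algebra.smul_def, map_pow, map_natCast]
  exact hy.trans (h1 y)

variable {K : IntermediateField ℚ_[p] (PadicAlgCl p)} [FiniteDimensional ℚ_[p] K]
  (π : Uniformizer K)

/-- Vanishing digits make `x` divisible by every power of `π`, hence by every power of `p`. -/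
theorem eq_zero_of_coeffA_eq_zero (x : At K) (hx : ∀ k, coeffA π x k = 0) : x = 0 := by
  refine RamWitt.eq_zero_of_forall_p_pow_dvd (iota K) π.good π.exists_p_dvd_pow x fun N => ?_
  obtain ⟨n, hn⟩ := π.exists_p_dvd_pow
  obtain ⟨y, hy⟩ := RamWitt.isExp_coeff π.good x (n * N)
  rw [Finset.sum_eq_zero, zero_add] at hy
  · rw [hy]
    refine Dvd.dvd.mul_right ?_ _
    rw [pow_mul, ← map_pow, ← map_natCast (RamWitt.ofInt (iota K))]
    exact pow_dvd_pow_of_dvd (map_dvd _ hn) N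
  · intro k _
    have : RamWitt.coeff (iota K) π.elt x k = 0 := hx k
    rw [this, RamWitt.teich_zero, mul_zero]

end Separated

/-! ### Images of elements of `B̃` in `B̃^{[r,s]}` -/

section Images

variable {p : ℕ} [Fact p.Prime] {K : IntermediateField ℚ_[p] (PadicAlgCl p)}
  [FiniteDimensional ℚ_[p] K] (π : Uniformizer K)

/-- The graph of the partially defined map `B̃ → B̃^{[r,s]}`: the pairs `(x, z)` that have common
approximations in `B̃⁺[1/[ū]]`. -/
def imageGraph (I : PosInterval) : AddSubgroup (Bt π × BtI π I) where
  carrier := {q | ∀ c : ℝ, ∃ b : BPre π I, (c : EReal) ≤ VI π I (q.1 - b.1) ∧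
    ‖q.2 - (b : BtI π I)‖ ≤ (p : ℝ) ^ (-c)}
  zero_mem' := fun c => ⟨0, by
    have h1 : ((0 : Bt π × BtI π I).1 - (0 : BPre π I).1) = (0 : BPre π I).1 := sub_self _
    rw [h1, ← norm_BPre_le_iff, norm_zero]
    positivity, by
    rw [UniformSpace.Completion.coe_zero, Prod.snd_zero, sub_zero, norm_zero]
    positivity⟩
  add_mem' := fun {q q'} hq hq' c => by
    obtain ⟨b, h1, h2⟩ := hq c
    obtain ⟨b', h1', h2'⟩ := hq' c
    refine ⟨b + b', ?_, ?_⟩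
    · have e : (q + q').1 - (b + b').1 = (q.1 - b.1) + (q'.1 - b'.1) := add_sub_add_comm _ _ _ _
      rw [e]
      exact le_VI_add π h1 h1'
    · rw [Prod.snd_add, UniformSpace.Completion.coe_add, add_sub_add_comm]
      exact (IsUltrametricDist.norm_add_le_max _ _).trans (max_le h2 h2')
  neg_mem' := fun {q} hq c => by
    obtain ⟨b, h1, h2⟩ := hq c
    refine ⟨-b, ?_, ?_⟩
    · have e : (-q).1 - (-b).1 = -(q.1 - b.1) := (neg_sub_neg _ _).trans (neg_sub _ _).symm
      rw [e]
      exact le_VI_neg π h1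
    · rw [Prod.snd_neg, UniformSpace.Completion.coe_neg, neg_sub_neg, ← neg_sub, norm_neg]
      exact h2

variable {π}

/-- Take a common approximation `b` of precision `c`. By the ultrametric inequality, passing from
`z` or from `x` to `b` does not affect whether the threshold `c` is met. -/
theorem norm_le_iff_of_mem_imageGraph {I : PosInterval} {x : Bt π} {z : BtI π I}
    (h : (x, z) ∈ imageGraph π I) (c : ℝ) :
    ‖z‖ ≤ (p : ℝ) ^ (-c) ↔ (c : EReal) ≤ VI π I x := by
  obtain ⟨b, h1, h2⟩ := h c
  change (c : EReal) ≤ VI π I (x - b.1) at h1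
  change ‖z - (b : BtI π I)‖ ≤ _ at h2
  have e1 : ‖z‖ ≤ (p : ℝ) ^ (-c) ↔ ‖b‖ ≤ (p : ℝ) ^ (-c) := by
    rw [← UniformSpace.Completion.norm_coe b]
    constructor
    · intro hz
      have : (b : BtI π I) = z + -(z - b) := by abel
      rw [this]
      exact (IsUltrametricDist.norm_add_le_max _ _).trans (max_le hz (by rwa [norm_neg]))
    · intro hb
      have : z = (z - b) + b := by abel
      rw [this]
      exact (IsUltrametricDist.norm_add_le_max _ _).trans (max_le h2 hb)
  rw [e1, norm_BPre_le_iff]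
  constructor
  · intro hb
    have := le_VI_add π h1 hb
    rwa [sub_add_cancel] at this
  · intro hx
    have := le_VI_sub π hx h1
    rwa [sub_sub_cancel] at this

/-- The difference of two images is an image of `0`, so its norm lies below every threshold. -/
theorem eq_of_mem_imageGraph {I : PosInterval} {x : Bt π} {z z' : BtI π I}
    (h : (x, z) ∈ imageGraph π I) (h' : (x, z') ∈ imageGraph π I) : z = z' := by
  have h0 : ((0 : Bt π), z - z') ∈ imageGraph π I := by
    have := (imageGraph π I).sub_mem h h'
    rwa [Prod.mk_sub_mk, sub_self] at this
  rw [← sub_eq_zero, ← norm_le_zero_iff]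
  refine le_of_forall_rpow (p := p) le_rfl fun c _ => ?_
  rw [norm_le_iff_of_mem_imageGraph h0, le_VI_iff]
  intro t ht
  rw [V_zero π t (I.pos.trans_le ht.1)]
  exact le_top

theorem gal_mem_imageGraph {I : PosInterval} {x : Bt π} {z : BtI π I}
    (h : (x, z) ∈ imageGraph π I) (σ : Gal(PadicAlgCl p/K)) :
    (galB π σ x, galBtI π I σ z) ∈ imageGraph π I := by
  intro c
  obtain ⟨b, h1, h2⟩ := h c
  refine ⟨galPre π I σ b, ?_, ?_⟩
  · change (c : EReal) ≤ VI π I (galB π σ x - galB π σ b.1)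
    rw [← map_sub, VI_gal]
    exact h1
  · change ‖galBtI π I σ z - _‖ ≤ _
    rw [← galBtI_coe, ← map_sub, norm_galBtI]
    exact h2

/-- Mahler coefficients are integral combinations of values, and the graph is a subgroup. Estimates
on them can thus be moved between `Ã` and the completion. -/
theorem mahler_mem_imageGraph {d : ℕ} {I : PosInterval} {F : (Fin d → ℤ_[p]) → At K}
    {G : (Fin d → ℤ_[p]) → BtI π I} (h : ∀ t, (toBt π (F t), G t) ∈ imageGraph π I)
    (n : Fin d → ℕ) : (toBt π (mahler F n), mahler G n) ∈ imageGraph π I := by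
  have e : (toBt π (mahler F n), mahler G n) =
      mahler (fun t => ((toBt π (F t), G t) : Bt π × BtI π I)) n := by
    refine Prod.ext ?_ ?_
    · simp only [mahler, Prod.fst_sum, Prod.smul_fst, map_sum, map_zsmul]
    · simp only [mahler, Prod.snd_sum, Prod.smul_snd]
  rw [e]
  exact (imageGraph π I).sum_mem fun k _ => (imageGraph π I).zsmul_mem (h _) _

variable (π)

/-! ### Estimates for `V` through the digits of elements of `Ã`. -/

theorem le_V_toBt_iff {c t : ℝ} (ht : 0 < t) (x : At K) :
    (c : EReal) ≤ V π (toBt π x) t ↔ ∀ k : ℕ, val p (coeffA π x k) ≤ bnd π c t k := by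
  rw [le_V_iff π ht (n := 0) (y := x) (by simp)]
  simp

theorem coeffA_term (n : ℕ) (a : Et p) (k : ℕ) :
    coeffA π (piA π ^ n * teichA K a) k = if k = n then a else 0 := by
  have h0 : RamWitt.IsExp (iota K) π.elt (teichA K a) (fun j => if j = 0 then a else 0) := by
    intro N
    cases N with
    | zero => exact ⟨teichA K a, by simp⟩
    | succ N =>
      refine ⟨0, ?_⟩
      rw [Finset.sum_range_succ', Finset.sum_eq_zero]
      · simp [teichA]
      · intro j _; simp [RamWitt.teich_zero]
  rw [coeffA, piA]
  by_cases hk : k < n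
  · rw [RamWitt.coeff_pi_pow_mul_of_lt π.good n _ k hk, if_neg hk.ne]
  · obtain ⟨j, rfl⟩ : ∃ j, k = j + n := ⟨k - n, by omega⟩
    rw [RamWitt.coeff_pi_pow_mul π.good, RamWitt.IsExp.coeff_eq π.good h0]
    simp

theorem le_V_term_iff {c t : ℝ} (ht : 0 < t) (n : ℕ) (a : Et p) :
    (c : EReal) ≤ V π (toBt π (piA π ^ n * teichA K a)) t ↔ val p a ≤ bnd π c t n := by
  rw [le_V_toBt_iff π ht]
  constructor
  · intro h
    have := h n
    rwa [coeffA_term, if_pos rfl] at this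
  · intro h k
    rw [coeffA_term]
    split_ifs with hk
    · rwa [hk]
    · simp

/-- Subtracting a partial sum of the expansion leaves the later digits unchanged: the remainder is
`π^N y`, and cancelling the regular element `π^N` identifies the digits of `y` with `x_N, x_{N+1},
…`. -/
theorem le_V_tail {c t : ℝ} (ht : 0 < t) (x : At K) (N : ℕ)
    (h : ∀ k ≥ N, val p (coeffA π x k) ≤ bnd π c t k) :
    (c : EReal) ≤ V π (toBt π (x - ∑ k ∈ Finset.range N, piA π ^ k * teichA K (coeffA π x k))) t := by
  obtain ⟨y, hy⟩ := RamWitt.isExp_coeff π.good x N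
  have hy' : x - ∑ k ∈ Finset.range N, piA π ^ k * teichA K (coeffA π x k) = piA π ^ N * y :=
    sub_eq_iff_eq_add'.2 hy
  have hexp : RamWitt.IsExp (iota K) π.elt y (fun j => coeffA π x (N + j)) := by
    intro m
    obtain ⟨z, hz⟩ := RamWitt.isExp_coeff π.good x (N + m)
    refine ⟨z, ?_⟩
    rw [← sub_eq_zero]
    apply RamWitt.pi_pow_regular (iota K) π.good N
    rw [Finset.sum_range_add] at hz
    rw [mul_sub, mul_add, Finset.mul_sum, sub_eq_zero]
    have h1 := hy.symm.trans hz
    rw [add_assoc, add_right_inj] at h1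
    rw [h1, pow_add, mul_assoc]
    congr 1
    exact Finset.sum_congr rfl fun j _ => by rw [pow_add, mul_assoc]; rfl
  rw [hy', le_V_toBt_iff π ht]
  intro k
  by_cases hk : k < N
  · have : coeffA π (piA π ^ N * y) k = 0 := RamWitt.coeff_pi_pow_mul_of_lt π.good N y k hk
    rw [this]; simp
  · obtain ⟨j, rfl⟩ : ∃ j, k = j + N := ⟨k - N, by omega⟩
    have : coeffA π (piA π ^ N * y) (j + N) = coeffA π x (N + j) := by
      rw [coeffA, piA, RamWitt.coeff_pi_pow_mul π.good, RamWitt.IsExp.coeff_eq π.good hexp]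
    rw [this, add_comm j N]
    exact h _ (Nat.le_add_right _ _)

theorem norm_termI_le_iff (I : PosInterval) (k : ℕ) (a : Et p) (c : ℝ) :
    ‖termI π I k a‖ ≤ (p : ℝ) ^ (-c) ↔ ∀ t ∈ Set.Icc I.r I.s, val p a ≤ bnd π c t k := by
  rw [termI, UniformSpace.Completion.norm_coe, norm_BPre_le_iff, le_VI_iff]
  exact forall₂_congr fun t ht => le_V_term_iff π (I.pos.trans_le ht.1) k a

/-- If the series `∑ π^k [x_k]` converges in `B̃^{[r,s]}`, then its sum is the image of `x`. -/
theorem mem_imageGraph_of_hasSum {I : PosInterval} {x : At K} {z : BtI π I}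
    (h : HasSum (fun k : ℕ => termI π I k (coeffA π x k)) z) :
    (toBt π x, z) ∈ imageGraph π I := by
  have hp0 : (0 : ℝ) < p := by exact_mod_cast (Fact.out : p.Prime).pos
  intro c
  have hc : (0 : ℝ) < (p : ℝ) ^ (-c) := by positivity
  have h1 : ∀ᶠ k in Filter.atTop, ‖termI π I k (coeffA π x k)‖ < (p : ℝ) ^ (-c) := by
    have := h.summable.tendsto_atTop_zero.norm
    rw [norm_zero] at this
    exact this.eventually_lt_const hc
  have h2 : ∀ᶠ N in Filter.atTop,
      ‖z - ∑ k ∈ Finset.range N, termI π I k (coeffA π x k)‖ < (p : ℝ) ^ (-c) := by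
    have := (h.tendsto_sum_nat.const_sub z).norm
    rw [sub_self, norm_zero] at this
    exact this.eventually_lt_const hc
  obtain ⟨N₁, hN₁⟩ := Filter.eventually_atTop.1 h1
  -- The same partial sum must approximate on both sides: it is close to `z` in the completion, and
  -- all omitted digits are small, which bounds the remainder in `B̃`.
  obtain ⟨N, hN, hle⟩ := (h2.and (Filter.eventually_ge_atTop N₁)).exists
  refine ⟨∑ k ∈ Finset.range N, termPre π I k (coeffA π x k), ?_, ?_⟩
  · have e : (∑ k ∈ Finset.range N, termPre π I k (coeffA π x k)).1 =
        toBt π (∑ k ∈ Finset.range N, piA π ^ k * teichA K (coeffA π x k)) := by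
      rw [map_sum]
      exact AddSubmonoidClass.coe_finsetSum (S := Bb π) _ _
    rw [e]
    change (c : EReal) ≤ VI π I (toBt π x - _)
    rw [← map_sub, le_VI_iff]
    intro t ht
    refine le_V_tail π (I.pos.trans_le ht.1) x N fun k hk => ?_
    exact (norm_termI_le_iff π I k _ c).1 (hN₁ k (hle.trans hk)).le t ht
  · have e : ((∑ k ∈ Finset.range N, termPre π I k (coeffA π x k) : BPre π I) : BtI π I) =
        ∑ k ∈ Finset.range N, termI π I k (coeffA π x k) :=
      map_sum (UniformSpace.Completion.toComplL (𝕜 := ℤ) (E := BPre π I)) _ _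
    rw [e]
    exact hN.le

theorem summable_termI {I : PosInterval} {x : At K}
    (h : ∀ c : ℝ, ∃ N, ∀ k ≥ N, ∀ t ∈ Set.Icc I.r I.s, val p (coeffA π x k) ≤ bnd π c t k) :
    Summable (fun k : ℕ => termI π I k (coeffA π x k)) := by
  refine NonarchimedeanAddGroup.summable_of_tendsto_cofinite_zero ?_
  have hp1 : (1 : ℝ) < p := by exact_mod_cast (Fact.out : p.Prime).one_lt
  rw [Nat.cofinite_eq_atTop, Metric.tendsto_atTop]
  intro ε hε
  obtain ⟨N, hN⟩ := h (-Real.logb p (ε / 2))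
  refine ⟨N, fun k hk => ?_⟩
  have h1 := (norm_termI_le_iff π I k _ _).2 (hN k hk)
  rw [neg_neg, Real.rpow_logb (by linarith) hp1.ne' (half_pos hε)] at h1
  rw [dist_zero_right]
  exact h1.trans_lt (half_lt_self hε)

/-- An infinite infimum forces every term to be infinite, which happens only for zero digits;
separatedness then gives `x = 0`. -/
theorem eq_zero_of_forall_le_V {x : At K} {t : ℝ}
    (h : ∀ c : ℝ, (c : EReal) ≤ V π (toBt π x) t) : x = 0 := by
  refine eq_zero_of_coeffA_eq_zero π x fun k => ?_
  by_contra h0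
  have h1 : V π (toBt π x) t = ⊤ := by
    rw [EReal.eq_top_iff_forall_lt]
    exact fun c => lt_of_lt_of_le (EReal.coe_lt_coe_iff.2 (lt_add_one c)) (h _)
  rw [V, iInf_eq_top] at h1
  have h2 := h1 k
  have e : coeffB π (toBt π x) k = coeffA π x k := by
    rw [coeffB_eq π (n := 0) (y := x) (by simp), if_neg (by omega)]
    simp
  rw [e, vE, if_neg h0, ← EReal.coe_mul, ← EReal.coe_add] at h2
  exact EReal.coe_ne_top _ h2

/-- Bounds for `V(·, r)` on `Ã` propagate to all `t ≥ r`. -/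
theorem bnd_le_bnd {c r t : ℝ} (hr : 0 < r) (hrt : r ≤ t) (k : ℕ) :
    bnd π c r k ≤ bnd π (c * r / t) t k := by
  have hp1 : (1 : ℝ) < p := by exact_mod_cast (Fact.out : p.Prime).one_lt
  have ht : 0 < t := hr.trans_le hrt
  rw [← NNReal.coe_le_coe]
  change (p : ℝ) ^ (-((c - ((k : ℤ) : ℝ) * vPi π) * (p * r / (p - 1)))) ≤
    (p : ℝ) ^ (-((c * r / t - ((k : ℤ) : ℝ) * vPi π) * (p * t / (p - 1))))
  apply Real.rpow_le_rpow_of_exponent_le hp1.le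
  have hq : 0 < (p : ℝ) / (p - 1) := div_pos (by linarith) (by linarith)
  have e1 : (c * r / t - ((k : ℤ) : ℝ) * vPi π) * (p * t / (p - 1)) =
      p / (p - 1) * (c * r - ((k : ℤ) : ℝ) * vPi π * t) := by
    field_simp
  have e2 : (c - ((k : ℤ) : ℝ) * vPi π) * (p * r / (p - 1)) =
      p / (p - 1) * (c * r - ((k : ℤ) : ℝ) * vPi π * r) := by ring
  rw [e1, e2, neg_le_neg_iff]
  -- The inequality has been reduced to `k v_p(π) r ≤ k v_p(π) t`. It holds because `k ≥ 0`, that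
  -- is, because negative powers of `π` are absent.
  have hk : 0 ≤ ((k : ℤ) : ℝ) * vPi π := mul_nonneg (by positivity) (vPi_pos π).le
  gcongr

theorem bnd_anti {c c' r : ℝ} (hr : 0 < r) (h : c' ≤ c) (k : ℤ) : bnd π c r k ≤ bnd π c' r k := by
  have hp1 : (1 : ℝ) < p := by exact_mod_cast (Fact.out : p.Prime).one_lt
  rw [← NNReal.coe_le_coe]
  change (p : ℝ) ^ _ ≤ (p : ℝ) ^ _
  apply Real.rpow_le_rpow_of_exponent_le hp1.le
  have : 0 ≤ (p : ℝ) * r / (p - 1) := (div_pos (by positivity) (by linarith)).le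
  gcongr

/-- On `[r,s]` the quantity `c r/t` lies between `c r/s` and `c`; which of the two is smaller
depends on the sign of `c`. -/
theorem min_le_mul_div {c r s t : ℝ} (hr : 0 < r) (hrt : r ≤ t) (hts : t ≤ s) :
    min (c * r / s) c ≤ c * r / t := by
  have ht : 0 < t := hr.trans_le hrt
  rcases le_total 0 c with h | h
  · refine (min_le_left _ _).trans ?_
    gcongr
  · refine (min_le_right _ _).trans ?_
    rw [le_div_iff₀ ht]
    nlinarith

theorem bnd_le_bnd_of_mem_Icc {c r s t : ℝ} (hr : 0 < r) (ht : t ∈ Set.Icc r s) (k : ℕ) :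
    bnd π c r k ≤ bnd π (min (c * r / s) c) t k :=
  (bnd_le_bnd π hr ht.1 k).trans (bnd_anti π (hr.trans_le ht.1) (min_le_mul_div hr ht.1 ht.2) k)

/-- Control at the left end suffices on the whole interval, since the digits satisfy the propagated
bound separately at each `t`. A positive `c` loses only the fixed factor `r/s`, so linear growth
stays linear. -/
theorem le_VI_of_le_V {I : PosInterval} {c : ℝ} {x : At K}
    (h : (c : EReal) ≤ V π (toBt π x) I.r) :
    ((min (c * I.r / I.s) c : ℝ) : EReal) ≤ VI π I (toBt π x) := by
  rw [le_VI_iff]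
  intro t ht
  rw [le_V_toBt_iff π I.pos] at h
  rw [le_V_toBt_iff π (I.pos.trans_le ht.1)]
  exact fun k => (h k).trans (bnd_le_bnd_of_mem_Icc π I.pos ht k)

end Images

/-! ### Invariants and orbits -/

section Orbits

variable {p : ℕ} [Fact p.Prime] {K : IntermediateField ℚ_[p] (PadicAlgCl p)}

theorem galCp_mul (σ τ : Gal(PadicAlgCl p/K)) (x : ℂ_[p]) :
    galCp (σ * τ) x = galCp σ (galCp τ x) := by
  induction x using UniformSpace.Completion.induction_on with
  | hp =>
    exact isClosed_eq (continuous_galCp _) ((continuous_galCp σ).comp (continuous_galCp τ))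
  | ih x => rw [galCp_coe, galCp_coe, galCp_coe, AlgEquiv.mul_apply]

theorem galPlus_mul (σ τ : Gal(PadicAlgCl p/K)) (x : EtPlus p) :
    galPlus (σ * τ) x = galPlus σ (galPlus τ x) := by
  refine Perfection.ext fun n => ?_
  change galModP (σ * τ) (PreTilt.coeff n x) = galModP σ (galModP τ (PreTilt.coeff n x))
  obtain ⟨c, hc⟩ := Ideal.Quotient.mk_surjective (PreTilt.coeff n x)
  rw [← hc]
  change Ideal.Quotient.mk _ (galOCp (σ * τ) c) = Ideal.Quotient.mk _ (galOCp σ (galOCp τ c))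
  congr 1
  exact Subtype.ext (galCp_mul σ τ c)

theorem galE_mul (σ τ : Gal(PadicAlgCl p/K)) (x : Et p) :
    galE (σ * τ) x = galE σ (galE τ x) := by
  obtain ⟨a, b, hb, rfl⟩ := IsFractionRing.div_surjective (A := EtPlus p) x
  simp only [map_div₀, galE_algebraMap, galPlus_mul]

variable [FiniteDimensional ℚ_[p] K]

theorem galA_mul (σ τ : Gal(PadicAlgCl p/K)) (x : At K) :
    galA (σ * τ) x = galA σ (galA τ x) := by
  induction x using RamWitt.induction_on with
  | tmul c w =>
    simp only [map_mul, galA, RamWitt.map_ofInt, RamWitt.map_ofWitt]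
    congr 2
    ext n
    simp only [WittVector.map_coeff, galE_mul]
  | add x y hx hy => simp only [map_add, hx, hy]

variable {Kinf : IntermediateField K (PadicAlgCl p)}

theorem galA_mem_AtFixed [IsGalois K Kinf] {x : At K} (hx : x ∈ AtFixed Kinf) (τ : Gal(PadicAlgCl p/K)) :
    galA τ x ∈ AtFixed Kinf := by
  intro σ hσ
  -- The subgroup `H_K` is normal because `K_∞/K` is Galois.
  have h1 : τ⁻¹ * σ * τ ∈ Kinf.fixingSubgroup := by
    have hn : Kinf.fixingSubgroup.Normal := inferInstance
    have := hn.conj_mem σ hσ τ⁻¹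
    rwa [inv_inv] at this
  have h2 : σ * τ = τ * (τ⁻¹ * σ * τ) := by group
  rw [← galA_mul, h2, galA_mul, hx _ h1]

variable (π : Uniformizer K)

/-- For `σ ∈ H_K`, both `z` and `σ(z)` are images of `x = σ(x)`, so they coincide. -/
theorem mem_BtIFixed_of_mem_imageGraph {I : PosInterval} {x : At K} {z : BtI π I}
    (hx : x ∈ AtFixed Kinf) (h : (toBt π x, z) ∈ imageGraph π I) : z ∈ BtIFixed π Kinf I := by
  intro σ hσ
  have := gal_mem_imageGraph h σ
  rw [galB_toBt, hx σ hσ] at this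
  exact eq_of_mem_imageGraph this h

/-- If `σ(z) = z`, then `0` is an image of `σ(x) - x`. All its valuations at `r` are then infinite,
and separatedness of `Ã` makes it zero. -/
theorem mem_AtFixed_of_mem_imageGraph {I : PosInterval} {x : At K} {z : BtI π I}
    (hz : z ∈ BtIFixed π Kinf I) (h : (toBt π x, z) ∈ imageGraph π I) : x ∈ AtFixed Kinf := by
  intro σ hσ
  have h1 := (imageGraph π I).sub_mem (gal_mem_imageGraph h σ) h
  rw [Prod.mk_sub_mk, hz σ hσ, sub_self, galB_toBt, ← map_sub] at h1
  rw [← sub_eq_zero]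
  refine eq_zero_of_forall_le_V π (t := I.r) fun c => ?_
  have h2 := (norm_le_iff_of_mem_imageGraph h1 c).1 (by rw [norm_zero]; positivity)
  exact le_VI_iff π |>.1 h2 I.r ⟨le_rfl, I.le⟩

variable {d : ℕ} (C : Coordinates p Gal(Kinf/K) d)

theorem orbit_mem_imageGraph {I : PosInterval} {x : At K} {z : BtI π I}
    (h : (toBt π x, z) ∈ imageGraph π I) (m : ℕ) (t : Fin d → ℤ_[p]) :
    (toBt π (orbitA C m x t), galBtI π I (liftGal (C.param m t)) z) ∈ imageGraph π I := by
  have := gal_mem_imageGraph h (liftGal (C.param m t))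
  rwa [galB_toBt] at this

/-- A power series valid only on `p^h ℤ_p^d` in the coordinate of `Γ_m` is a power series on all of
`ℤ_p^d` in the coordinate of `Γ_{m+h}`. -/
theorem param_p_pow_mul (m h : ℕ) (t : Fin d → ℤ_[p]) :
    C.param m (fun i => (p : ℤ_[p]) ^ h * t i) = C.param (m + h) t := by
  simp only [Coordinates.param, pow_add, mul_assoc]

end Orbits

/-! ### Overconvergent elements and growth conditions -/

section Overconvergent

variable {p : ℕ} [Fact p.Prime] {K : IntermediateField ℚ_[p] (PadicAlgCl p)}
  [FiniteDimensional ℚ_[p] K] (π : Uniformizer K)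

variable (p) in
theorem rZero_pos : 0 < rZero p := by
  have hp1 : (1 : ℝ) < p := by exact_mod_cast (Fact.out : p.Prime).one_lt
  exact div_pos (by linarith) (by linarith)

theorem le_one_div_mul_iff {ρ : ℝ} (hρ : 0 < ρ) (B : ℝ) (y : EReal) :
    (B : EReal) ≤ ((1 / ρ : ℝ) : EReal) * y ↔ ((ρ * B : ℝ) : EReal) ≤ y := by
  have h : 0 < 1 / ρ := by positivity
  induction y with
  | bot => rw [EReal.coe_mul_bot_of_pos h, le_bot_iff, le_bot_iff]; simp only [EReal.coe_ne_bot]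
  | top => rw [EReal.coe_mul_top_of_pos h]; simp
  | coe y =>
    rw [← EReal.coe_mul, EReal.coe_le_coe_iff, EReal.coe_le_coe_iff, one_div, inv_mul_eq_div,
      le_div_iff₀ hρ, mul_comm]

theorem le_vRho_iff {ρ : ℝ} (hρ : 0 < ρ) (B : ℝ) (x : At K) :
    (B : EReal) ≤ vRho π ρ x ↔ ((ρ * B : ℝ) : EReal) ≤ V π (toBt π x) (rZero p / ρ) :=
  le_one_div_mul_iff hρ B _

theorem val_le_of_le_vE_add {B y : ℝ} {b : Et p} (h : (B : EReal) ≤ vE p b + (y : EReal)) :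
    ((val p b : ℝ≥0) : ℝ) ≤ (p : ℝ) ^ (y - B) := by
  have hp1 : (1 : ℝ) < p := by exact_mod_cast (Fact.out : p.Prime).one_lt
  by_cases hb : b = 0
  · rw [hb, map_zero, NNReal.coe_zero]; positivity
  · have hv : (0 : ℝ) < (val p b : ℝ≥0) := by
      have : val p b ≠ 0 := (val p).ne_zero_iff.2 hb
      exact_mod_cast pos_iff_ne_zero.2 this
    rw [vE, if_neg hb, ← EReal.coe_add, EReal.coe_le_coe_iff] at h
    rw [← Real.logb_le_iff_le_rpow hp1 hv]
    linarith

/-- Multiplication by `[a]` shifts every `v_E(x_k)` by the same constant, so the convergence to `+∞`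
required after inverting `[a]` already holds for the digits of `x`. -/
theorem exists_val_coeffA_le_bnd {ρ : ℝ} {x : At K} (hx : x ∈ AtRho π ρ) (c : ℝ) :
    ∃ N, ∀ k ≥ N, val p (coeffA π x k) ≤ bnd π c (rZero p / ρ) k := by
  have hp1 : (1 : ℝ) < p := by exact_mod_cast (Fact.out : p.Prime).one_lt
  have hp0 : (0 : ℝ) < p := by linarith
  obtain ⟨a, ha, -, hlim⟩ := hx
  set a' := algebraMap (EtPlus p) (Et p) a with ha'
  have ha1 : a' ≠ 0 := (map_ne_zero_iff _ (IsFractionRing.injective (EtPlus p) (Et p))).2 ha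
  have hv : (0 : ℝ) < (val p a' : ℝ≥0) := by
    have : val p a' ≠ 0 := (val p).ne_zero_iff.2 ha1
    exact_mod_cast pos_iff_ne_zero.2 this
  set r := rZero p / ρ
  set L := Real.logb p (val p a')
  have hL : (p : ℝ) ^ L = (val p a' : ℝ≥0) := Real.rpow_logb hp0 hp1.ne' hv
  obtain ⟨N, hN⟩ := Filter.eventually_atTop.1
    (Filter.Tendsto.eventually_const_le (EReal.coe_lt_top (c * (p * r / (p - 1)) - L)) hlim)
  refine ⟨N, fun k hk => ?_⟩
  have h1 := val_le_of_le_vE_add (hN k hk)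
  have e : coeffA π (teichA K a' * x) k = a' * coeffA π x k :=
    RamWitt.coeff_teich_mul π.good a' x k
  rw [e, map_mul, NNReal.coe_mul, ← hL, ← le_div_iff₀' (by positivity), ← Real.rpow_sub hp0] at h1
  rw [← NNReal.coe_le_coe]
  change _ ≤ (p : ℝ) ^ (-((c - ((k : ℤ) : ℝ) * vPi π) * (p * r / (p - 1))))
  refine h1.trans_eq ?_
  congr 1
  push_cast
  ring

/-- Decreasing `ρ` increases `r = r_0/ρ`, and the weights `k v_p(π)` are nonnegative, so the
condition becomes weaker. -/
theorem AtRho_anti {ρ ρ' : ℝ} (hρ' : 0 < ρ') (h : ρ' ≤ ρ) {x : At K} (hx : x ∈ AtRho π ρ) :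
    x ∈ AtRho π ρ' := by
  have hp1 : (1 : ℝ) < p := by exact_mod_cast (Fact.out : p.Prime).one_lt
  obtain ⟨a, ha, h1, h2⟩ := hx
  have key : ∀ k : ℕ, vE p (coeffA π (teichA K (algebraMap (EtPlus p) (Et p) a) * x) k) +
      ((p * (rZero p / ρ) / (p - 1) * (k * vPi π) : ℝ) : EReal) ≤
      vE p (coeffA π (teichA K (algebraMap (EtPlus p) (Et p) a) * x) k) +
      ((p * (rZero p / ρ') / (p - 1) * (k * vPi π) : ℝ) : EReal) := by
    intro k
    gcongr
    · exact mul_nonneg (by positivity) (vPi_pos π).le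
    · exact (rZero_pos p).le
  exact ⟨a, ha, fun k => (h1 k).trans (key k),
    tendsto_nhds_top_mono h2 (Filter.Eventually.of_forall key)⟩

/-! ### Linear growth and valuations of factorials. -/

theorem mul_sup_le_growth {d : ℕ} (lam : ℝ) (n : Fin d → ℕ) :
    (p : ℝ) ^ lam / p * (Finset.univ.sup n : ℕ) ≤ growth p lam n := by
  have hp := (Fact.out : p.Prime)
  have hp0 : (0 : ℝ) < p := by exact_mod_cast hp.pos
  rw [growth]
  split_ifs with h
  · subst h
    have : Finset.univ.sup (0 : Fin d → ℕ) = 0 := by simp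
    rw [this]; simp
  · have h1 : Finset.univ.sup n < p ^ (Nat.log p (Finset.univ.sup n) + 1) :=
      Nat.lt_pow_succ_log_self hp.one_lt _
    have h2 : ((Finset.univ.sup n : ℕ) : ℝ) ≤ (p : ℝ) ^ Nat.log p (Finset.univ.sup n) * p := by
      rw [← pow_succ]; exact_mod_cast h1.le
    calc (p : ℝ) ^ lam / p * (Finset.univ.sup n : ℕ)
        ≤ (p : ℝ) ^ lam / p * ((p : ℝ) ^ Nat.log p (Finset.univ.sup n) * p) := by gcongr
      _ = _ := by field_simp

theorem norm_factorial_le (N : ℕ) : ‖(N.factorial : ℤ_[p])‖ ≤ (p : ℝ) ^ (-((N / p : ℕ) : ℝ)) := by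
  have hp := (Fact.out : p.Prime)
  have hp0 : (0 : ℝ) < p := by exact_mod_cast hp.pos
  have h1 : p ^ (N / p) ∣ N.factorial := by
    have h2 : ∀ m : ℕ, p ^ m ∣ (p * m).factorial := by
      intro m
      induction m with
      | zero => simp
      | succ m ih =>
        obtain ⟨q, hq⟩ : ∃ q, p = q + 1 := ⟨p - 1, by have := hp.pos; omega⟩
        have e : p * (m + 1) = (p * m + q) + 1 := by rw [mul_add, mul_one]; omega
        rw [e, Nat.factorial_succ, ← e, pow_succ']
        exact mul_dvd_mul (Dvd.intro _ rfl)
          (ih.trans (Nat.factorial_dvd_factorial (Nat.le_add_right _ _)))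
    exact (h2 _).trans (Nat.factorial_dvd_factorial (Nat.mul_div_le N p))
  obtain ⟨q, hq⟩ := h1
  rw [hq, Nat.cast_mul, Nat.cast_pow, norm_mul, PadicInt.norm_p_pow, zpow_neg, Real.rpow_neg hp0.le,
    Real.rpow_natCast, zpow_natCast]
  exact mul_le_of_le_one_right (by positivity) (PadicInt.norm_le_one _)

/-- Only the factor with `n_i = |n|` is kept. Its valuation is at least `⌊n_i/p⌋`, and `p^⌊log_p
n_i⌋ ≤ n_i < p(⌊n_i/p⌋ + 1)`. This explains `λ = -1` and the additive loss of `1`. -/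
theorem norm_prod_factorial_le {d : ℕ} (n : Fin d → ℕ) :
    ‖∏ i, ((n i).factorial : ℤ_[p])‖ ≤ (p : ℝ) ^ (1 - growth p (-1) n) := by
  have hp := (Fact.out : p.Prime)
  have hp1 : (1 : ℝ) < p := by exact_mod_cast hp.one_lt
  have hp0 : (0 : ℝ) < p := by linarith
  rw [growth]
  split_ifs with h
  · refine (PadicInt.norm_le_one _).trans ?_
    rw [sub_zero, Real.rpow_one]; exact hp1.le
  obtain ⟨j, hj⟩ := Function.ne_iff.1 h
  obtain ⟨i, -, hi⟩ := Finset.exists_mem_eq_sup Finset.univ ⟨j, Finset.mem_univ j⟩ n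
  rw [hi, ← Finset.mul_prod_erase _ _ (Finset.mem_univ i), norm_mul]
  refine (mul_le_of_le_one_right (norm_nonneg _) (PadicInt.norm_le_one _)).trans ?_
  refine (norm_factorial_le (n i)).trans ?_
  apply Real.rpow_le_rpow_of_exponent_le hp1.le
  have hni : n i ≠ 0 := by
    have : n j ≤ n i := by rw [← hi]; exact Finset.le_sup (Finset.mem_univ j)
    intro h0
    rw [h0] at this
    exact hj (Nat.le_zero.1 this)
  have h1 : p ^ Nat.log p (n i) ≤ n i := Nat.pow_log_le_self p hni
  have h2 : n i < p * (n i / p + 1) := Nat.lt_mul_div_succ _ hp.pos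
  have h3 : ((p : ℝ) ^ Nat.log p (n i)) ≤ p * ((n i / p : ℕ) + 1) := by
    exact_mod_cast h1.trans h2.le
  rw [Real.rpow_neg_one]
  have h4 : (p : ℝ)⁻¹ * (p : ℝ) ^ Nat.log p (n i) ≤ ((n i / p : ℕ) : ℝ) + 1 := by
    rwa [inv_mul_le_iff₀ hp0]
  linarith

end Overconvergent

/-! ### Comparison of locally analytic and pro-analytic vectors -/

section Comparison

variable {p : ℕ} [Fact p.Prime] {K : IntermediateField ℚ_[p] (PadicAlgCl p)}
  [FiniteDimensional ℚ_[p] K] (π : Uniformizer K)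
  {Kinf : IntermediateField K (PadicAlgCl p)} {d : ℕ}
  (C : Coordinates p Gal(Kinf/K) d)

theorem hasSum_termI_of_mem_AtRho {ρ : ℝ} {x : At K} (hx : x ∈ AtRho π ρ) (I : PosInterval)
    (hI : I.r = rZero p / ρ) :
    ∃ z : BtI π I, HasSum (fun k : ℕ => termI π I k (coeffA π x k)) z := by
  refine summable_termI π fun c => ?_
  have hr := I.pos
  have hs : 0 < I.s := hr.trans_le I.le
  -- The maximum with `c s/r` compensates in advance for the factor `r/s` lost in passing from the
  -- endpoint `r` to `[r,s]`.
  obtain ⟨N, hN⟩ := exists_val_coeffA_le_bnd π hx (max c (c * I.s / I.r))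
  refine ⟨N, fun k hk t ht => (hN k hk).trans ?_⟩
  rw [← hI]
  refine (bnd_le_bnd_of_mem_Icc π hr ht k).trans (bnd_anti π (hr.trans_le ht.1) ?_ k)
  refine le_min ?_ (le_max_left _ _)
  rw [le_div_iff₀ hs, ← div_le_iff₀ hr]
  exact le_max_right _ _

/-- If the orbit map of `x` is analytic for `v_ρ` in the sense of Mahler coefficients, then the
image of `x` in `B̃^{[r,s]}` is locally analytic, for `r = r_0/ρ`. -/
theorem mem_laVectorsI_of_isMahlerAnalytic [IsGalois K Kinf] {ρ : ℝ} (hρ : 0 < ρ) {m : ℕ} {lam μ : ℝ} {x : At K}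
    (hfix : x ∈ AtFixed Kinf) (hla : IsMahlerAnalytic π C ρ m lam μ x) (I : PosInterval)
    (hI : I.r = rZero p / ρ) {z : BtI π I} (hz : (toBt π x, z) ∈ imageGraph π I) :
    z ∈ laVectorsI π C I := by
  have hp1 : (1 : ℝ) < p := by exact_mod_cast (Fact.out : p.Prime).one_lt
  have hp0 : (0 : ℝ) < p := by linarith
  have hr := I.pos
  have hs : 0 < I.s := hr.trans_le I.le
  obtain ⟨hcont, hcoef⟩ := hla
  let F : (Fin d → ℤ_[p]) → BtI π I := fun t => galBtI π I (liftGal (C.param m t)) z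
  have hF : ∀ t, (toBt π (orbitA C m x t), F t) ∈ imageGraph π I := fun t =>
    orbit_mem_imageGraph π C hz m t
  have hFc : Continuous F := by
    rw [continuous_iff_continuousAt]
    intro t
    rw [ContinuousAt, tendsto_iff_norm_sub_tendsto_zero, Metric.tendsto_nhds]
    intro ε hε
    set c := -Real.logb p (ε / 2)
    have hc : (p : ℝ) ^ (-c) = ε / 2 := by
      rw [neg_neg, Real.rpow_logb hp0 hp1.ne' (half_pos hε)]
    set c' := max c (c * I.s / I.r)
    filter_upwards [hcont t (c' / ρ)] with t' ht'
    rw [le_vRho_iff π hρ, mul_div_cancel₀ _ hρ.ne', ← hI] at ht'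
    have h1 := le_VI_of_le_V π ht'
    have h2 : c ≤ min (c' * I.r / I.s) c' := by
      refine le_min ?_ (le_max_left _ _)
      rw [le_div_iff₀ hs, ← div_le_iff₀ hr]
      exact le_max_right _ _
    have h3 := (imageGraph π I).sub_mem (hF t') (hF t)
    rw [Prod.mk_sub_mk, ← map_sub] at h3
    have h4 := (norm_le_iff_of_mem_imageGraph h3 c).2 ((EReal.coe_le_coe_iff.2 h2).trans h1)
    rw [Real.dist_0_eq_abs, abs_norm]
    rw [hc] at h4
    exact h4.trans_lt (half_lt_self hε)
  have hFS : ∀ t, F t ∈ fixedSubgroup π Kinf I := fun t =>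
    mem_BtIFixed_of_mem_imageGraph π (galA_mem_AtFixed hfix _) (hF t)
  -- The slope has three sources: `p^λ/p` from the growth function, `ρ` from the normalization of
  -- `v_ρ`, and `r/s` from the passage to the interval.
  have hc0 : 0 < I.r / I.s * (ρ * ((p : ℝ) ^ lam / p)) := by positivity
  obtain ⟨h, w, hwS, hw0, hw⟩ := exists_power_series_of_mahler (fixedSubgroup π Kinf I)
    (isClosed_fixedSubgroup π Kinf I) (fun t x hx => smul_mem_fixedSubgroup π Kinf I t x hx)
    (exists_p_smul_eq_fixedSubgroup π Kinf I) hFc hFS hc0 (B := ρ * |μ|) (by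
      intro n
      have h1 := hcoef n
      rw [le_vRho_iff π hρ, ← hI] at h1
      have h2 := le_VI_of_le_V π h1
      have h3 := (norm_le_iff_of_mem_imageGraph (mahler_mem_imageGraph hF n) _).2 h2
      refine h3.trans (Real.rpow_le_rpow_of_exponent_le hp1.le ?_)
      have h4 := mul_sup_le_growth (p := p) lam n
      set q := I.r / I.s with hq
      have hq0 : 0 < q := by positivity
      have hq1 : q ≤ 1 := (div_le_one hs).2 I.le
      set S : ℝ := (p : ℝ) ^ lam / p * (Finset.univ.sup n : ℕ) with hS
      have hS0 : 0 ≤ S := by positivity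
      have e1 : q * (ρ * ((p : ℝ) ^ lam / p)) * (Finset.univ.sup n : ℕ) = q * (ρ * S) := by
        rw [hS]; ring
      rw [e1, neg_le]
      have h5 : -(ρ * |μ|) ≤ ρ * μ := by
        have := neg_abs_le μ
        nlinarith
      have h6 : 0 ≤ ρ * |μ| := by positivity
      have h7 : ρ * S + ρ * μ ≤ ρ * (growth p lam n + μ) := by nlinarith
      have h8 : 0 ≤ ρ * S := by positivity
      -- The constant `ρ|μ|` serves both branches: since `r/s ≤ 1`, scaling `ρμ` by `r/s` cannot
      -- push it below `-ρ|μ|`, and the unscaled branch only has a larger slope.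
      refine le_min ?_ ?_
      · have e2 : ρ * (growth p lam n + μ) * I.r / I.s = q * (ρ * (growth p lam n + μ)) := by
          rw [hq]; ring
        rw [e2]
        have h9 : q * (ρ * S + ρ * μ) ≤ q * (ρ * (growth p lam n + μ)) := by gcongr
        nlinarith
      · nlinarith)
  refine ⟨mem_BtIFixed_of_mem_imageGraph π hfix hz, m + h, w, hwS, hw0, fun t => ?_⟩
  have := hw t
  change HasSum _ (galBtI π I (liftGal (C.param m fun i => (p : ℤ_[p]) ^ h * t i)) z) at this
  rwa [param_p_pow_mul] at this

/-- The radius `r = r_0/ρ` works for every `s`. The subgroup on which the orbit is given by a power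
series may shrink as `s` grows, which pro-analyticity allows. -/
theorem laVectors_subset_paVectors [IsGalois K Kinf] : laVectors π C ⊆ paVectors π C := by
  rintro x ⟨ρ, hρ, ⟨hx, hfix⟩, m, lam, μ, hla⟩
  have hr : 0 < rZero p / ρ := div_pos (rZero_pos p) hρ
  let r : Set.Ioi (0 : ℝ) := ⟨rZero p / ρ, hr⟩
  choose z hz using fun s : Set.Ici (r : ℝ) =>
    hasSum_termI_of_mem_AtRho π hx (interval r s) rfl
  -- Restriction is continuous and fixes every term `π^k [x_k]`, so the sums on different intervals
  -- are compatible.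
  have hres : ∀ (s s' : Set.Ici (r : ℝ)) (h : s ≤ s'),
      res π (interval_subset r h) (z s') = z s := by
    intro s s' h
    have h1 := (hz s').map (res π (interval_subset r h)) (AddMonoidHom.continuous_completion _ _)
    refine h1.unique ?_
    convert hz s using 1
    funext k
    exact AddMonoidHom.completion_coe _ _ _
  have hgraph := fun s => mem_imageGraph_of_hasSum π (hz s)
  have hlaI := fun s => mem_laVectorsI_of_isMahlerAnalytic π C hρ hfix hla (interval r s) rfl
    (hgraph s)
  exact ⟨r, ⟨z, hres⟩, hz, fun s => (hlaI s).1, hlaI⟩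

/-- One interval `[r,s]` suffices: factorial divisibility bounds the Mahler coefficients there, and
the bound is then read at the endpoint `s`, which corresponds to `ρ = r_0/s`. -/
theorem AtDagger_inter_paVectors_subset : AtDagger π ∩ paVectors π C ⊆ laVectors π C := by
  rintro x ⟨⟨ρ₁, hρ₁, hx⟩, r, y, hy, hfix, hpa⟩
  have hp1 : (1 : ℝ) < p := by exact_mod_cast (Fact.out : p.Prime).one_lt
  have hp0 : (0 : ℝ) < p := by linarith
  have hr0 := rZero_pos p
  -- The condition `s ≥ r` gives access to local analyticity, and `s ≥ r_0/ρ₁` ensures `ρ ≤ ρ₁`, so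
  -- that `x` lies in `Ã^{(0,ρ]}`.
  let s : Set.Ici (r : ℝ) := ⟨max r (rZero p / ρ₁), Set.mem_Ici.2 (le_max_left _ _)⟩
  have hs : 0 < (s : ℝ) := lt_of_lt_of_le r.2 s.2
  let I := interval r s
  have hsI : (s : ℝ) ∈ Set.Icc I.r I.s := ⟨s.2, le_rfl⟩
  let ρ := rZero p / s
  have hρ : 0 < ρ := div_pos hr0 hs
  have hsρ : rZero p / ρ = s := div_div_cancel₀ hr0.ne'
  have hρ₁' : ρ ≤ ρ₁ := by
    rw [div_le_iff₀ hs, ← div_le_iff₀' hρ₁]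
    exact le_max_right _ _
  have hz := mem_imageGraph_of_hasSum π (hy s)
  obtain ⟨-, m, w, -, hw0, hw⟩ := hpa s
  let F : (Fin d → ℤ_[p]) → BtI π I := fun t => galBtI π I (liftGal (C.param m t)) (y.1 s)
  have hF : ∀ t, (toBt π (orbitA C m x t), F t) ∈ imageGraph π I := fun t =>
    orbit_mem_imageGraph π C hz m t
  obtain ⟨hFc, B, hB0, hB⟩ := continuous_and_norm_mahler_le (F := F) hw0 hw
  have hle : ∀ {u : At K} {v : BtI π I} {c : ℝ}, (toBt π u, v) ∈ imageGraph π I →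
      ‖v‖ ≤ (p : ℝ) ^ (-(ρ * c)) → (c : EReal) ≤ vRho π ρ u := by
    intro u v c huv hv
    rw [le_vRho_iff π hρ, hsρ]
    exact le_VI_iff π |>.1 ((norm_le_iff_of_mem_imageGraph huv _).1 hv) s hsI
  -- Here `p^λ = p^{-1}/ρ`: the factorial bound has `λ = -1`, and `v_ρ` divides `V` by `ρ`. In `μ`,
  -- the `1` is the loss in the factorial bound, and `B + 1` replaces `B` to keep the logarithm
  -- meaningful when `B = 0`.
  refine ⟨ρ, hρ, ⟨AtRho_anti π hρ hρ₁' hx, mem_AtFixed_of_mem_imageGraph π (hfix s) hz⟩, m,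
    -1 - Real.logb p ρ, -(1 + Real.logb p (B + 1)) / ρ, ?_, ?_⟩
  · intro t c
    have hc : (0 : ℝ) < (p : ℝ) ^ (-(ρ * c)) := by positivity
    filter_upwards [Metric.tendsto_nhds.1 (hFc.tendsto t) _ hc] with t' ht'
    rw [dist_eq_norm] at ht'
    refine hle (v := F t' - F t) ?_ ht'.le
    have h3 := (imageGraph π I).sub_mem (hF t') (hF t)
    rwa [Prod.mk_sub_mk, ← map_sub] at h3
  · intro n
    refine hle (mahler_mem_imageGraph hF n) ((hB n).trans ?_)
    have e1 : ρ * (growth p (-1 - Real.logb p ρ) n + -(1 + Real.logb p (B + 1)) / ρ) =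
        growth p (-1) n - (1 + Real.logb p (B + 1)) := by
      have e2 : growth p (-1 - Real.logb p ρ) n = growth p (-1) n / ρ := by
        rw [growth, growth]
        split_ifs
        · simp
        · rw [Real.rpow_sub hp0, Real.rpow_logb hp0 hp1.ne' hρ]; ring
      rw [e2]
      field_simp
      ring
    have e3 : (p : ℝ) ^ (-(growth p (-1) n - (1 + Real.logb p (B + 1)))) =
        (p : ℝ) ^ (1 - growth p (-1) n) * (B + 1) := by
      have : -(growth p (-1) n - (1 + Real.logb p (B + 1))) =
        (1 - growth p (-1) n) + Real.logb p (B + 1) := by ring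
      rw [this, Real.rpow_add hp0, Real.rpow_logb hp0 hp1.ne' (by linarith)]
    rw [e1, e3]
    exact mul_le_mul (norm_prod_factorial_le n) (by linarith) hB0 (by positivity)

theorem laVectors_subset_AtDagger : laVectors π C ⊆ AtDagger π := by
  rintro x ⟨ρ, hρ, ⟨hx, -⟩, -⟩
  exact ⟨ρ, hρ, hx⟩

end Comparison

end

end PeriodRings

theorem mainTheorem10 (p : ℕ) [Fact p.Prime]
    (K : IntermediateField ℚ_[p] (PadicAlgCl p)) [FiniteDimensional ℚ_[p] K]
    (π : Uniformizer K)
    (Kinf : IntermediateField K (PadicAlgCl p)) [IsGalois K Kinf]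
    (d : ℕ) (C : Coordinates p Gal(Kinf/K) d) :
    (∀ x ∈ AtDaggerK π Kinf, x ∈ laVectors π C ↔ x ∈ paVectors π C) ∧
      laVectors π C = AtDagger π ∩ paVectors π C := by
  refine ⟨fun x hx => ⟨fun h => laVectors_subset_paVectors π C h, fun h =>
    AtDagger_inter_paVectors_subset π C ⟨hx.1, h⟩⟩, Set.Subset.antisymm (fun x hx => ?_)
      (AtDagger_inter_paVectors_subset π C)⟩
  exact ⟨laVectors_subset_AtDagger π C hx, laVectors_subset_paVectors π C hx⟩
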